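/- Let $0\le r\le N$ be integers, let $\mathbb G=G(r,N)$ be the Grassmannian of $r$-dimensional subspaces of $\mathbb C^N$, and let $\mathbb P=\mathbb P^{N-1}=G(1,N)$. Let $V$ and $Q$ be the tautological subbundle and the universal quotient bundle on $\mathbb G$, let $x_1,\dots,x_r$ be the Chern roots of $V^*$, and write $$H^\bullet(\mathbb G)=\mathbb C[x_1,\dots,x_r]^{\mathfrak S_r}/\langle h_{N-r+1},\dots,h_N\rangle ,$$ where $h_k=h_k(x_1,\dots,x_r)$ is the complete symmetric polynomial; put $\sigma_1=h_1=x_1+\cdots+x_r$, and recall $c_k(Q)=h_k$. For a partition $\lambda$ in the $r\times(N-r)$ rectangle let $$\sigma_\lambda=\frac{\det(x_i^{\lambda_j+r-j})_{1\le i,j\le r}}{\det(x_i^{r-j})_{1\le i,j\le r}}\in H^\bullet(\mathbb G)$$ be the Schubert class. Let $h=c_1(\mathcal O(1))\in H^\bullet(\mathbb P)$ be the hyperplane class; thus $1,h,\dots,h^{N-1}$ is a basis of $H^\bullet(\mathbb P)$. The Satake identification is the linear map $$\mathrm{Sat}\colon \wedge^r H^\bullet(\mathbb P)\to H^\bullet(\mathbb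 G),\qquad h^{\lambda_1+r-1}\wedge h^{\lambda_2+r-2}\wedge\cdots\wedge h^{\lambda_r}\mapsto \sigma_\lambda ,$$ for $\lambda$ in the $r\times(N-r)$ rectangle. For a smooth projective variety $F$ let $\widehat\Gamma_F=\prod_{i}\Gamma(1+\delta_i)$, where the $\delta_i$ are the Chern roots of the tangent bundle $TF$ and $\Gamma(1+z)$ is expanded in its Taylor series at $z=0$ (recall $T\mathbb G=\mathrm{Hom}(V,Q)$). For a vector bundle $E$ with Chern roots $\varepsilon_j$ let $\mathrm{Ch}(E)=\sum_j e^{2\pi \mathtt i\,\varepsilon_j}$. Let $S^\nu$ be the Schur functor of a partition $\nu$. Then for every partition $N-r\ge\nu_1\ge\nu_2\ge\cdots\ge\nu_r\ge0$, $$\widehat\Gamma_{\mathbb G}\,\mathrm{Ch}(S^\nu V^*)=(2\pi\mathtt i)^{-\binom r2}\,e^{-(r-1)\pi\mathtt i\,\sigma_1}\;\mathrm{Sat}\Bigl(\widehat\Gamma_{\mathbb P}\mathrm{Ch}(\mathcal O(\nu_1+r-1))\wedge\widehat\Gamma_{\mathbb P}\mathrm{Ch}(\mathcal O(\nu_2+r-2))\wedge\cdots\wedge\widehat\Gamma_{\mathbb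 P}\mathrm{Ch}(\mathcal O(\nu_r))\Bigr)$$ in $H^\bullet(\mathbb G)$. -/

import Mathlib

open scoped TensorProduct

noncomputable section

namespace GammaGrassmannian

/-! ### Cohomology of the Grassmannian `G(r,N)` -/

/-- Symmetric polynomials in `x_1, …, x_r` (the Chern roots of the dual `V^*` of the
tautological bundle). -/
abbrev SymPoly (r : ℕ) : Type :=
  MvPolynomial.symmetricSubalgebra (Fin r) ℂ

/-- The complete symmetric polynomial `h_k(x_1, …, x_r)`. -/
def hSym (r k : ℕ) : SymPoly r :=
  ⟨MvPolynomial.hsymm (Fin r) ℂ k, MvPolynomial.hsymm_isSymmetric (Fin r) ℂ k⟩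

/-- The ideal `⟨h_{N-r+1}, …, h_N⟩`. -/
def relIdeal (r N : ℕ) : Ideal (SymPoly r) :=
  Ideal.span {f | ∃ k : ℕ, N + 1 ≤ k + r ∧ k ≤ N ∧ f = hSym r k}

/-- `H(G(r,N)) = ℂ[x_1, …, x_r]^{S_r} / ⟨h_{N-r+1}, …, h_N⟩`.
In particular `HG 1 N` is the cohomology of the projective space `ℙ^{N-1} = G(1,N)`. -/
abbrev HG (r N : ℕ) : Type := SymPoly r ⧸ relIdeal r N

/-- The cohomology class of a symmetric polynomial in the Chern roots of `V^*`. -/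
def toHG (r N : ℕ) (f : SymPoly r) : HG r N := Ideal.Quotient.mk (relIdeal r N) f

/-- The special Schubert class `σ_k = h_k(x_1, …, x_r) = c_k(Q)`. For `r = 1`, `k = 1` this is
the hyperplane class of `ℙ^{N-1}`. -/
def specialClass (r N k : ℕ) : HG r N := toHG r N (hSym r k)

/-! ### Schur polynomials and Schubert classes -/

/-- The matrix `(x_i ^ {a_j})`. -/
def alternant (r : ℕ) (a : Fin r → ℕ) : Matrix (Fin r) (Fin r) (MvPolynomial (Fin r) ℂ) :=
  Matrix.of fun i j => MvPolynomial.X i ^ a j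

theorem rename_det_alternant {r : ℕ} (a : Fin r → ℕ) (e : Equiv.Perm (Fin r)) :
    MvPolynomial.rename e (alternant r a).det
      = ((Equiv.Perm.sign e : ℤ) : MvPolynomial (Fin r) ℂ) * (alternant r a).det := by
  rw [← Matrix.det_permute, AlgHom.map_det]
  congr 1
  ext1 i j
  simp [alternant]

theorem det_alternant_rev_ne_zero (r : ℕ) :
    (alternant r (fun j => (j.rev : ℕ))).det ≠ 0 := by
  have h : alternant r (fun j => (j.rev : ℕ))
      = (Matrix.vandermonde (fun i : Fin r => (MvPolynomial.X i : MvPolynomial (Fin r) ℂ))).submatrix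
        id Fin.revPerm := by
    ext1 i j
    simp [alternant, Matrix.vandermonde_apply]
  rw [h, Matrix.det_permute']
  refine mul_ne_zero ?_ ?_
  · rcases Int.units_eq_one_or (Equiv.Perm.sign (Fin.revPerm : Equiv.Perm (Fin r))) with h | h <;>
      simp [h]
  · exact Matrix.det_vandermonde_ne_zero_iff.2 (MvPolynomial.X_injective)

/-- `det (x_i ^ {r-j})` divides `det (x_i ^ {a_j})`. -/
theorem det_alternant_dvd {r : ℕ} (a : Fin r → ℕ) :
    (alternant r (fun j => (j.rev : ℕ))).det ∣ (alternant r a).det := by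
  classical
  let P : Polynomial (MvPolynomial (Fin r) ℂ) :=
    ∏ i : Fin r, (Polynomial.X - Polynomial.C (MvPolynomial.X i))
  have hP : P.Monic := Polynomial.monic_prod_of_monic _ _ fun i _ => Polynomial.monic_X_sub_C _
  have hdeg : P.natDegree = r := by simp [P]
  have hroot : ∀ i : Fin r, P.eval (MvPolynomial.X i) = 0 := fun i => by
    simp only [P, Polynomial.eval_prod]
    exact Finset.prod_eq_zero (Finset.mem_univ i) (by simp)
  let p : Fin r → Polynomial (MvPolynomial (Fin r) ℂ) := fun j =>
    (Polynomial.X ^ a j) %ₘ P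
  have heval : ∀ i j, (p j).eval (MvPolynomial.X i) = MvPolynomial.X i ^ a j := fun i j => by
    have h := congrArg (Polynomial.eval (MvPolynomial.X i : MvPolynomial (Fin r) ℂ))
      (Polynomial.modByMonic_add_div (Polynomial.X ^ a j) P)
    simpa [hroot i] using h
  have hlt : ∀ j, (p j).natDegree < r ∨ p j = 0 := fun j => by
    by_cases h0 : p j = 0
    · exact Or.inr h0
    · left
      have h := Polynomial.degree_modByMonic_lt (Polynomial.X ^ a j) hP
      exact (Polynomial.natDegree_lt_natDegree h0 h).trans_eq hdeg
  let Cm : Matrix (Fin r) (Fin r) (MvPolynomial (Fin r) ℂ) :=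
    Matrix.of fun k j => (p j).coeff (k.rev : ℕ)
  refine ⟨Cm.det, ?_⟩
  rw [← Matrix.det_mul]
  congr 1
  ext1 i j
  rw [Matrix.mul_apply]
  simp only [alternant, Matrix.of_apply, Cm]
  rw [← heval i j]
  have h1 : (p j).eval (MvPolynomial.X i : MvPolynomial (Fin r) ℂ)
      = ∑ k ∈ Finset.range r, (p j).coeff k * MvPolynomial.X i ^ k := by
    rcases hlt j with h | h
    · exact Polynomial.eval_eq_sum_range' h _
    · simp [h]
  rw [h1, ← Fin.sum_univ_eq_sum_range (fun k => (p j).coeff k * MvPolynomial.X i ^ k) r]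
  rw [← Equiv.sum_comp Fin.revPerm]
  exact Finset.sum_congr rfl fun k _ => by simp [mul_comm]

/-- The Schur polynomial
`σ_λ(x_1, …, x_r) = det (x_i ^ {λ_j + r - j}) / det (x_i ^ {r - j})`. -/
def schurPoly {r : ℕ} (l : Fin r → ℕ) : MvPolynomial (Fin r) ℂ :=
  Classical.choose (det_alternant_dvd fun j => l j + (j.rev : ℕ))

theorem schurPoly_spec {r : ℕ} (l : Fin r → ℕ) :
    (alternant r fun j => l j + (j.rev : ℕ)).det
      = (alternant r fun j => (j.rev : ℕ)).det * schurPoly l :=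
  Classical.choose_spec (det_alternant_dvd fun j => l j + (j.rev : ℕ))

theorem schurPoly_isSymmetric {r : ℕ} (l : Fin r → ℕ) : (schurPoly l).IsSymmetric := by
  intro e
  have h := congrArg (MvPolynomial.rename e) (schurPoly_spec l)
  rw [map_mul, rename_det_alternant, rename_det_alternant, schurPoly_spec l, mul_assoc] at h
  have hs : ((Equiv.Perm.sign e : ℤ) : MvPolynomial (Fin r) ℂ) ≠ 0 := by
    rcases Int.units_eq_one_or (Equiv.Perm.sign e) with h | h <;> simp [h]
  exact (mul_left_cancel₀ (det_alternant_rev_ne_zero r) (mul_left_cancel₀ hs h)).symm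

/-- The Schubert class `σ_λ`. -/
def schubertClass {r : ℕ} (N : ℕ) (l : Fin r → ℕ) : HG r N :=
  toHG r N ⟨schurPoly l, schurPoly_isSymmetric l⟩

/-! ### The Satake identification -/

theorem hSym_one_eq_pow (k : ℕ) : hSym 1 k = hSym 1 1 ^ k := by
  apply Subtype.ext
  have h : ∀ k : ℕ, MvPolynomial.hsymm (Fin 1) ℂ k = MvPolynomial.X 0 ^ k := fun k => by
    rw [MvPolynomial.hsymm, Fintype.sum_unique]
    have hs : ((default : Sym (Fin 1) k) : Multiset (Fin 1)) = Multiset.replicate k 0 := by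
      rw [Multiset.eq_replicate]
      exact ⟨(default : Sym (Fin 1) k).2, fun b _ => Subsingleton.elim _ _⟩
    change (((default : Sym (Fin 1) k) : Multiset (Fin 1)).map _).prod = _
    rw [hs]
    simp
  simp [hSym, h]

theorem relIdeal_one (N : ℕ) : relIdeal 1 N = Ideal.span {hSym 1 1 ^ N} := by
  rw [relIdeal, ← hSym_one_eq_pow]
  congr 1
  ext f
  constructor
  · rintro ⟨k, h1, h2, rfl⟩
    obtain rfl : k = N := by omega
    rfl
  · rintro rfl
    exact ⟨N, le_rfl, le_rfl, rfl⟩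

theorem aeval_hSym_one_bijective :
    Function.Bijective (Polynomial.aeval (R := ℂ) (hSym 1 1)) := by
  have h : ∀ f : Polynomial ℂ, ((Polynomial.aeval (hSym 1 1) f : SymPoly 1) :
      MvPolynomial (Fin 1) ℂ) = (MvPolynomial.uniqueAlgEquiv ℂ (Fin 1)).symm f := by
    have h' : ((MvPolynomial.symmetricSubalgebra (Fin 1) ℂ).val).comp
        (Polynomial.aeval (hSym 1 1))
        = ((MvPolynomial.uniqueAlgEquiv ℂ (Fin 1)).symm : Polynomial ℂ →ₐ[ℂ] _) := by
      ext1
      simp [hSym, MvPolynomial.uniqueAlgEquiv]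
    exact fun f => DFunLike.congr_fun h' f
  constructor
  · intro f g hfg
    apply (MvPolynomial.uniqueAlgEquiv ℂ (Fin 1)).symm.injective
    rw [← h, ← h, hfg]
  · intro f
    refine ⟨MvPolynomial.uniqueAlgEquiv ℂ (Fin 1) f, Subtype.ext ?_⟩
    rw [h, AlgEquiv.symm_apply_apply]

/-- The classes `1, h, …, h^{N-1}` form a basis of the cohomology of `ℙ^{N-1}`. -/
theorem exists_hyperplaneBasis (N : ℕ) :
    ∃ b : Module.Basis (Fin N) ℂ (HG 1 N), ∀ k, b k = specialClass 1 N 1 ^ (k : ℕ) := by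
  let e : Polynomial ℂ ≃ₐ[ℂ] SymPoly 1 :=
    AlgEquiv.ofBijective (Polynomial.aeval (hSym 1 1)) aeval_hSym_one_bijective
  have heX : e Polynomial.X = hSym 1 1 := Polynomial.aeval_X _
  have hI : relIdeal 1 N
      = (Ideal.span {(Polynomial.X : Polynomial ℂ) ^ N}).map (e : Polynomial ℂ →+* SymPoly 1) := by
    rw [relIdeal_one, Ideal.map_span, Set.image_singleton, map_pow]
    simp [heX]
  let E : AdjoinRoot ((Polynomial.X : Polynomial ℂ) ^ N) ≃ₐ[ℂ] HG 1 N :=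
    Ideal.quotientEquivAlg _ _ e hI
  have hm : ((Polynomial.X : Polynomial ℂ) ^ N).Monic := Polynomial.monic_X_pow N
  have hdim : (AdjoinRoot.powerBasis' hm).dim = N := by simp
  refine ⟨((AdjoinRoot.powerBasis' hm).basis.reindex (finCongr hdim)).map E.toLinearEquiv,
    fun k => ?_⟩
  have hr : E (AdjoinRoot.root ((Polynomial.X : Polynomial ℂ) ^ N)) = specialClass 1 N 1 := by
    change Ideal.Quotient.mk _ (e Polynomial.X) = _
    rw [heX]
    rfl
  simp [hr]

/-- The basis `1, h, …, h^{N-1}` of the cohomology of `ℙ^{N-1}`. -/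
def hyperplaneBasis (N : ℕ) : Module.Basis (Fin N) ℂ (HG 1 N) :=
  Classical.choose (exists_hyperplaneBasis N)

theorem hyperplaneBasis_apply (N : ℕ) (k : Fin N) :
    hyperplaneBasis N k = specialClass 1 N 1 ^ (k : ℕ) :=
  Classical.choose_spec (exists_hyperplaneBasis N) k

/-- The induced basis of `⋀^r H(ℙ^{N-1})`: the wedges `h^{a_1} ∧ ⋯ ∧ h^{a_r}` with
`a_1 > ⋯ > a_r`. The index type carries the reversed order so that exponents decrease. -/
def wedgeBasis (r N : ℕ) :
    Module.Basis (Set.powersetCard (Fin N)ᵒᵈ r) ℂ (⋀[ℂ]^r (HG 1 N)) :=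
  ((hyperplaneBasis N).reindex OrderDual.toDual).exteriorPower r

/-- The exponents `a_1 > ⋯ > a_r` of an element of `wedgeBasis`. -/
def wedgeExponents {r N : ℕ} (s : Set.powersetCard (Fin N)ᵒᵈ r) (j : Fin r) : ℕ :=
  (OrderDual.ofDual (Set.powersetCard.ofFinEmbEquiv.symm s j) : Fin N)

/-- The Satake identification `⋀^r H(ℙ^{N-1}) → H(G(r,N))`: the linear map with
`h^{λ_1 + r - 1} ∧ h^{λ_2 + r - 2} ∧ ⋯ ∧ h^{λ_r} ↦ σ_λ` (see `satake_wedge`). -/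
def satake (r N : ℕ) : ⋀[ℂ]^r (HG 1 N) →ₗ[ℂ] HG r N :=
  (wedgeBasis r N).constr ℂ fun s =>
    schubertClass N fun j => wedgeExponents s j - (j.rev : ℕ)

theorem satake_wedge {r N : ℕ} (hrN : r ≤ N) (l : Fin r → ℕ) (hl : Antitone l)
    (hbox : ∀ j, l j ≤ N - r) :
    satake r N (exteriorPower.ιMulti ℂ r
      fun j : Fin r => specialClass 1 N 1 ^ (l j + (j.rev : ℕ))) = schubertClass N l := by
  have hlt : ∀ j : Fin r, l j + (j.rev : ℕ) < N := fun j => by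
    have h1 := hbox j
    have h2 := j.rev.isLt
    omega
  let f : Fin r ↪o (Fin N)ᵒᵈ := OrderEmbedding.ofStrictMono
    (fun j => OrderDual.toDual ⟨l j + (j.rev : ℕ), hlt j⟩) (by
      intro i j hij
      have h1 := hl hij.le
      have h2 : (i : ℕ) < j := hij
      have h3 := j.isLt
      change l j + (j.rev : ℕ) < l i + (i.rev : ℕ)
      simp only [Fin.val_rev]
      omega)
  have hs : wedgeBasis r N (Set.powersetCard.ofFinEmbEquiv f)
      = exteriorPower.ιMulti ℂ r
        fun j : Fin r => specialClass 1 N 1 ^ (l j + (j.rev : ℕ)) := by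
    rw [wedgeBasis, exteriorPower.basis_apply]
    simp only [exteriorPower.ιMulti_family, Equiv.symm_apply_apply]
    congr 1
    ext1 j
    simp [hyperplaneBasis_apply, f]
  rw [← hs, satake, Module.Basis.constr_basis]
  congr 1
  ext j
  simp [wedgeExponents, f]

/-! ### Characteristic classes -/

/-- The part of degree at most `D` in the `δ_p` of `∏_p φ(δ_p)`, for a power series `φ`. -/
def truncProd {A ι : Type*} [CommRing A] [Algebra ℂ A] [Fintype ι] [DecidableEq ι]
    (φ : PowerSeries ℂ) (δ : ι → A) (D : ℕ) : A :=
  ∑ d ∈ Finset.range (D + 1), ∑ a ∈ Finset.piAntidiag (Finset.univ : Finset ι) d,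
    ∏ p, (PowerSeries.coeff (a p) φ) • δ p ^ a p

theorem map_truncProd {A B ι : Type*} [CommRing A] [Algebra ℂ A] [CommRing B] [Algebra ℂ B]
    [Fintype ι] [DecidableEq ι] (F : A →ₐ[ℂ] B) (φ : PowerSeries ℂ) (δ : ι → A) (D : ℕ) :
    F (truncProd φ δ D) = truncProd φ (fun p => F (δ p)) D := by
  simp [truncProd, map_sum, map_prod]

theorem truncProd_comp {A ι : Type*} [CommRing A] [Algebra ℂ A] [Fintype ι] [DecidableEq ι]
    (φ : PowerSeries ℂ) (δ : ι → A) (D : ℕ) (e : Equiv.Perm ι) :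
    truncProd φ (fun p => δ (e p)) D = truncProd φ δ D := by
  unfold truncProd
  refine Finset.sum_congr rfl fun d _ => ?_
  refine Finset.sum_nbij' (fun a => a ∘ e.symm) (fun a => a ∘ e) ?_ ?_ ?_ ?_ ?_
  · intro a ha
    simp only [Finset.mem_piAntidiag, Finset.mem_univ, implies_true, and_true] at ha ⊢
    rw [← ha]
    exact Equiv.sum_comp e.symm a
  · intro a ha
    simp only [Finset.mem_piAntidiag, Finset.mem_univ, implies_true, and_true] at ha ⊢
    rw [← ha]
    exact Equiv.sum_comp e a
  · intro a _
    ext p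
    simp
  · intro a _
    ext p
    simp
  · intro a _
    rw [← Equiv.prod_comp e (fun p => (PowerSeries.coeff ((a ∘ e.symm) p) φ) •
      δ p ^ (a ∘ e.symm) p)]
    simp

/-- The Taylor series of `Γ(1 + z)` at `z = 0`. -/
def gammaSeries : PowerSeries ℂ :=
  PowerSeries.mk fun n => iteratedDeriv n Complex.Gamma 1 / (n.factorial : ℂ)

/-- The part of degree at most `D` of `e^a`, for a class `a` of degree two. -/
def truncExp {A : Type*} [CommRing A] [Algebra ℂ A] (D : ℕ) (a : A) : A :=
  ∑ k ∈ Finset.range (D + 1), ((k.factorial : ℂ)⁻¹) • a ^ k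

theorem map_truncExp {A B : Type*} [CommRing A] [Algebra ℂ A] [CommRing B] [Algebra ℂ B]
    (F : A →ₐ[ℂ] B) (D : ℕ) (a : A) : F (truncExp D a) = truncExp D (F a) := by
  simp [truncExp, map_sum]

/-! ### The Gamma class of the Grassmannian -/

/-- Evaluation of a symmetric polynomial in `y_1, …, y_m` (with coefficients in
`ℂ[x_1, …, x_r]`) at the Chern roots `y_1, …, y_m` of the universal quotient bundle `Q`, whose
Chern classes are `e_k(y) = c_k(Q) = h_k(x)`: a symmetric polynomial is written as a polynomial in
the elementary symmetric polynomials `e_k(y)`, and `h_k(x)` is substituted for `e_k(y)`. -/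
def evalQuotientRoots (r m : ℕ) :
    MvPolynomial.symmetricSubalgebra (Fin m) (MvPolynomial (Fin r) ℂ)
      →ₐ[MvPolynomial (Fin r) ℂ] MvPolynomial (Fin r) ℂ :=
  (MvPolynomial.aeval fun k : Fin m => MvPolynomial.hsymm (Fin r) ℂ (k + 1)).comp
    (MvPolynomial.esymmAlgEquiv (Fin m) (MvPolynomial (Fin r) ℂ)
      (Fintype.card_fin m)).symm.toAlgHom

/-- The Chern roots `x_i + y_j` of the tangent bundle `T G(r,N) = Hom(V, Q) = V^* ⊗ Q`, where
`x_i` and `y_j` are the Chern roots of `V^*` and of `Q`. -/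
def tangentRoot {r m : ℕ} (p : Fin r × Fin m) : MvPolynomial (Fin m) (MvPolynomial (Fin r) ℂ) :=
  MvPolynomial.C (MvPolynomial.X p.1) + MvPolynomial.X p.2

/-- `∏ Γ(1 + δ)` over the Chern roots `δ` of the tangent bundle of `G(r, r + m)`, up to degree
`r m = dim G(r, r + m)`. -/
def gammaRoots (r m : ℕ) : MvPolynomial (Fin m) (MvPolynomial (Fin r) ℂ) :=
  truncProd gammaSeries (tangentRoot (r := r) (m := m)) (r * m)

theorem gammaRoots_isSymmetric (r m : ℕ) : (gammaRoots r m).IsSymmetric := by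
  intro e
  have h := map_truncProd ((MvPolynomial.rename e : MvPolynomial (Fin m) (MvPolynomial (Fin r) ℂ)
    →ₐ[MvPolynomial (Fin r) ℂ] _).restrictScalars ℂ) gammaSeries
    (tangentRoot (r := r) (m := m)) (r * m)
  rw [AlgHom.restrictScalars_apply] at h
  rw [gammaRoots, h, ← truncProd_comp gammaSeries tangentRoot (r * m)
    (Equiv.prodCongr (Equiv.refl (Fin r)) e)]
  congr 1
  ext1 p
  simp [tangentRoot]

/-- The Gamma class of `G(r, r + m)` as a polynomial in the Chern roots of `V^*`. -/
def gammaPoly (r m : ℕ) : MvPolynomial (Fin r) ℂ :=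
  evalQuotientRoots r m ⟨gammaRoots r m, gammaRoots_isSymmetric r m⟩

theorem map_aeval_of_fixed {K B ι : Type*} [CommRing K] [CommRing B] [Algebra K B]
    (ρ : K →+* K) (ψ : B →+* B) (hc : ∀ k, ψ (algebraMap K B k) = algebraMap K B (ρ k))
    (b : ι → B) (hb : ∀ i, ψ (b i) = b i) (q : MvPolynomial ι K) :
    ψ (MvPolynomial.aeval b q) = MvPolynomial.aeval b (MvPolynomial.map ρ q) := by
  induction q using MvPolynomial.induction_on with
  | C k => simp [hc]
  | add p q hp hq => simp [hp, hq]
  | mul_X p i hp => simp [hp, hb]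

theorem gammaPoly_isSymmetric (r m : ℕ) : (gammaPoly r m).IsSymmetric := by
  intro e
  let E := MvPolynomial.esymmAlgEquiv (Fin m) (MvPolynomial (Fin r) ℂ) (Fintype.card_fin m)
  let G : MvPolynomial.symmetricSubalgebra (Fin m) (MvPolynomial (Fin r) ℂ) :=
    ⟨gammaRoots r m, gammaRoots_isSymmetric r m⟩
  let ρ : MvPolynomial (Fin r) ℂ →+* MvPolynomial (Fin r) ℂ :=
    (MvPolynomial.rename e : MvPolynomial (Fin r) ℂ →ₐ[ℂ] MvPolynomial (Fin r) ℂ)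
  let q : MvPolynomial (Fin m) (MvPolynomial (Fin r) ℂ) := E.symm G
  have hE : ∀ p, ((E p : MvPolynomial.symmetricSubalgebra (Fin m) (MvPolynomial (Fin r) ℂ)) :
      MvPolynomial (Fin m) (MvPolynomial (Fin r) ℂ))
      = MvPolynomial.aeval (fun i : Fin m => MvPolynomial.esymm (Fin m) _ (i + 1)) p := fun p =>
    MvPolynomial.esymmAlgHom_apply p
  have hG : MvPolynomial.map ρ (gammaRoots r m) = gammaRoots r m := by
    have h := map_truncProd (MvPolynomial.mapAlgHom (σ := Fin m)
      (MvPolynomial.rename e : MvPolynomial (Fin r) ℂ →ₐ[ℂ] MvPolynomial (Fin r) ℂ)) gammaSeries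
      (tangentRoot (r := r) (m := m)) (r * m)
    rw [MvPolynomial.mapAlgHom_apply] at h
    refine h.trans ?_
    rw [gammaRoots, ← truncProd_comp gammaSeries tangentRoot (r * m)
      (Equiv.prodCongr e (Equiv.refl (Fin m)))]
    congr 1
    ext1 p
    simp [tangentRoot]
  have hq : MvPolynomial.map ρ q = q := by
    apply E.injective
    apply Subtype.ext
    have h1 : ((E q : MvPolynomial.symmetricSubalgebra (Fin m) (MvPolynomial (Fin r) ℂ)) :
      MvPolynomial (Fin m) (MvPolynomial (Fin r) ℂ)) = gammaRoots r m := by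
      simp [q, G]
    rw [h1, ← hG, ← h1, hE, hE]
    refine (map_aeval_of_fixed ρ (MvPolynomial.map ρ) (fun k => ?_) _ (fun i => ?_) q).symm
    · rw [MvPolynomial.algebraMap_eq, MvPolynomial.map_C]
    · exact MvPolynomial.map_esymm _ _ _ _
  change ρ (MvPolynomial.aeval (fun k : Fin m => MvPolynomial.hsymm (Fin r) ℂ (k + 1)) q)
    = MvPolynomial.aeval (fun k : Fin m => MvPolynomial.hsymm (Fin r) ℂ (k + 1)) q
  rw [map_aeval_of_fixed ρ ρ (fun k => rfl) _ (fun i => MvPolynomial.rename_hsymm _ _ _ e) q, hq]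

/-- The Gamma class of `G(r,N)`. -/
def gammaClass (r N : ℕ) : HG r N :=
  toHG r N ⟨gammaPoly r (N - r), gammaPoly_isSymmetric r (N - r)⟩

/-! ### Schur functors and the bundles `S^ν V^*` -/

/-- The boxes of the Young diagram with rows of lengths `ν_1, …, ν_r`. -/
abbrev Boxes {r : ℕ} (ν : Fin r → ℕ) : Type := Σ i : Fin r, Fin (ν i)

/-- The permutations of the boxes that preserve each row. -/
abbrev RowPerm {r : ℕ} (ν : Fin r → ℕ) : Type :=
  {p : Equiv.Perm (Boxes ν) // ∀ c, (p c).1 = c.1}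

/-- The permutations of the boxes that preserve each column. -/
abbrev ColPerm {r : ℕ} (ν : Fin r → ℕ) : Type :=
  {q : Equiv.Perm (Boxes ν) // ∀ c, ((q c).2 : ℕ) = (c.2 : ℕ)}

/-- The Young symmetrizer `∑_{p, q} sgn(q) p q` (`p` preserving rows, `q` preserving columns)
acting on the tensor power `W^{⊗ |ν|}`, whose factors are indexed by the boxes of `ν`. -/
def youngSymmetrizer {r : ℕ} (ν : Fin r → ℕ) (W : Type*) [AddCommGroup W] [Module ℂ W] :
    Module.End ℂ (⨂[ℂ] _ : Boxes ν, W) :=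
  ∑ p : RowPerm ν, ∑ q : ColPerm ν, ((Equiv.Perm.sign q.1 : ℤ) : ℂ) •
    ((PiTensorProduct.reindex ℂ (fun _ : Boxes ν => W) p.1).toLinearMap ∘ₗ
      (PiTensorProduct.reindex ℂ (fun _ : Boxes ν => W) q.1).toLinearMap)

/-- The Schur functor `S^ν` on vector spaces: the image of the Young symmetrizer on
`W^{⊗ |ν|}`; a linear endomorphism `g` of `W` acts through `g^{⊗ |ν|}`. -/
def schurFunctor {r : ℕ} (ν : Fin r → ℕ) (W : Type*) [AddCommGroup W] [Module ℂ W] :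
    Submodule ℂ (⨂[ℂ] _ : Boxes ν, W) :=
  LinearMap.range (youngSymmetrizer ν W)

/-- The action of the diagonal matrix `diag(t_1, …, t_r)` on `(ℂ^r)^{⊗ |ν|}`. -/
def torusAction {r : ℕ} (ν : Fin r → ℕ) (t : Fin r → ℂˣ) :
    Module.End ℂ (⨂[ℂ] _ : Boxes ν, (Fin r → ℂ)) :=
  PiTensorProduct.map fun _ => Matrix.toLin' (Matrix.diagonal fun i => (t i : ℂ))

/-- The subspace of weight `μ` of `S^ν(ℂ^r)`, on which `diag(t_1, …, t_r)` acts by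
`t_1^{μ_1} ⋯ t_r^{μ_r}`. -/
def schurWeightSpace {r : ℕ} (ν μ : Fin r → ℕ) :
    Submodule ℂ (⨂[ℂ] _ : Boxes ν, (Fin r → ℂ)) :=
  schurFunctor ν (Fin r → ℂ) ⊓
    ⨅ t : Fin r → ℂˣ, Module.End.eigenspace (torusAction ν t) (∏ i, (t i : ℂ) ^ μ i)

/-- The multiplicity of the weight `μ` in `S^ν(ℂ^r)`. -/
def weightMult {r : ℕ} (ν μ : Fin r → ℕ) : ℕ :=
  Module.finrank ℂ (schurWeightSpace ν μ)

theorem weightMult_le_comp {r : ℕ} (ν μ : Fin r → ℕ) (e : Equiv.Perm (Fin r)) :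
    weightMult ν μ ≤ weightMult ν (μ ∘ e) := by
  let π : (Fin r → ℂ) ≃ₗ[ℂ] (Fin r → ℂ) := LinearEquiv.funCongrLeft ℂ ℂ e
  let T : (⨂[ℂ] _ : Boxes ν, (Fin r → ℂ)) ≃ₗ[ℂ] (⨂[ℂ] _ : Boxes ν, (Fin r → ℂ)) :=
    PiTensorProduct.congr fun _ => π
  have hT : ∀ w : Boxes ν → Fin r → ℂ,
      T (PiTensorProduct.tprod ℂ w) = PiTensorProduct.tprod ℂ fun c => π (w c) := fun w =>
    PiTensorProduct.congr_tprod _ w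
  have hreindex : ∀ (p : Equiv.Perm (Boxes ν)) x,
      PiTensorProduct.reindex ℂ (fun _ : Boxes ν => (Fin r → ℂ)) p (T x)
        = T (PiTensorProduct.reindex ℂ (fun _ : Boxes ν => (Fin r → ℂ)) p x) := fun p x => by
    induction x using PiTensorProduct.induction_on with
    | smul_tprod a w => simp only [map_smul, hT, PiTensorProduct.reindex_tprod]
    | add x y hx hy => simp only [map_add, hx, hy]
  have hyoung : ∀ x, youngSymmetrizer ν (Fin r → ℂ) (T x)
      = T (youngSymmetrizer ν (Fin r → ℂ) x) := fun x => by
    simp only [youngSymmetrizer, LinearMap.sum_apply, LinearMap.smul_apply,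
      LinearMap.comp_apply, LinearEquiv.coe_coe, map_sum, map_smul]
    simp only [hreindex]
  have htorus : ∀ (t : Fin r → ℂˣ) x,
      torusAction ν t (T x) = T (torusAction ν (t ∘ e.symm) x) := fun t x => by
    induction x using PiTensorProduct.induction_on with
    | smul_tprod a w =>
      simp only [map_smul, hT, torusAction, PiTensorProduct.map_tprod]
      congr 2
      ext1 c
      ext1 i
      simp [π, LinearEquiv.funCongrLeft_apply, Matrix.mulVec_diagonal, LinearMap.funLeft_apply]
    | add x y hx hy => simp only [map_add, hx, hy]
  rw [weightMult, weightMult, ← LinearEquiv.finrank_map_eq T]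
  apply Submodule.finrank_mono
  rintro _ ⟨x, hx, rfl⟩
  rw [schurWeightSpace, SetLike.mem_coe, Submodule.mem_inf, Submodule.mem_iInf] at hx
  rw [schurWeightSpace, Submodule.mem_inf, Submodule.mem_iInf]
  refine ⟨?_, fun t => ?_⟩
  · obtain ⟨y, hy⟩ := hx.1
    exact ⟨T y, by rw [hyoung, hy]; rfl⟩
  · have h := hx.2 (t ∘ e.symm)
    rw [Module.End.mem_eigenspace_iff] at h ⊢
    change torusAction ν t (T x) = _ • T x
    rw [htorus, h, map_smul]
    congr 1
    rw [← Equiv.prod_comp e]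
    simp

theorem weightMult_comp {r : ℕ} (ν μ : Fin r → ℕ) (e : Equiv.Perm (Fin r)) :
    weightMult ν (μ ∘ e) = weightMult ν μ := by
  refine le_antisymm ?_ (weightMult_le_comp ν μ e)
  have h := weightMult_le_comp ν (μ ∘ e) e.symm
  rwa [Function.comp_assoc, Equiv.self_comp_symm, Function.comp_id] at h

/-- The modified Chern character `Ch(S^ν V^*) = ∑_δ e^{2πi δ}` of the bundle `S^ν V^*` on
`G(r,N)`, up to degree `D`, as a polynomial in the Chern roots `x_1, …, x_r` of `V^*`.
When `V^*` splits into line bundles `L_1, …, L_r`, the bundle `S^ν V^*` is the sum over the weights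
`μ` of `S^ν(ℂ^r)` (with multiplicity) of `L_1^{μ_1} ⊗ ⋯ ⊗ L_r^{μ_r}`, so that its Chern roots are
the `μ_1 x_1 + ⋯ + μ_r x_r`. All weights satisfy `μ_1 + ⋯ + μ_r = |ν|`. -/
def chSchurPoly {r : ℕ} (ν : Fin r → ℕ) (D : ℕ) : MvPolynomial (Fin r) ℂ :=
  ∑ μ ∈ Finset.piAntidiag (Finset.univ : Finset (Fin r)) (∑ i, ν i),
    (weightMult ν μ : ℂ) •
      truncExp D ((2 * Real.pi * Complex.I : ℂ) • ∑ i, (μ i : ℂ) • MvPolynomial.X i)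

theorem chSchurPoly_isSymmetric {r : ℕ} (ν : Fin r → ℕ) (D : ℕ) :
    (chSchurPoly ν D).IsSymmetric := by
  intro e
  simp only [chSchurPoly, map_sum, map_smul, map_truncExp, MvPolynomial.rename_X]
  refine Finset.sum_nbij' (fun a => a ∘ e.symm) (fun a => a ∘ e) ?_ ?_ ?_ ?_ ?_
  · intro a ha
    simp only [Finset.mem_piAntidiag, Finset.mem_univ, implies_true, and_true] at ha ⊢
    rw [← ha]
    exact Equiv.sum_comp e.symm a
  · intro a ha
    simp only [Finset.mem_piAntidiag, Finset.mem_univ, implies_true, and_true] at ha ⊢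
    rw [← ha]
    exact Equiv.sum_comp e a
  · intro a _
    ext p
    simp
  · intro a _
    ext p
    simp
  · intro a _
    rw [weightMult_comp, ← Equiv.sum_comp e (fun i => ((a ∘ e.symm) i : ℂ) •
      (MvPolynomial.X i : MvPolynomial (Fin r) ℂ))]
    simp

/-- `Ch(S^ν V^*)` in the cohomology of `G(r,N)`; the dimension of `G(r,N)` is `r (N - r)`. -/
def chSchurBundle {r : ℕ} (N : ℕ) (ν : Fin r → ℕ) : HG r N :=
  toHG r N ⟨chSchurPoly ν (r * (N - r)), chSchurPoly_isSymmetric ν (r * (N - r))⟩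

/-- `Ch(O(k)) = e^{2πi k h}` in the cohomology of `ℙ^{N-1}`. -/
def chO (N : ℕ) (k : ℤ) : HG 1 N :=
  truncExp (N - 1) ((2 * Real.pi * Complex.I * k : ℂ) • specialClass 1 N 1)

end GammaGrassmannian

end

open scoped TensorProduct

noncomputable section

namespace GammaGrassmannian

/-! The identity is checked after pulling back to ℂ[x_1, …, x_r]/⟨h_{N-r+1}, …, h_N⟩ and multiplying
by the Vandermonde determinant Δ = det(x_i^{r-j}). Nothing is lost: antisymmetrization recovers a
symmetric f modulo the relations from Δ f (`mem_relIdeal_of_vand_mul_mem`,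
`eq_of_vand_mul_pullback_eq`). In exchange the Satake map becomes a determinant, Δ · Sat(u_1 ∧ … ∧
u_r) = det(u_j(x_i)) (`vand_mul_pullback_satake`): both sides are alternating in the u_j, and on
powers of h this is the bialternant definition of σ_λ.

For the classes in the theorem the matrix entries are Γ(1 + x_i)^N e^{2πi(ν_j + r - j)x_i}. The
Gamma factors come out of the rows, and the alternant left over in the variables e^{2πi x_i} is
s_ν(e^{2πi x}) ∏_{i<j} (e^{2πi x_i} - e^{2πi x_j}). By the reflection formula
(`scaledSeries_gamma_reflection`) each difference is 2πi (x_i - x_j) e^{πi(x_i + x_j)} / (Γ(1 + x_i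
- x_j) Γ(1 - x_i + x_j)). The product over pairs supplies the power of 2πi, the factor Δ, the
exponential of (r-1)πi σ_1, and 1/∏_{i,k} Γ(1 + x_i - x_k) (`det_expSeries`, `det_scaledSeries`).

Two identifications remain. From 0 → V → ℂ^N → Q → 0, the tangent bundle plus Hom(V,V) is Hom(V,
ℂ^N) in K-theory, so the Gamma class of the Grassmannian is ∏_i Γ(1 + x_i)^N / ∏_{i,k} Γ(1 + x_i -
x_k) (`toFlagRing_gammaPoly`). And Ch(S^ν V^*) is the character χ of S^ν(ℂ^r) at e^{2πi x_i}, which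
must be the Schur polynomial: this is the Weyl character formula (`vand_mul_schurCharacter`), proved
here for the image of the Young symmetrizer. The Casimir element acts on S^ν by a scalar, by a
Garnir relation; taking traces on weight spaces makes Δ χ an eigenvector of ∑_k (x_k ∂/∂x_k)^2. All
monomials of Δ χ then have exponents of the same norm, and they are dominated by ν + ρ, where ρ =
(r-1, …, 0). Only ν + ρ and its permutations survive, and its coefficient is 1.

Characteristic classes are finite truncations, so computations take place in power series in a
variable t marking the degree, with `partialSum` in the role of t = 1. Truncation respects products
because symmetric polynomials of degree above r(N-r) vanish in the quotient
(`mem_flagIdeal_of_isHomogeneous`). -/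

/-! ### Partial sums of coefficients -/

section PartialSum

variable {A B : Type*} [CommRing A] [CommRing B]

/-- The sum of the coefficients of degree at most `D`. -/
def partialSum (D : ℕ) : PowerSeries A →ₗ[A] A :=
  ∑ d ∈ Finset.range (D + 1), PowerSeries.coeff d

theorem partialSum_apply (D : ℕ) (u : PowerSeries A) :
    partialSum D u = ∑ d ∈ Finset.range (D + 1), PowerSeries.coeff d u := by
  simp [partialSum]

theorem partialSum_map (F : A →+* B) (D : ℕ) (u : PowerSeries A) :
    partialSum D (PowerSeries.map F u) = F (partialSum D u) := by
  simp [partialSum_apply]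

/-- The two sides differ only by products of coefficients of degrees i, j ≤ D with i + j > D, and c
kills these. This is how truncation at the dimension becomes multiplicative. -/
theorem partialSum_mul (D : ℕ) (c : A) (u v : PowerSeries A)
    (h : ∀ i j, D < i + j → c * (PowerSeries.coeff i u * PowerSeries.coeff j v) = 0) :
    c * partialSum D (u * v) = c * (partialSum D u * partialSum D v) := by
  rw [partialSum_apply, partialSum_apply, partialSum_apply, Finset.sum_mul_sum,
    ← Finset.sum_product']
  have h1 : ∑ d ∈ Finset.range (D + 1), PowerSeries.coeff d (u * v)
      = ∑ p ∈ (Finset.range (D + 1) ×ˢ Finset.range (D + 1)).filter (fun p => p.1 + p.2 ≤ D),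
        PowerSeries.coeff p.1 u * PowerSeries.coeff p.2 v := by
    simp_rw [PowerSeries.coeff_mul]
    rw [Finset.sum_sigma']
    refine Finset.sum_bij' (fun x _ => x.2) (fun p _ => ⟨p.1 + p.2, p⟩) ?_ ?_ ?_ ?_ ?_
    · rintro ⟨d, p⟩ hx
      simp only [Finset.mem_sigma, Finset.mem_range, Finset.HasAntidiagonal.mem_antidiagonal,
        Finset.mem_filter, Finset.mem_product] at hx ⊢
      omega
    · rintro p hp
      simp only [Finset.mem_sigma, Finset.mem_range, Finset.HasAntidiagonal.mem_antidiagonal,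
        Finset.mem_filter, Finset.mem_product] at hp ⊢
      exact ⟨by omega, trivial⟩
    · rintro ⟨d, p⟩ hx
      simp only [Finset.mem_sigma, Finset.HasAntidiagonal.mem_antidiagonal] at hx
      obtain ⟨-, rfl⟩ := hx
      rfl
    · intros; rfl
    · intros; rfl
  rw [h1, Finset.mul_sum, Finset.mul_sum]
  refine Finset.sum_subset (Finset.filter_subset _ _) fun p hp hp' => ?_
  refine h _ _ ?_
  simp only [Finset.mem_filter, not_and, not_le] at hp'
  exact hp' hp

end PartialSum

/-! ### One-variable series evaluated at `a t` -/

section Series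

variable {A B : Type*} [CommRing A] [Algebra ℂ A] [CommRing B] [Algebra ℂ B]

/-- The series `φ(a t)` in `A⟦t⟧`, for a power series `φ` over `ℂ`. -/
def scaledSeries (a : A) : PowerSeries ℂ →+* PowerSeries A :=
  (PowerSeries.rescale a).comp (PowerSeries.map (algebraMap ℂ A))

theorem coeff_scaledSeries (a : A) (φ : PowerSeries ℂ) (n : ℕ) :
    PowerSeries.coeff n (scaledSeries a φ) = PowerSeries.coeff n φ • a ^ n := by
  simp [scaledSeries, PowerSeries.coeff_rescale, Algebra.smul_def, mul_comm]

theorem map_scaledSeries (F : A →ₐ[ℂ] B) (a : A) (φ : PowerSeries ℂ) :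
    PowerSeries.map (F : A →+* B) (scaledSeries a φ) = scaledSeries (F a) φ := by
  ext n
  simp [coeff_scaledSeries]

theorem scaledSeries_smul (c : ℂ) (a : A) (φ : PowerSeries ℂ) :
    scaledSeries (c • a) φ = scaledSeries a (PowerSeries.rescale c φ) := by
  ext n
  simp [coeff_scaledSeries, PowerSeries.coeff_rescale, smul_pow, smul_smul, mul_comm]

theorem scaledSeries_X (a : A) : scaledSeries a PowerSeries.X = PowerSeries.C a * PowerSeries.X := by
  simp [scaledSeries, PowerSeries.rescale_X]

theorem scaledSeries_C (a : A) (c : ℂ) :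
    scaledSeries a (PowerSeries.C c) = PowerSeries.C (algebraMap ℂ A c) := by
  ext n
  rw [coeff_scaledSeries, PowerSeries.coeff_C, PowerSeries.coeff_C]
  split_ifs with h
  · simp [h, Algebra.smul_def]
  · simp

theorem scaledSeries_zero (φ : PowerSeries ℂ) (h : PowerSeries.constantCoeff φ = 1) :
    scaledSeries (0 : A) φ = 1 := by
  ext n
  rcases n with _ | n
  · simp [coeff_scaledSeries, h]
  · simp [coeff_scaledSeries, PowerSeries.coeff_one]

/-- The series `e^{a t}`. -/
def expSeries (a : A) : PowerSeries A := scaledSeries a (PowerSeries.exp ℂ)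

theorem expSeries_add (a b : A) : expSeries (a + b) = expSeries a * expSeries b := by
  -- The addition formula for `PowerSeries.exp` is stated over ℚ-algebras; the structure is
  -- restricted from ℂ.
  let : Algebra ℚ A := Algebra.compHom A (algebraMap ℚ ℂ)
  have : IsScalarTower ℚ ℂ A := IsScalarTower.of_algebraMap_eq fun _ => rfl
  have h : PowerSeries.map (algebraMap ℂ A) (PowerSeries.exp ℂ) = PowerSeries.exp A :=
    PowerSeries.map_exp _
  simp only [expSeries, scaledSeries, RingHom.comp_apply, h]
  exact (PowerSeries.exp_mul_exp_eq_exp_add a b).symm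

theorem expSeries_zero : expSeries (0 : A) = 1 := scaledSeries_zero _ (by simp)

theorem expSeries_sum {ι : Type*} (s : Finset ι) (a : ι → A) :
    expSeries (∑ i ∈ s, a i) = ∏ i ∈ s, expSeries (a i) := by
  classical
  induction s using Finset.induction_on with
  | empty => simp [expSeries_zero]
  | insert i s hi ih => rw [Finset.sum_insert hi, Finset.prod_insert hi, expSeries_add, ih]

theorem expSeries_nsmul (k : ℕ) (a : A) : expSeries (k • a) = expSeries a ^ k := by
  induction k with
  | zero => simp [expSeries_zero]
  | succ k ih => rw [succ_nsmul, expSeries_add, ih, pow_succ]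

theorem map_expSeries (F : A →ₐ[ℂ] B) (a : A) :
    PowerSeries.map (F : A →+* B) (expSeries a) = expSeries (F a) := map_scaledSeries F a _

theorem scaledSeries_rescale_exp (a : A) (c : ℂ) :
    scaledSeries a (PowerSeries.rescale c (PowerSeries.exp ℂ)) = expSeries (c • a) :=
  (scaledSeries_smul c a _).symm

theorem coeff_prod_scaledSeries {ι : Type*} [Fintype ι] [DecidableEq ι]
    (φ : PowerSeries ℂ) (δ : ι → A) (d : ℕ) :
    PowerSeries.coeff d (∏ p, scaledSeries (δ p) φ)
      = ∑ a ∈ Finset.piAntidiag (Finset.univ : Finset ι) d,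
        ∏ p, (PowerSeries.coeff (a p) φ) • δ p ^ a p := by
  rw [PowerSeries.coeff_prod]
  refine Finset.sum_bij' (fun l _ => ⇑l) (fun a _ => Finsupp.equivFunOnFinite.symm a)
    ?_ ?_ ?_ ?_ ?_
  · intro l hl
    simpa [Finset.mem_finsuppAntidiag, Finset.mem_piAntidiag] using hl
  · intro a ha
    simpa [Finset.mem_finsuppAntidiag, Finset.mem_piAntidiag] using ha
  · intro l _
    ext
    simp
  · intro a _
    ext
    simp
  · intro l _
    simp [coeff_scaledSeries]

theorem truncProd_eq_partialSum {ι : Type*} [Fintype ι] [DecidableEq ι]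
    (φ : PowerSeries ℂ) (δ : ι → A) (D : ℕ) :
    truncProd φ δ D = partialSum D (∏ p, scaledSeries (δ p) φ) := by
  simp [truncProd, partialSum_apply, coeff_prod_scaledSeries]

theorem truncExp_eq_partialSum (D : ℕ) (a : A) : truncExp D a = partialSum D (expSeries a) := by
  simp [truncExp, partialSum_apply, expSeries, coeff_scaledSeries, PowerSeries.coeff_exp]

end Series

/-! ### The reflection formula for the Gamma series -/

/-- The Taylor series of `f` at `0`. -/
def taylorSeries (f : ℂ → ℂ) : PowerSeries ℂ :=
  PowerSeries.mk fun n => iteratedDeriv n f 0 / (n.factorial : ℂ)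

theorem taylorSeries_mul {f g : ℂ → ℂ} (hf : AnalyticAt ℂ f 0) (hg : AnalyticAt ℂ g 0) :
    taylorSeries (f * g) = taylorSeries f * taylorSeries g := by
  ext n
  rw [PowerSeries.coeff_mul]
  simp only [taylorSeries, PowerSeries.coeff_mk]
  rw [iteratedDeriv_mul hf.contDiffAt hg.contDiffAt, Finset.sum_div,
    Finset.Nat.sum_antidiagonal_eq_sum_range_succ
      (fun i j => iteratedDeriv i f 0 / (i.factorial : ℂ) * (iteratedDeriv j g 0 / j.factorial)) n]
  refine Finset.sum_congr rfl fun i hi => ?_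
  have hi' : i ≤ n := Nat.lt_succ_iff.1 (Finset.mem_range.1 hi)
  rw [Nat.cast_choose ℂ hi']
  have h1 : (n.factorial : ℂ) ≠ 0 := by exact_mod_cast n.factorial_ne_zero
  have h2 : (i.factorial : ℂ) ≠ 0 := by exact_mod_cast i.factorial_ne_zero
  have h3 : ((n - i).factorial : ℂ) ≠ 0 := by exact_mod_cast (n - i).factorial_ne_zero
  field_simp

theorem taylorSeries_congr {f g : ℂ → ℂ} (h : f =ᶠ[nhds 0] g) :
    taylorSeries f = taylorSeries g := by
  ext n
  simp [taylorSeries, h.iteratedDeriv_eq n]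

theorem taylorSeries_exp_mul (c : ℂ) :
    taylorSeries (fun z => Complex.exp (c * z)) = PowerSeries.rescale c (PowerSeries.exp ℂ) := by
  ext n
  simp [taylorSeries, PowerSeries.coeff_rescale, PowerSeries.coeff_exp, iteratedDeriv_cexp_const_mul,
    div_eq_mul_inv]

theorem taylorSeries_gamma : taylorSeries (fun z => Complex.Gamma (1 + z)) = gammaSeries := by
  ext n
  simp [taylorSeries, gammaSeries, iteratedDeriv_comp_const_add]

theorem taylorSeries_gamma_neg :
    taylorSeries (fun z => Complex.Gamma (1 - z)) = PowerSeries.rescale (-1) gammaSeries := by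
  rw [← taylorSeries_gamma]
  ext n
  have h := iteratedDeriv_comp_neg n (fun z => Complex.Gamma (1 + z)) 0
  simp only [← sub_eq_add_neg, neg_zero] at h
  simp [taylorSeries, PowerSeries.coeff_rescale, h, mul_div_assoc]

theorem analyticAt_gamma_one : AnalyticAt ℂ Complex.Gamma 1 := by
  refine DifferentiableOn.analyticAt (s := {z : ℂ | 0 < z.re}) (fun z hz => ?_)
    ((isOpen_lt continuous_const Complex.continuous_re).mem_nhds (by simp))
  refine (Complex.differentiableAt_Gamma z fun m hm => ?_).differentiableWithinAt
  have h : (0 : ℝ) < z.re := hz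
  rw [hm] at h
  simp only [Complex.neg_re, Complex.natCast_re] at h
  have : (0 : ℝ) ≤ m := m.cast_nonneg
  linarith

/-- Combines Γ(1 + z) = z Γ(z), Γ(z) Γ(1 - z) = π / sin πz and e^{2πiz} - 1 = 2i sin(πz) e^{πiz}.
Written without denominators it also holds at z = 0, and the bound on z excludes the other zeros of
the sine. -/
theorem gamma_reflection_near_zero {z : ℂ} (hz : ‖z‖ < 1) :
    Complex.Gamma (1 + z) * Complex.Gamma (1 - z) * (Complex.exp (2 * Real.pi * Complex.I * z) - 1)
      = 2 * Real.pi * Complex.I * z * Complex.exp (Real.pi * Complex.I * z) := by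
  rcases eq_or_ne z 0 with rfl | h0
  · simp
  have hsin : Complex.sin (Real.pi * z) ≠ 0 := by
    intro h
    obtain ⟨k, hk⟩ := Complex.sin_eq_zero_iff.1 h
    have hpi : (Real.pi : ℂ) ≠ 0 := by exact_mod_cast Real.pi_ne_zero
    have hzk : z = k := mul_left_cancel₀ hpi (by rw [hk, mul_comm])
    rw [hzk, Complex.norm_intCast] at hz
    have : k = 0 := by
      have : |k| < 1 := by exact_mod_cast hz
      exact Int.abs_lt_one_iff.1 this
    exact h0 (by rw [hzk, this]; simp)
  have h1 : Complex.Gamma (1 + z) = z * Complex.Gamma z := by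
    rw [add_comm, Complex.Gamma_add_one z h0]
  have h2 : Complex.exp (2 * Real.pi * Complex.I * z) - 1
      = 2 * Complex.I * Complex.sin (Real.pi * z) * Complex.exp (Real.pi * Complex.I * z) := by
    rw [Complex.sin]
    have e1 : Complex.exp (2 * Real.pi * Complex.I * z)
        = Complex.exp (Real.pi * z * Complex.I) * Complex.exp (Real.pi * z * Complex.I) := by
      rw [← Complex.exp_add]; ring_nf
    have e2 : (1 : ℂ) = Complex.exp (-(Real.pi * z) * Complex.I)
        * Complex.exp (Real.pi * z * Complex.I) := by
      rw [← Complex.exp_add]; simp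
    have e3 : (Real.pi * Complex.I * z : ℂ) = Real.pi * z * Complex.I := by ring
    rw [e3, e1]
    linear_combination (Complex.exp (Real.pi * z * Complex.I) * Complex.exp (Real.pi * z * Complex.I)
       - Complex.exp (-(Real.pi * z) * Complex.I) * Complex.exp (Real.pi * z * Complex.I))
        * Complex.I_sq - e2
  rw [h1, h2, mul_assoc z, Complex.Gamma_mul_Gamma_one_sub]
  generalize Complex.sin (Real.pi * z) = s at *
  field_simp

/-- Both sides of the analytic identity near 0 are products of analytic functions, and taking Taylor
series is multiplicative on these. -/
theorem gammaSeries_reflection :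
    gammaSeries * PowerSeries.rescale (-1) gammaSeries *
        (PowerSeries.rescale (2 * Real.pi * Complex.I : ℂ) (PowerSeries.exp ℂ) - 1)
      = PowerSeries.C (2 * Real.pi * Complex.I : ℂ) * PowerSeries.X *
        PowerSeries.rescale (Real.pi * Complex.I : ℂ) (PowerSeries.exp ℂ) := by
  have hg1 : AnalyticAt ℂ (fun z => Complex.Gamma (1 + z)) 0 :=
    AnalyticAt.fun_comp (by simpa using analyticAt_gamma_one) (by fun_prop)
  have hg2 : AnalyticAt ℂ (fun z => Complex.Gamma (1 - z)) 0 :=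
    AnalyticAt.fun_comp (by simpa using analyticAt_gamma_one) (by fun_prop)
  have he : ∀ c : ℂ, AnalyticAt ℂ (fun z => Complex.exp (c * z)) 0 := fun c => by fun_prop
  have hlin : AnalyticAt ℂ (fun z : ℂ => (2 * Real.pi * Complex.I : ℂ) * z) 0 := by fun_prop
  have hx : taylorSeries (fun z : ℂ => (2 * Real.pi * Complex.I : ℂ) * z)
      = PowerSeries.C (2 * Real.pi * Complex.I : ℂ) * PowerSeries.X := by
    ext n
    rw [PowerSeries.coeff_C_mul, PowerSeries.coeff_X]
    simp only [taylorSeries, PowerSeries.coeff_mk]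
    rw [iteratedDeriv_const_mul_field]
    rcases n with _ | _ | n
    · simp
    · simp
    · rw [iteratedDeriv_succ', iteratedDeriv_succ']
      simp
  have hexp1 : taylorSeries (fun z => Complex.exp (2 * Real.pi * Complex.I * z) - 1)
      = PowerSeries.rescale (2 * Real.pi * Complex.I : ℂ) (PowerSeries.exp ℂ) - 1 := by
    rw [← taylorSeries_exp_mul]
    ext n
    simp only [taylorSeries, map_sub, PowerSeries.coeff_mk, PowerSeries.coeff_one]
    rcases n with _ | n
    · simp
    · rw [iteratedDeriv_succ', iteratedDeriv_succ']
      simp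
  have key := taylorSeries_congr (f := (fun z => Complex.Gamma (1 + z)) *
      (fun z => Complex.Gamma (1 - z)) * (fun z => Complex.exp (2 * Real.pi * Complex.I * z) - 1))
    (g := (fun z : ℂ => (2 * Real.pi * Complex.I : ℂ) * z) *
      (fun z => Complex.exp (Real.pi * Complex.I * z))) (by
    filter_upwards [Metric.ball_mem_nhds (0 : ℂ) one_pos] with z hz
    exact gamma_reflection_near_zero (by simpa using hz))
  rw [taylorSeries_mul (hg1.mul hg2) ((he (2 * Real.pi * Complex.I)).fun_sub analyticAt_const), taylorSeries_mul hg1 hg2,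
    taylorSeries_mul hlin (he _), hx, hexp1, taylorSeries_exp_mul, taylorSeries_gamma,
    taylorSeries_gamma_neg] at key
  exact key

theorem constantCoeff_gammaSeries : PowerSeries.constantCoeff gammaSeries = 1 := by
  simp [gammaSeries, ← PowerSeries.coeff_zero_eq_constantCoeff_apply]

theorem gammaSeries_mul_inv : gammaSeries * gammaSeries⁻¹ = 1 :=
  PowerSeries.mul_inv_cancel _ (by simp [constantCoeff_gammaSeries])

theorem constantCoeff_gammaSeries_inv : PowerSeries.constantCoeff gammaSeries⁻¹ = 1 := by
  simp [PowerSeries.constantCoeff_inv, constantCoeff_gammaSeries]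

/-- `2πi (x - y) t e^{πi (x + y) t} / (Γ(1 + (x - y) t) Γ(1 - (x - y) t))
= e^{2πi x t} - e^{2πi y t}`. -/
theorem scaledSeries_gamma_reflection {A : Type*} [CommRing A] [Algebra ℂ A] (x y : A) :
    PowerSeries.C (algebraMap ℂ A (2 * Real.pi * Complex.I)) *
        (PowerSeries.C (x - y) * PowerSeries.X) *
        (scaledSeries (x - y) gammaSeries⁻¹ * scaledSeries (y - x) gammaSeries⁻¹) *
        expSeries ((Real.pi * Complex.I : ℂ) • (x + y))
      = expSeries ((2 * Real.pi * Complex.I : ℂ) • x)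
        - expSeries ((2 * Real.pi * Complex.I : ℂ) • y) := by
  have h := congrArg (scaledSeries (x - y)) gammaSeries_reflection
  simp only [map_mul, map_sub, map_one, scaledSeries_C,
    scaledSeries_X, ← scaledSeries_smul, neg_smul, one_smul, neg_sub] at h
  simp only [← map_sub, ← map_mul] at h
  change _ * (expSeries _ - 1) = _ * expSeries _ at h
  have h1 : scaledSeries (x - y) gammaSeries * scaledSeries (x - y) gammaSeries⁻¹ = 1 := by
    rw [← map_mul, gammaSeries_mul_inv, map_one]
  have h2 : scaledSeries (y - x) gammaSeries * scaledSeries (y - x) gammaSeries⁻¹ = 1 := by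
    rw [← map_mul, gammaSeries_mul_inv, map_one]
  -- Since πi(x + y) = πi(x - y) + 2πi y, both sides contain the factor e^{2πi y}, and what remains
  -- is the one-variable reflection formula at x - y.
  have e1 : expSeries ((Real.pi * Complex.I : ℂ) • (x + y))
      = expSeries ((Real.pi * Complex.I : ℂ) • (x - y)) *
        expSeries ((2 * Real.pi * Complex.I : ℂ) • y) := by
    rw [← expSeries_add]; congr 1; module
  have e2 : expSeries ((2 * Real.pi * Complex.I : ℂ) • x)
      = expSeries ((2 * Real.pi * Complex.I : ℂ) • (x - y)) *
        expSeries ((2 * Real.pi * Complex.I : ℂ) • y) := by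
    rw [← expSeries_add]; congr 1; module
  simp only [map_mul, map_sub] at h ⊢
  rw [e1, e2]
  generalize expSeries ((2 * Real.pi * Complex.I : ℂ) • (x - y)) = E at *
  generalize expSeries ((2 * Real.pi * Complex.I : ℂ) • y) = F at *
  generalize expSeries ((Real.pi * Complex.I : ℂ) • (x - y)) = H at *
  generalize scaledSeries (x - y) gammaSeries = a at *
  generalize scaledSeries (x - y) gammaSeries⁻¹ = a' at *
  generalize scaledSeries (y - x) gammaSeries = b at *
  generalize scaledSeries (y - x) gammaSeries⁻¹ = b' at *
  linear_combination -(a' * b' * F) * h + (b * b' * (E - 1) * F) * h1 + (E - 1) * F * h2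

/-! ### Generating function of the complete symmetric polynomials -/

/-- The geometric series `1 / (1 - z)`. -/
def geomSeries : PowerSeries ℂ := PowerSeries.mk fun _ => 1

theorem scaledSeries_geomSeries_mul {A : Type*} [CommRing A] [Algebra ℂ A] (a : A) :
    scaledSeries a geomSeries * (1 - PowerSeries.C a * PowerSeries.X) = 1 := by
  have h : geomSeries * (1 - PowerSeries.X) = 1 := PowerSeries.mk_one_mul_one_sub_eq_one ℂ
  have h' := congrArg (scaledSeries a) h
  rwa [map_mul, map_sub, map_one, scaledSeries_X] at h'

/-- Multisets of size d correspond to exponent vectors of total d through their multiplicities, and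
every coefficient of the geometric series is 1. -/
theorem mk_hsymm (r : ℕ) : PowerSeries.mk (fun k => MvPolynomial.hsymm (Fin r) ℂ k)
    = ∏ i : Fin r, scaledSeries (MvPolynomial.X i : MvPolynomial (Fin r) ℂ) geomSeries := by
  ext1 d
  rw [coeff_prod_scaledSeries, PowerSeries.coeff_mk, MvPolynomial.hsymm]
  refine Finset.sum_bij' (fun s _ => fun i => (s : Multiset (Fin r)).count i)
    (fun a ha => ⟨∑ i, Multiset.replicate (a i) i, ?_⟩) ?_ ?_ ?_ ?_ ?_
  · rw [Multiset.card_sum]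
    simpa [Finset.mem_piAntidiag] using ha
  · intro s _
    simp only [Finset.mem_piAntidiag, Finset.mem_univ, implies_true, and_true]
    rw [Multiset.sum_count_eq_card (fun a _ => Finset.mem_univ a)]
    exact s.2
  · intro a ha
    exact Finset.mem_univ _
  · intro s _
    apply Subtype.ext
    ext i
    simp [Multiset.count_sum', Multiset.count_replicate]
  · intro a ha
    ext i
    simp [Multiset.count_sum', Multiset.count_replicate]
  · intro s _
    rw [Finset.prod_multiset_map_count]
    simp only [geomSeries, PowerSeries.coeff_mk, one_smul]
    refine Finset.prod_subset (Finset.subset_univ _) fun i _ hi => ?_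
    have : Multiset.count i (s : Multiset (Fin r)) = 0 := by
      simpa using hi
    change _ ^ Multiset.count i (s : Multiset (Fin r)) = 1
    rw [this, pow_zero]

/-- `∑_k h_k t^k · ∏_i (1 - x_i t) = 1`. -/
theorem mk_hsymm_mul_prod (r : ℕ) : PowerSeries.mk (fun k => MvPolynomial.hsymm (Fin r) ℂ k)
    * ∏ i : Fin r, (1 - PowerSeries.C (MvPolynomial.X i : MvPolynomial (Fin r) ℂ) * PowerSeries.X)
      = 1 := by
  rw [mk_hsymm, ← Finset.prod_mul_distrib]
  exact Finset.prod_eq_one fun i _ => scaledSeries_geomSeries_mul _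

/-! ### The flag ring -/

/-- The ideal of `ℂ[x_1, …, x_r]` generated by `h_{N-r+1}, …, h_N`. -/
def flagIdeal (r N : ℕ) : Ideal (MvPolynomial (Fin r) ℂ) :=
  (relIdeal r N).map (MvPolynomial.symmetricSubalgebra (Fin r) ℂ).val

/-- `ℂ[x_1, …, x_r] / ⟨h_{N-r+1}, …, h_N⟩`. -/
abbrev FlagRing (r N : ℕ) : Type := MvPolynomial (Fin r) ℂ ⧸ flagIdeal r N

/-- The class of a polynomial in the flag ring. -/
abbrev toFlagRing (r N : ℕ) : MvPolynomial (Fin r) ℂ →ₐ[ℂ] FlagRing r N :=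
  Ideal.Quotient.mkₐ ℂ (flagIdeal r N)

/-- The pullback map `H(G(r,N)) → ℂ[x_1, …, x_r] / ⟨h_{N-r+1}, …, h_N⟩`. -/
def pullback (r N : ℕ) : HG r N →ₐ[ℂ] FlagRing r N :=
  Ideal.quotientMapₐ (flagIdeal r N) (MvPolynomial.symmetricSubalgebra (Fin r) ℂ).val
    Ideal.le_comap_map

theorem pullback_toHG (r N : ℕ) (f : SymPoly r) :
    pullback r N (toHG r N f) = toFlagRing r N f := rfl

theorem hsymm_mem_flagIdeal {r N k : ℕ} (h1 : N + 1 ≤ k + r) (h2 : k ≤ N) :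
    MvPolynomial.hsymm (Fin r) ℂ k ∈ flagIdeal r N :=
  Ideal.mem_map_of_mem (MvPolynomial.symmetricSubalgebra (Fin r) ℂ).val
    (Ideal.subset_span ⟨k, h1, h2, rfl⟩ : hSym r k ∈ relIdeal r N)

/-- Cancelling all factors but the i-th gives 1/(1 - x_i t) = (∑ h_k t^k) ∏_{l ≠ i} (1 - x_l t). The
last product has degree less than r, so the coefficient of t^N involves only h_{N-r+1}, …, h_N. -/
theorem X_pow_mem_flagIdeal {r N : ℕ} (i : Fin r) :
    (MvPolynomial.X i : MvPolynomial (Fin r) ℂ) ^ N ∈ flagIdeal r N := by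
  classical
  let P : Polynomial (MvPolynomial (Fin r) ℂ) :=
    ∏ l ∈ Finset.univ.erase i, (1 - Polynomial.C (MvPolynomial.X l) * Polynomial.X)
  have hP : (P : PowerSeries (MvPolynomial (Fin r) ℂ)) = ∏ l ∈ Finset.univ.erase i,
      (1 - PowerSeries.C (MvPolynomial.X l) * PowerSeries.X) := by
    change Polynomial.coeToPowerSeries.ringHom P = _
    rw [map_prod]
    exact Finset.prod_congr rfl fun l _ => by simp
  have hdeg : P.natDegree < r := by
    have h1 : P.natDegree ≤ ∑ l ∈ Finset.univ.erase i, 1 := by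
      refine (Polynomial.natDegree_prod_le _ _).trans (Finset.sum_le_sum fun l _ => ?_)
      compute_degree
    have h2 : (Finset.univ.erase i).card < r := by
      rw [Finset.card_erase_of_mem (Finset.mem_univ i), Finset.card_fin]
      have := i.pos
      omega
    simpa using h1.trans_lt (by simpa using h2)
  have key : scaledSeries (MvPolynomial.X i : MvPolynomial (Fin r) ℂ) geomSeries
      = PowerSeries.mk (fun k => MvPolynomial.hsymm (Fin r) ℂ k) * P := by
    have h1 := mk_hsymm_mul_prod r
    rw [← Finset.mul_prod_erase _ _ (Finset.mem_univ i), ← hP] at h1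
    have h2 := scaledSeries_geomSeries_mul (MvPolynomial.X i : MvPolynomial (Fin r) ℂ)
    linear_combination (-scaledSeries (MvPolynomial.X i : MvPolynomial (Fin r) ℂ) geomSeries) * h1
      + (PowerSeries.mk (fun k => MvPolynomial.hsymm (Fin r) ℂ k) * P) * h2
  have h := congrArg (PowerSeries.coeff N) key
  rw [coeff_scaledSeries, PowerSeries.coeff_mul] at h
  simp only [geomSeries, PowerSeries.coeff_mk, one_smul, Polynomial.coeff_coe] at h
  rw [h]
  refine Ideal.sum_mem _ fun p hp => ?_
  rw [Finset.HasAntidiagonal.mem_antidiagonal] at hp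
  by_cases hb : p.2 < r
  · exact Ideal.mul_mem_right _ _ (hsymm_mem_flagIdeal (by omega) (by omega))
  · rw [Polynomial.coeff_eq_zero_of_natDegree_lt (by omega), mul_zero]
    exact Ideal.zero_mem _

/-! ### Antisymmetrization -/

/-- The Vandermonde determinant `det (x_i ^ {r - j})`. -/
def vand (r : ℕ) : MvPolynomial (Fin r) ℂ := (alternant r fun j => (j.rev : ℕ)).det

theorem vand_ne_zero (r : ℕ) : vand r ≠ 0 := det_alternant_rev_ne_zero r

/-- The antisymmetrization `∑_e sgn(e) e(g)`. -/
def antisymm (r : ℕ) : MvPolynomial (Fin r) ℂ →ₗ[ℂ] MvPolynomial (Fin r) ℂ :=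
  ∑ e : Equiv.Perm (Fin r), ((Equiv.Perm.sign e : ℤ) : ℂ) •
    (MvPolynomial.rename e : MvPolynomial (Fin r) ℂ →ₐ[ℂ] MvPolynomial (Fin r) ℂ).toLinearMap

theorem antisymm_apply {r : ℕ} (g : MvPolynomial (Fin r) ℂ) :
    antisymm r g = ∑ e : Equiv.Perm (Fin r),
      ((Equiv.Perm.sign e : ℤ) : MvPolynomial (Fin r) ℂ) * MvPolynomial.rename e g := by
  simp [antisymm, Algebra.smul_def]

theorem antisymm_mul_of_isSymmetric {r : ℕ} {s : MvPolynomial (Fin r) ℂ} (hs : s.IsSymmetric)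
    (g : MvPolynomial (Fin r) ℂ) : antisymm r (g * s) = s * antisymm r g := by
  rw [antisymm_apply, antisymm_apply, Finset.mul_sum]
  refine Finset.sum_congr rfl fun e _ => ?_
  rw [map_mul, hs e]
  ring

/-- A polynomial `g` is antisymmetric if `e(g) = sgn(e) g` for every permutation `e`. -/
def IsAntisymmetric {r : ℕ} (g : MvPolynomial (Fin r) ℂ) : Prop :=
  ∀ e : Equiv.Perm (Fin r),
    MvPolynomial.rename e g = ((Equiv.Perm.sign e : ℤ) : MvPolynomial (Fin r) ℂ) * g

theorem isAntisymmetric_vand (r : ℕ) : IsAntisymmetric (vand r) := rename_det_alternant _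

theorem IsAntisymmetric.mul {r : ℕ} {g s : MvPolynomial (Fin r) ℂ} (hg : IsAntisymmetric g)
    (hs : s.IsSymmetric) : IsAntisymmetric (g * s) := fun e => by
  rw [map_mul, hs e, hg e, mul_assoc]

theorem sign_mul_sign {r : ℕ} (e : Equiv.Perm (Fin r)) :
    ((Equiv.Perm.sign e : ℤ) : MvPolynomial (Fin r) ℂ)
      * ((Equiv.Perm.sign e : ℤ) : MvPolynomial (Fin r) ℂ) = 1 := by
  rcases Int.units_eq_one_or (Equiv.Perm.sign e) with h | h <;> simp [h]

theorem antisymm_of_isAntisymmetric {r : ℕ} {g : MvPolynomial (Fin r) ℂ}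
    (hg : IsAntisymmetric g) : antisymm r g = (r.factorial : ℂ) • g := by
  rw [antisymm_apply]
  simp_rw [hg _, ← mul_assoc, sign_mul_sign, one_mul]
  simp [Fintype.card_perm, Algebra.smul_def]

theorem isAntisymmetric_antisymm {r : ℕ} (g : MvPolynomial (Fin r) ℂ) :
    IsAntisymmetric (antisymm r g) := by
  intro e
  rw [antisymm_apply, map_sum, Finset.mul_sum]
  refine Fintype.sum_equiv (Equiv.mulLeft e) _ _ fun f => ?_
  simp only [map_mul, map_intCast, MvPolynomial.rename_rename, Equiv.coe_mulLeft,
    Equiv.Perm.coe_mul, Units.val_mul, Int.cast_mul]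
  rw [← mul_assoc, ← mul_assoc, sign_mul_sign, one_mul]

theorem antisymm_monomial {r : ℕ} (α : Fin r →₀ ℕ) (c : ℂ) :
    antisymm r (MvPolynomial.monomial α c) = c • (alternant r α).det := by
  rw [antisymm_apply, Matrix.det_apply, Finset.smul_sum]
  refine Finset.sum_congr rfl fun e _ => ?_
  rw [MvPolynomial.monomial_eq, map_mul, MvPolynomial.rename_C,
    Finsupp.prod_fintype _ _ fun _ => pow_zero _, map_prod]
  simp only [map_pow, MvPolynomial.rename_X, alternant, Matrix.of_apply, Units.smul_def,
    MvPolynomial.smul_eq_C_mul, zsmul_eq_mul]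
  ring

theorem antisymm_eq_sum {r : ℕ} (g : MvPolynomial (Fin r) ℂ) :
    antisymm r g = ∑ α ∈ g.support, g.coeff α • (alternant r α).det := by
  conv_lhs => rw [g.as_sum, map_sum]
  exact Finset.sum_congr rfl fun α _ => antisymm_monomial α _

theorem vand_dvd_antisymm {r : ℕ} (g : MvPolynomial (Fin r) ℂ) : vand r ∣ antisymm r g := by
  rw [antisymm_eq_sum]
  exact Finset.dvd_sum fun α _ => by
    rw [Algebra.smul_def]
    exact Dvd.dvd.mul_left (det_alternant_dvd α) _

theorem IsAntisymmetric.isSymmetric_of_vand_mul {r : ℕ} {s : MvPolynomial (Fin r) ℂ}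
    (h : IsAntisymmetric (vand r * s)) : s.IsSymmetric := by
  intro e
  have h1 := h e
  rw [map_mul, isAntisymmetric_vand r e, mul_assoc] at h1
  have hs : ((Equiv.Perm.sign e : ℤ) : MvPolynomial (Fin r) ℂ) ≠ 0 :=
    left_ne_zero_of_mul_eq_one (sign_mul_sign e)
  exact mul_left_cancel₀ (vand_ne_zero r) (mul_left_cancel₀ hs h1)

theorem exists_antisymm_eq {r : ℕ} (g : MvPolynomial (Fin r) ℂ) :
    ∃ s : SymPoly r, antisymm r g = vand r * s := by
  obtain ⟨s, hs⟩ := vand_dvd_antisymm g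
  exact ⟨⟨s, IsAntisymmetric.isSymmetric_of_vand_mul (hs ▸ isAntisymmetric_antisymm g)⟩, hs⟩

/-- Antisymmetrization is linear over symmetric polynomials and takes values in Δ times symmetric
polynomials, so it sends the extended ideal into Δ times the original one. On Δ f it is
multiplication by r!, and both Δ and r! can be cancelled. -/
theorem mem_relIdeal_of_vand_mul_mem {r N : ℕ} (f : SymPoly r)
    (h : vand r * f ∈ flagIdeal r N) : f ∈ relIdeal r N := by
  -- The arbitrary multiplier g lets the span induction pass through multiplication by non-symmetric
  -- polynomials.
  have key : ∀ x ∈ flagIdeal r N, ∀ g, ∃ s ∈ relIdeal r N, antisymm r (g * x) = vand r * s := by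
    intro x hx
    rw [flagIdeal, Ideal.map] at hx
    refine Submodule.span_induction ?_ ?_ ?_ ?_ hx
    · rintro _ ⟨s, hs, rfl⟩ g
      obtain ⟨s', hs'⟩ := exists_antisymm_eq g
      refine ⟨s * s', Ideal.mul_mem_right _ _ hs, ?_⟩
      have h2 := antisymm_mul_of_isSymmetric s.2 g
      change antisymm r (g * (s : MvPolynomial (Fin r) ℂ)) = _
      rw [h2, hs']
      push_cast
      ring
    · exact fun g => ⟨0, Ideal.zero_mem _, by simp⟩
    · intro x y _ _ hx hy g
      obtain ⟨s, hs, h1⟩ := hx g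
      obtain ⟨s', hs', h2⟩ := hy g
      exact ⟨s + s', Ideal.add_mem _ hs hs', by rw [mul_add, map_add, h1, h2]; push_cast; ring⟩
    · intro a x _ hx g
      obtain ⟨s, hs, h1⟩ := hx (g * a)
      exact ⟨s, hs, by rw [← h1, smul_eq_mul, mul_assoc]⟩
  obtain ⟨s, hs, h1⟩ := key _ h 1
  rw [one_mul, antisymm_of_isAntisymmetric ((isAntisymmetric_vand r).mul f.2),
    ← mul_smul_comm] at h1
  have h2 := mul_left_cancel₀ (vand_ne_zero r) h1
  have hr : (r.factorial : ℂ) ≠ 0 := by exact_mod_cast r.factorial_ne_zero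
  have h3 : f = (r.factorial : ℂ)⁻¹ • s := by
    apply Subtype.ext
    change _ = (r.factorial : ℂ)⁻¹ • (s : MvPolynomial (Fin r) ℂ)
    rw [← h2, smul_smul, inv_mul_cancel₀ hr, one_smul]
  rw [h3]
  exact Submodule.smul_of_tower_mem _ _ hs

/-- Classes in `H(G(r,N))` are determined by their pullbacks times the Vandermonde determinant. -/
theorem eq_of_vand_mul_pullback_eq {r N : ℕ} {u v : HG r N}
    (h : toFlagRing r N (vand r) * pullback r N u = toFlagRing r N (vand r) * pullback r N v) :
    u = v := by
  obtain ⟨f, rfl⟩ := Ideal.Quotient.mk_surjective u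
  obtain ⟨g, rfl⟩ := Ideal.Quotient.mk_surjective v
  rw [← sub_eq_zero, ← mul_sub, ← map_sub, ← map_sub] at h
  rw [← sub_eq_zero, ← map_sub, Ideal.Quotient.eq_zero_iff_mem]
  apply mem_relIdeal_of_vand_mul_mem
  rw [← Ideal.Quotient.eq_zero_iff_mem, map_mul]
  exact h

theorem pullback_injective (r N : ℕ) : Function.Injective (pullback r N) := fun u v h =>
  eq_of_vand_mul_pullback_eq (by rw [h])

/-! ### Vanishing above the dimension -/

theorem sum_range_le_sum_of_injective {r : ℕ} (β : Fin r → ℕ) (hβ : Function.Injective β) :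
    ∑ i ∈ Finset.range r, i ≤ ∑ i, β i := by
  have h : ∀ (n : ℕ) (s : Finset ℕ), s.card = n → ∑ i ∈ Finset.range n, i ≤ ∑ i ∈ s, i := by
    intro n
    induction n with
    | zero => simp
    | succ n ih =>
      intro s hs
      have hne : s.Nonempty := Finset.card_pos.1 (by omega)
      have hmax := s.max'_mem hne
      rw [Finset.sum_range_succ, ← Finset.sum_erase_add _ _ hmax]
      refine Nat.add_le_add (ih _ (by rw [Finset.card_erase_of_mem hmax, hs]; rfl)) ?_
      have hsub : s ⊆ Finset.range (s.max' hne + 1) := fun x hx =>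
        Finset.mem_range.2 (Nat.lt_succ_of_le (s.le_max' x hx))
      have := Finset.card_le_card hsub
      rw [Finset.card_range, hs] at this
      omega
  have h1 := h r (Finset.univ.image β) (by rw [Finset.card_image_of_injective _ hβ]; simp)
  rwa [Finset.sum_image (fun a _ b _ hab => hβ hab)] at h1

/-- Otherwise the N - 1 - α_i are distinct natural numbers with sum at least 0 + 1 + ⋯ + (r-1),
which bounds ∑ α_i by r(N-1) - r(r-1)/2 = r(N-r) + r(r-1)/2. -/
theorem exists_le_of_injective_of_lt_sum {r N : ℕ} (hrN : r ≤ N) (α : Fin r → ℕ)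
    (hα : Function.Injective α) (h : r * (N - r) + ∑ i ∈ Finset.range r, i < ∑ i, α i) :
    ∃ i, N ≤ α i := by
  by_contra! hlt
  have hinj : Function.Injective fun i => N - 1 - α i := fun i j hij => by
    have h1 := hlt i
    have h2 := hlt j
    simp only at hij
    exact hα (by omega)
  have h1 := sum_range_le_sum_of_injective _ hinj
  have h2 : ∑ i, α i + ∑ i, (N - 1 - α i) = r * (N - 1) := by
    rw [← Finset.sum_add_distrib, Finset.sum_congr rfl fun i _ =>
      (show α i + (N - 1 - α i) = N - 1 by have := hlt i; omega)]
    simp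
  have h3 := Finset.sum_range_id_mul_two r
  rcases Nat.eq_zero_or_pos r with rfl | hr
  · simp at h
  obtain ⟨m, rfl⟩ := Nat.exists_eq_add_of_le hrN
  obtain ⟨k, rfl⟩ := Nat.exists_eq_add_of_le' hr
  simp only [Nat.add_sub_cancel_left, Nat.add_sub_cancel] at *
  rw [show k + 1 + m - 1 = k + m by omega] at *
  nlinarith

theorem isHomogeneous_det_alternant {r : ℕ} (a : Fin r → ℕ) :
    (alternant r a).det.IsHomogeneous (∑ j, a j) := by
  rw [Matrix.det_apply]
  refine MvPolynomial.IsHomogeneous.sum _ _ _ fun e _ => ?_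
  have h : (∏ i, alternant r a (e i) i).IsHomogeneous (∑ j, a j) :=
    MvPolynomial.IsHomogeneous.prod _ _ _ fun i _ => by
      simpa [alternant] using (MvPolynomial.isHomogeneous_X_pow (R := ℂ) (e i) (a i))
  rcases Int.units_eq_one_or (Equiv.Perm.sign e) with h' | h'
  · simpa [h'] using h
  · simpa [h'] using h.neg

theorem sum_rev (r : ℕ) : ∑ j : Fin r, (j.rev : ℕ) = ∑ i ∈ Finset.range r, i := by
  rw [← Fin.sum_univ_eq_sum_range (fun i => i) r]
  exact Equiv.sum_comp Fin.revPerm (fun j : Fin r => (j : ℕ))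

theorem det_alternant_mem_flagIdeal {r N : ℕ} (a : Fin r → ℕ) (i : Fin r) (h : N ≤ a i) :
    (alternant r a).det ∈ flagIdeal r N := by
  rw [← Ideal.Quotient.eq_zero_iff_mem, RingHom.map_det]
  refine Matrix.det_eq_zero_of_column_eq_zero i fun k => ?_
  rw [RingHom.mapMatrix_apply, Matrix.map_apply, Ideal.Quotient.eq_zero_iff_mem]
  exact Ideal.mem_of_dvd _ (pow_dvd_pow _ h) (X_pow_mem_flagIdeal k)

/-- The algebraic form of vanishing above the dimension. The antisymmetric polynomial Δ f is a
combination of alternants of degree above r(N-r) + r(r-1)/2. Each has either two equal exponents,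
hence is zero, or an exponent at least N, hence a column in the ideal. Then Δ is removed. -/
theorem mem_flagIdeal_of_isHomogeneous {r N : ℕ} (hrN : r ≤ N) {f : MvPolynomial (Fin r) ℂ} {d : ℕ}
    (hs : f.IsSymmetric) (hf : f.IsHomogeneous d) (hd : r * (N - r) < d) :
    f ∈ flagIdeal r N := by
  have h1 : vand r * f ∈ flagIdeal r N := by
    have hr : (r.factorial : ℂ) ≠ 0 := by exact_mod_cast r.factorial_ne_zero
    have h2 := antisymm_of_isAntisymmetric ((isAntisymmetric_vand r).mul hs)
    have h3 : vand r * f = (r.factorial : ℂ)⁻¹ • antisymm r (vand r * f) := by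
      rw [h2, smul_smul, inv_mul_cancel₀ hr, one_smul]
    rw [h3, antisymm_eq_sum]
    refine Submodule.smul_of_tower_mem _ _ (Ideal.sum_mem _ fun α hα => ?_)
    refine Submodule.smul_of_tower_mem _ _ ?_
    by_cases hinj : Function.Injective α
    · have hhom : (vand r * f).IsHomogeneous (∑ j : Fin r, (j.rev : ℕ) + d) :=
        (isHomogeneous_det_alternant _).mul hf
      have hsum : α.degree = ∑ j : Fin r, (j.rev : ℕ) + d := by
        rw [Finsupp.degree_eq_weight_one]
        exact hhom (MvPolynomial.mem_support_iff.1 hα)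
      rw [Finsupp.degree_eq_sum, sum_rev] at hsum
      obtain ⟨i, hi⟩ := exists_le_of_injective_of_lt_sum (N := N) hrN α hinj (by omega)
      exact det_alternant_mem_flagIdeal _ i hi
    · simp only [Function.Injective, not_forall] at hinj
      obtain ⟨i, j, hij, hne⟩ := hinj
      rw [Matrix.det_zero_of_column_eq hne fun k => by simp [alternant, hij]]
      exact Ideal.zero_mem _
  have h4 := mem_relIdeal_of_vand_mul_mem ⟨f, hs⟩ h1
  exact Ideal.mem_map_of_mem (MvPolynomial.symmetricSubalgebra (Fin r) ℂ).val h4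

/-! ### Symmetric functions of the roots of `V ⊕ Q` -/

theorem coeff_prod_one_add {R ι : Type*} [CommRing R] [Fintype ι] (f : ι → R) (k : ℕ) :
    PowerSeries.coeff k (∏ i, (1 + PowerSeries.C (f i) * PowerSeries.X))
      = ∑ t ∈ Finset.powersetCard k (Finset.univ : Finset ι), ∏ i ∈ t, f i := by
  classical
  rw [Finset.prod_one_add, map_sum, Finset.powersetCard_eq_filter, Finset.sum_filter]
  refine Finset.sum_congr rfl fun t _ => ?_
  rw [Finset.prod_mul_distrib, Finset.prod_const, ← map_prod, PowerSeries.coeff_C_mul,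
    PowerSeries.coeff_X_pow]
  simp [eq_comm]

theorem coeff_prod_one_add_X (R σ : Type*) [CommRing R] [Fintype σ] (k : ℕ) :
    PowerSeries.coeff k (∏ i : σ, (1 + PowerSeries.C (MvPolynomial.X i : MvPolynomial σ R) *
      PowerSeries.X)) = MvPolynomial.esymm σ R k := coeff_prod_one_add _ k

theorem isSymmetric_coeff_of_map {σ R : Type*} [CommRing R]
    {u : PowerSeries (MvPolynomial σ R)}
    (h : ∀ e : Equiv.Perm σ, PowerSeries.map
      ((MvPolynomial.rename e : MvPolynomial σ R →ₐ[R] _) : _ →+* MvPolynomial σ R) u = u) (d : ℕ) :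
    (PowerSeries.coeff d u).IsSymmetric := fun e => by
  have h1 := congrArg (PowerSeries.coeff d) (h e)
  rwa [PowerSeries.coeff_map] at h1

theorem one_add_C_neg_mul_X {R : Type*} [CommRing R] (a : R) :
    1 + PowerSeries.C (-a) * PowerSeries.X = 1 - PowerSeries.C a * PowerSeries.X := by
  rw [map_neg, neg_mul, sub_eq_add_neg]

section Roots

variable {K : Type*} [CommRing K] {r : ℕ} (m : ℕ) (x : Fin r → K)

/-- Substitution of `y_1, …, y_m` and `-x_1, …, -x_r` for `m + r` variables. -/
def substRoots : MvPolynomial (Fin m ⊕ Fin r) K →ₐ[K] MvPolynomial (Fin m) K :=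
  MvPolynomial.aeval (Sum.elim MvPolynomial.X fun k => MvPolynomial.C (-x k))

variable {m}

theorem substRoots_isSymmetric {p : MvPolynomial (Fin m ⊕ Fin r) K}
    (hp : p.IsSymmetric) : (substRoots m x p).IsSymmetric := by
  intro e
  have h : (MvPolynomial.rename e : _ →ₐ[K] _).comp (substRoots m x)
      = (substRoots m x).comp
        (MvPolynomial.rename (Equiv.sumCongr e (Equiv.refl (Fin r)))) := by
    apply MvPolynomial.algHom_ext
    rintro (i | i) <;> simp [substRoots]
  refine (DFunLike.congr_fun h p).trans ?_
  rw [AlgHom.comp_apply, hp]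

theorem substRoots_esymm (k : ℕ) :
    substRoots m x (MvPolynomial.esymm _ _ k)
      = ∑ p ∈ Finset.HasAntidiagonal.antidiagonal k,
        MvPolynomial.esymm (Fin m) _ p.1 * MvPolynomial.C (PowerSeries.coeff p.2
          (∏ i : Fin r, (1 + PowerSeries.C (-x i) * PowerSeries.X))) := by
  have h : PowerSeries.map (substRoots m x).toRingHom
      (∏ i, (1 + PowerSeries.C (MvPolynomial.X i) * PowerSeries.X))
      = (∏ i : Fin m, (1 + PowerSeries.C (MvPolynomial.X i) * PowerSeries.X)) *
        PowerSeries.map MvPolynomial.C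
          (∏ i : Fin r, (1 + PowerSeries.C (-x i) * PowerSeries.X)) := by
    rw [map_prod, map_prod, Fintype.prod_sum_type]
    congr 1 <;> refine Finset.prod_congr rfl fun i _ => ?_ <;> simp [substRoots]
  have h1 := congrArg (PowerSeries.coeff k) h
  simp only [PowerSeries.coeff_map, PowerSeries.coeff_mul, coeff_prod_one_add_X] at h1
  exact h1

variable (E : MvPolynomial.symmetricSubalgebra (Fin m) K →ₐ[K] K)

theorem symmetric_algHom_eq_sum {ι : Type*} (s : Finset ι) {q : MvPolynomial (Fin m) K}
    (hq : q.IsSymmetric) (p : ι → MvPolynomial (Fin m) K) (hp : ∀ i, (p i).IsSymmetric)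
    (c : ι → K) (h : q = ∑ i ∈ s, p i * MvPolynomial.C (c i)) :
    E ⟨q, hq⟩ = ∑ i ∈ s, E ⟨p i, hp i⟩ * c i := by
  have h1 : (⟨q, hq⟩ : MvPolynomial.symmetricSubalgebra (Fin m) K)
      = ∑ i ∈ s, ⟨p i, hp i⟩ * algebraMap _ _ (c i) := by
    apply Subtype.ext
    rw [AddSubmonoidClass.coe_finsetSum]
    exact h
  rw [h1, map_sum]
  refine Finset.sum_congr rfl fun i _ => ?_
  rw [map_mul, AlgHom.commutes]
  rfl

variable {x E} {h : ℕ → K} {J : Ideal K}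

/-- This is c(V) c(Q) = 1, the -x_k being the Chern roots of V. The evaluation sets e_k(y) to zero
for k > m, while the exact inverse of ∏ (1 - x_i t) has coefficients h_k there; up to degree m + r
the discrepancy lies in J. -/
theorem algHom_substRoots_esymm_mem
    (hE : ∀ k, E ⟨MvPolynomial.esymm (Fin m) K k, MvPolynomial.esymm_isSymmetric _ _ k⟩
      = if k ≤ m then h k else 0)
    (hx : PowerSeries.mk h * ∏ i, (1 + PowerSeries.C (-x i) * PowerSeries.X) = 1)
    (hJ : ∀ k, m < k → k ≤ m + r → h k ∈ J) (k : ℕ) (hk : k + 1 ≤ m + r) :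
    E ⟨substRoots m x (MvPolynomial.esymm _ _ (k + 1)),
      substRoots_isSymmetric x (MvPolynomial.esymm_isSymmetric _ _ _)⟩ ∈ J := by
  have h2 : ∑ p ∈ Finset.HasAntidiagonal.antidiagonal (k + 1), h p.1 *
      PowerSeries.coeff p.2 (∏ i, (1 + PowerSeries.C (-x i) * PowerSeries.X)) = 0 := by
    have h3 := congrArg (PowerSeries.coeff (k + 1)) hx
    rw [PowerSeries.coeff_mul] at h3
    simpa [PowerSeries.coeff_one] using h3
  have h3 := symmetric_algHom_eq_sum E (ι := ℕ × ℕ) _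
      (substRoots_isSymmetric x (MvPolynomial.esymm_isSymmetric _ _ (k + 1)))
      (fun p => MvPolynomial.esymm (Fin m) K p.1)
      (fun p => MvPolynomial.esymm_isSymmetric (Fin m) K p.1)
      (fun p => PowerSeries.coeff p.2 (∏ i, (1 + PowerSeries.C (-x i) * PowerSeries.X)))
      (substRoots_esymm x (k + 1))
  -- Subtracting the vanishing full convolution leaves only the terms with h_k for k > m.
  rw [h3, ← sub_zero (Finset.sum _ _), ← h2, ← Finset.sum_sub_distrib]
  refine Ideal.sum_mem _ fun p hp => ?_
  rw [Finset.HasAntidiagonal.mem_antidiagonal] at hp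
  rw [hE, ← sub_mul]
  refine Ideal.mul_mem_right _ _ ?_
  split_ifs with hm
  · simp
  · rw [zero_sub]
    exact neg_mem (hJ _ (by omega) (by omega))

/-- A symmetric polynomial is a polynomial in e_1, …, e_{m+r}, all of which vanish modulo J at the
roots of V ⊕ Q, exactly as they do at the origin. -/
theorem mk_algHom_substRoots
    (hE : ∀ k, E ⟨MvPolynomial.esymm (Fin m) K k, MvPolynomial.esymm_isSymmetric _ _ k⟩
      = if k ≤ m then h k else 0)
    (hx : PowerSeries.mk h * ∏ i, (1 + PowerSeries.C (-x i) * PowerSeries.X) = 1)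
    (hJ : ∀ k, m < k → k ≤ m + r → h k ∈ J)
    {p : MvPolynomial (Fin m ⊕ Fin r) K} (hp : p.IsSymmetric) :
    Ideal.Quotient.mk J (E ⟨substRoots m x p, substRoots_isSymmetric x hp⟩)
      = Ideal.Quotient.mk J (MvPolynomial.aeval (fun _ => 0) p) := by
  let S := MvPolynomial.symmetricSubalgebra (Fin m ⊕ Fin r) K
  have hcard : Fintype.card (Fin m ⊕ Fin r) = m + r := by simp
  let F₁ : S →ₐ[K] K ⧸ J := (Ideal.Quotient.mkₐ K J).comp (E.comp
      (((substRoots m x).comp S.val).codRestrict _ fun p => substRoots_isSymmetric x p.2))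
  let F₂ : S →ₐ[K] K ⧸ J :=
    (Ideal.Quotient.mkₐ K J).comp ((MvPolynomial.aeval (fun _ => 0)).comp S.val)
  have h : F₁.comp (MvPolynomial.esymmAlgEquiv _ _ hcard).toAlgHom
      = F₂.comp (MvPolynomial.esymmAlgEquiv _ _ hcard).toAlgHom := by
    apply MvPolynomial.algHom_ext
    intro k
    have hk : MvPolynomial.esymmAlgEquiv (Fin m ⊕ Fin r) K hcard
        (MvPolynomial.X k) = ⟨MvPolynomial.esymm _ _ (k + 1),
          MvPolynomial.esymm_isSymmetric _ _ _⟩ := by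
      rw [← MvPolynomial.esymmAlgEquiv_symm_apply _ hcard, AlgEquiv.apply_symm_apply]
    change F₁ (MvPolynomial.esymmAlgEquiv _ _ hcard (MvPolynomial.X k))
      = F₂ (MvPolynomial.esymmAlgEquiv _ _ hcard (MvPolynomial.X k))
    rw [hk]
    trans 0
    · exact Ideal.Quotient.eq_zero_iff_mem.2
        (algHom_substRoots_esymm_mem hE hx hJ (k : ℕ) k.2)
    · symm
      change Ideal.Quotient.mk _ (MvPolynomial.aeval (fun _ => 0)
        (MvPolynomial.esymm (Fin m ⊕ Fin r) K (k + 1))) = 0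
      have : MvPolynomial.aeval (fun _ => (0 : K))
        (MvPolynomial.esymm (Fin m ⊕ Fin r) K (k + 1)) = 0 := by
        rw [MvPolynomial.esymm, map_sum]
        refine Finset.sum_eq_zero fun t ht => ?_
        rw [map_prod]
        obtain ⟨i, hi⟩ : t.Nonempty := Finset.card_pos.1 (by
          rw [(Finset.mem_powersetCard.1 ht).2]; omega)
        exact Finset.prod_eq_zero hi (by simp)
      rw [this, map_zero]
  have h' := DFunLike.congr_fun h ((MvPolynomial.esymmAlgEquiv _ _ hcard).symm ⟨p, hp⟩)
  change F₁ (MvPolynomial.esymmAlgEquiv _ _ hcard _)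
    = F₂ (MvPolynomial.esymmAlgEquiv _ _ hcard _) at h'
  rw [AlgEquiv.apply_symm_apply] at h'
  exact h'

variable [Algebra ℂ K]

/-- `∏_{i,j} φ((x_i + y_j) t)`. -/
def prodSumRoots (m : ℕ) (x : Fin r → K) (φ : PowerSeries ℂ) :
    PowerSeries (MvPolynomial (Fin m) K) :=
  ∏ p : Fin r × Fin m, scaledSeries (MvPolynomial.C (x p.1) + MvPolynomial.X p.2) φ

theorem isSymmetric_coeff_prod_scaledSeries {σ : Type*} [Fintype σ] (x : Fin r → K)
    (φ : PowerSeries ℂ) (d : ℕ) : (PowerSeries.coeff d (∏ p : Fin r × σ, scaledSeries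
      (MvPolynomial.C (x p.1) + MvPolynomial.X p.2 : MvPolynomial σ K) φ)).IsSymmetric := by
  refine isSymmetric_coeff_of_map (fun e => ?_) d
  rw [map_prod]
  refine Fintype.prod_equiv (Equiv.prodCongr (Equiv.refl (Fin r)) e) _ _ fun p => ?_
  refine (map_scaledSeries ((MvPolynomial.rename e : MvPolynomial σ K
    →ₐ[K] _).restrictScalars ℂ) _ _).trans ?_
  simp

/-- The multiplicative class of Hom(V, V ⊕ Q) splits into those of Hom(V, Q) and Hom(V, V). -/
theorem map_substRoots_prod_scaledSeries (m : ℕ) (x : Fin r → K) (φ : PowerSeries ℂ) :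
    PowerSeries.map (substRoots m x : _ →+* MvPolynomial (Fin m) K)
      (∏ p : Fin r × (Fin m ⊕ Fin r),
        scaledSeries (MvPolynomial.C (x p.1) + MvPolynomial.X p.2) φ)
      = prodSumRoots m x φ * PowerSeries.map MvPolynomial.C
        (∏ p : Fin r × Fin r, scaledSeries (x p.1 - x p.2) φ) := by
  have h1 : ∀ p : Fin r × (Fin m ⊕ Fin r), PowerSeries.map
      (substRoots m x : _ →+* MvPolynomial (Fin m) K)
      (scaledSeries (MvPolynomial.C (x p.1) + MvPolynomial.X p.2) φ)
      = scaledSeries (MvPolynomial.C (x p.1) +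
          Sum.elim MvPolynomial.X (fun k => MvPolynomial.C (-x k)) p.2) φ := fun p => by
    refine (map_scaledSeries ((substRoots m x).restrictScalars ℂ) _ _).trans ?_
    simp [substRoots]
  simp only [prodSumRoots, map_prod, h1]
  rw [Fintype.prod_prod_type, Fintype.prod_prod_type, Fintype.prod_prod_type,
    ← Finset.prod_mul_distrib]
  refine Finset.prod_congr rfl fun i _ => ?_
  rw [Fintype.prod_sum_type]
  congr 1
  refine Finset.prod_congr rfl fun k _ => ?_
  refine Eq.trans ?_ (map_scaledSeries (IsScalarTower.toAlgHom ℂ K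
    (MvPolynomial (Fin m) K)) _ _).symm
  simp [MvPolynomial.algebraMap_eq, sub_eq_add_neg]

theorem map_aeval_zero_prod_scaledSeries (m : ℕ) (x : Fin r → K) (φ : PowerSeries ℂ) :
    PowerSeries.map ((MvPolynomial.aeval (fun _ => 0) :
        MvPolynomial (Fin m ⊕ Fin r) K →ₐ[K] K) : _ →+* K)
      (∏ p : Fin r × (Fin m ⊕ Fin r),
        scaledSeries (MvPolynomial.C (x p.1) + MvPolynomial.X p.2) φ)
      = ∏ i : Fin r, scaledSeries (x i) φ ^ (m + r) := by
  have h1 : ∀ p : Fin r × (Fin m ⊕ Fin r), PowerSeries.map ((MvPolynomial.aeval (fun _ => 0) :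
      MvPolynomial (Fin m ⊕ Fin r) K →ₐ[K] K) : _ →+* K)
      (scaledSeries (MvPolynomial.C (x p.1) + MvPolynomial.X p.2) φ)
      = scaledSeries (x p.1) φ := fun p => by
    refine (map_scaledSeries ((MvPolynomial.aeval (fun _ => 0) :
      MvPolynomial (Fin m ⊕ Fin r) K →ₐ[K] K).restrictScalars ℂ) _ _).trans ?_
    simp
  simp only [map_prod, h1]
  rw [Fintype.prod_prod_type]
  simp

/-- If the elementary symmetric functions of the `y_j` and the `-x_k` together vanish, then
`∏_{i,j} φ((x_i + y_j) t) · ∏_{i,k} φ((x_i - x_k) t) = ∏_i φ(x_i t)^{m + r}`. -/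
theorem mk_algHom_prodSumRoots_mul
    (hE : ∀ k, E ⟨MvPolynomial.esymm (Fin m) K k, MvPolynomial.esymm_isSymmetric _ _ k⟩
      = if k ≤ m then h k else 0)
    (hx : PowerSeries.mk h * ∏ i, (1 + PowerSeries.C (-x i) * PowerSeries.X) = 1)
    (hJ : ∀ k, m < k → k ≤ m + r → h k ∈ J) (φ : PowerSeries ℂ) :
    PowerSeries.mk (fun d => Ideal.Quotient.mk J
        (E ⟨PowerSeries.coeff d (prodSumRoots m x φ), isSymmetric_coeff_prod_scaledSeries x φ d⟩))
      * PowerSeries.map (Ideal.Quotient.mk J)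
        (∏ p : Fin r × Fin r, scaledSeries (x p.1 - x p.2) φ)
      = PowerSeries.map (Ideal.Quotient.mk J) (∏ i : Fin r, scaledSeries (x i) φ ^ (m + r)) := by
  ext1 d
  rw [← map_aeval_zero_prod_scaledSeries, PowerSeries.coeff_map, PowerSeries.coeff_map]
  refine Eq.trans ?_ (mk_algHom_substRoots hE hx hJ (isSymmetric_coeff_prod_scaledSeries x φ d))
  have h2 := congrArg (PowerSeries.coeff d) (map_substRoots_prod_scaledSeries m x φ)
  simp only [PowerSeries.coeff_map, PowerSeries.coeff_mul] at h2
  have h3 := symmetric_algHom_eq_sum E (ι := ℕ × ℕ) _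
      (substRoots_isSymmetric x (isSymmetric_coeff_prod_scaledSeries x φ d))
      (fun p => PowerSeries.coeff p.1 (prodSumRoots m x φ))
      (fun p => isSymmetric_coeff_prod_scaledSeries x φ p.1)
      (fun p => PowerSeries.coeff p.2 (∏ p : Fin r × Fin r, scaledSeries (x p.1 - x p.2) φ)) h2
  rw [h3, map_sum, PowerSeries.coeff_mul]
  refine Finset.sum_congr rfl fun p _ => ?_
  rw [map_mul, PowerSeries.coeff_mk, PowerSeries.coeff_map]

end Roots

/-! ### The Gamma class in terms of the Chern roots of `V^*` -/

theorem evalQuotientRoots_esymm (r m k : ℕ) :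
    evalQuotientRoots r m ⟨MvPolynomial.esymm (Fin m) _ k, MvPolynomial.esymm_isSymmetric _ _ k⟩
      = if k ≤ m then MvPolynomial.hsymm (Fin r) ℂ k else 0 := by
  rcases k with _ | k
  · have h : (⟨MvPolynomial.esymm (Fin m) (MvPolynomial (Fin r) ℂ) 0,
        MvPolynomial.esymm_isSymmetric _ _ 0⟩ : MvPolynomial.symmetricSubalgebra (Fin m)
          (MvPolynomial (Fin r) ℂ)) = 1 := Subtype.ext (by simp)
    rw [h, map_one]
    simp
  · split_ifs with hk
    · have h := MvPolynomial.esymmAlgEquiv_symm_apply (R := MvPolynomial (Fin r) ℂ)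
        (Fintype.card_fin m) (⟨k, hk⟩ : Fin m)
      change MvPolynomial.aeval _ ((MvPolynomial.esymmAlgEquiv (Fin m) (MvPolynomial (Fin r) ℂ)
        (Fintype.card_fin m)).symm _) = _
      rw [h]
      simp
    · have h : (⟨MvPolynomial.esymm (Fin m) (MvPolynomial (Fin r) ℂ) (k + 1),
        MvPolynomial.esymm_isSymmetric _ _ (k + 1)⟩ : MvPolynomial.symmetricSubalgebra (Fin m)
          (MvPolynomial (Fin r) ℂ)) = 0 := by
        apply Subtype.ext
        change MvPolynomial.esymm (Fin m) (MvPolynomial (Fin r) ℂ) (k + 1) = 0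
        rw [MvPolynomial.esymm, Finset.powersetCard_eq_empty.2 (by simpa using hk),
          Finset.sum_empty]
      rw [h, map_zero]

/-- `∏_i Γ(1 + x_i t)^N / ∏_{i,k} Γ(1 + (x_i - x_k) t)`. -/
def gammaRatio (r N : ℕ) : PowerSeries (MvPolynomial (Fin r) ℂ) :=
  (∏ i : Fin r, scaledSeries (MvPolynomial.X i) gammaSeries ^ N) *
    ∏ p : Fin r × Fin r, scaledSeries (MvPolynomial.X p.1 - MvPolynomial.X p.2) gammaSeries⁻¹

/-- The multiplicative class of Hom(V, Q) is that of Hom(V, ℂ^{m+r}) divided by that of Hom(V, V);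
the division is legitimate because the Gamma series is invertible. -/
theorem toFlagRing_gammaPoly (r m : ℕ) :
    toFlagRing r (m + r) (gammaPoly r m) = toFlagRing r (m + r)
      (partialSum (r * m) (gammaRatio r (m + r))) := by
  have hG : ∀ d, (PowerSeries.coeff d (prodSumRoots m (MvPolynomial.X : Fin r →
    MvPolynomial (Fin r) ℂ) gammaSeries)).IsSymmetric :=
      isSymmetric_coeff_prod_scaledSeries _ gammaSeries
  have hx : PowerSeries.mk (fun k => MvPolynomial.hsymm (Fin r) ℂ k) *
      ∏ i : Fin r, (1 + PowerSeries.C (-MvPolynomial.X i) * PowerSeries.X) = 1 := by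
    rw [Finset.prod_congr rfl fun i _ => one_add_C_neg_mul_X (MvPolynomial.X i)]
    exact mk_hsymm_mul_prod r
  have key := mk_algHom_prodSumRoots_mul (E := evalQuotientRoots r m)
    (J := flagIdeal r (m + r)) (x := MvPolynomial.X) (evalQuotientRoots_esymm r m)
    hx
    (fun k h1 h2 => hsymm_mem_flagIdeal (by omega) h2) gammaSeries
  have hq : (∏ p : Fin r × Fin r, scaledSeries (MvPolynomial.X p.1 - MvPolynomial.X p.2 :
        MvPolynomial (Fin r) ℂ) gammaSeries) * ∏ p : Fin r × Fin r,
      scaledSeries (MvPolynomial.X p.1 - MvPolynomial.X p.2 : MvPolynomial (Fin r) ℂ)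
        gammaSeries⁻¹ = 1 := by
    rw [← Finset.prod_mul_distrib]
    exact Finset.prod_eq_one fun p _ => by rw [← map_mul, gammaSeries_mul_inv, map_one]
  have hG' : PowerSeries.mk (fun d => Ideal.Quotient.mk (flagIdeal r (m + r))
        (evalQuotientRoots r m ⟨_, hG d⟩))
      = PowerSeries.map (Ideal.Quotient.mk (flagIdeal r (m + r))) (gammaRatio r (m + r)) := by
    rw [gammaRatio, map_mul, ← key, mul_assoc, ← map_mul, hq, map_one, mul_one]
  have hfin : gammaPoly r m = ∑ d ∈ Finset.range (r * m + 1),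
      evalQuotientRoots r m ⟨_, hG d⟩ := by
    have h1 : gammaRoots r m = ∑ d ∈ Finset.range (r * m + 1), PowerSeries.coeff d
        (prodSumRoots m (MvPolynomial.X : Fin r → MvPolynomial (Fin r) ℂ) gammaSeries) := by
      rw [gammaRoots, truncProd_eq_partialSum, partialSum_apply]
      rfl
    rw [gammaPoly, symmetric_algHom_eq_sum (evalQuotientRoots r m) _ (gammaRoots_isSymmetric r m)
      _ hG (fun _ => 1) (by simpa using h1)]
    simp
  change Ideal.Quotient.mk _ _ = Ideal.Quotient.mk _ _
  rw [← partialSum_map, ← hG', hfin, map_sum, partialSum_apply]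
  simp

/-! ### The Satake identification as a quotient of determinants -/

theorem coe_hSym_one_one : ((hSym 1 1 : SymPoly 1) : MvPolynomial (Fin 1) ℂ)
    = MvPolynomial.X 0 := by
  simp [hSym]

/-- The map `H(ℙ^{N-1}) → ℂ[x_1, …, x_r] / ⟨h_{N-r+1}, …, h_N⟩` with `h ↦ x_i`. -/
def rootEval {r : ℕ} (N : ℕ) (i : Fin r) : HG 1 N →ₐ[ℂ] FlagRing r N :=
  Ideal.Quotient.liftₐ (relIdeal 1 N)
    ((MvPolynomial.aeval fun _ => toFlagRing r N (MvPolynomial.X i)).comp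
      (MvPolynomial.symmetricSubalgebra (Fin 1) ℂ).val) (by
    intro a ha
    rw [relIdeal_one, Ideal.mem_span_singleton] at ha
    obtain ⟨c, rfl⟩ := ha
    rw [map_mul, map_pow]
    have h : ((MvPolynomial.aeval fun _ => toFlagRing r N (MvPolynomial.X i)).comp
        (MvPolynomial.symmetricSubalgebra (Fin 1) ℂ).val) (hSym 1 1)
        = toFlagRing r N (MvPolynomial.X i) := by
      rw [AlgHom.comp_apply, Subalgebra.val_apply, coe_hSym_one_one, MvPolynomial.aeval_X]
    rw [h, ← map_pow]
    have h2 : toFlagRing r N (MvPolynomial.X i ^ N) = 0 :=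
      Ideal.Quotient.eq_zero_iff_mem.2 (X_pow_mem_flagIdeal i)
    rw [h2, zero_mul])

theorem rootEval_specialClass {r N : ℕ} (i : Fin r) :
    rootEval N i (specialClass 1 N 1) = toFlagRing r N (MvPolynomial.X i) := by
  change MvPolynomial.aeval (fun _ => toFlagRing r N (MvPolynomial.X i))
    ((hSym 1 1 : SymPoly 1) : MvPolynomial (Fin 1) ℂ) = _
  rw [coe_hSym_one_one, MvPolynomial.aeval_X]

/-- The alternating map `(u_1, …, u_r) ↦ det (u_j(x_i))`. -/
def detRootEval (r N : ℕ) : (HG 1 N) [⋀^Fin r]→ₗ[ℂ] FlagRing r N :=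
  { ((Matrix.detRowAlternating (n := Fin r) (R := FlagRing r N)).toMultilinearMap.restrictScalars
      ℂ).compLinearMap (fun _ => LinearMap.pi fun i => (rootEval N i).toLinearMap) with
    map_eq_zero_of_eq' := fun u i j hij hne =>
      (Matrix.detRowAlternating (n := Fin r) (R := FlagRing r N)).map_eq_zero_of_eq _
        (by simp [hij]) hne }

theorem detRootEval_apply {r N : ℕ} (u : Fin r → HG 1 N) :
    detRootEval r N u = (Matrix.of fun i j => rootEval N i (u j)).det := by
  rw [← Matrix.det_transpose]
  rfl

/-- The exponents strictly decrease to a natural number. Hence the truncated subtraction in `satake`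
is a true one. -/
theorem rev_le_wedgeExponents {r N : ℕ} (s : Set.powersetCard (Fin N)ᵒᵈ r) (j : Fin r) :
    (j.rev : ℕ) ≤ wedgeExponents s j := by
  have hanti : StrictAnti (wedgeExponents s) := fun i k hik =>
    (Set.powersetCard.ofFinEmbEquiv.symm s).strictMono hik
  have h : ∀ n : ℕ, ∀ j : Fin r, (j.rev : ℕ) = n → n ≤ wedgeExponents s j := by
    intro n
    induction n with
    | zero => exact fun j _ => Nat.zero_le _
    | succ n ih =>
      intro j hj
      rw [Fin.val_rev] at hj
      have hlt : (j : ℕ) + 1 < r := by omega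
      have h1 := ih ⟨j + 1, hlt⟩ (by rw [Fin.val_rev]; simp only; omega)
      have h2 : wedgeExponents s ⟨j + 1, hlt⟩ < wedgeExponents s j :=
        hanti (show j < ⟨j + 1, hlt⟩ from Nat.lt_succ_self _)
      omega
  exact h _ j rfl

theorem vand_mul_pullback_schubertClass {r N : ℕ} (l : Fin r → ℕ) :
    toFlagRing r N (vand r) * pullback r N (schubertClass N l)
      = (Matrix.of fun i j => toFlagRing r N (MvPolynomial.X i) ^ (l j + (j.rev : ℕ))).det := by
  rw [schubertClass, pullback_toHG, ← map_mul, vand, ← schurPoly_spec, AlgHom.map_det]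
  congr 1

/-- Both sides come from linear maps on the exterior power, so the wedges of powers of h suffice;
there the formula is the defining quotient of the Schur polynomial. It gives access to Sat on wedges
of arbitrary classes. -/
theorem vand_mul_pullback_satake {r N : ℕ} (u : Fin r → HG 1 N) :
    toFlagRing r N (vand r) * pullback r N (satake r N (exteriorPower.ιMulti ℂ r u))
      = (Matrix.of fun i j => rootEval N i (u j)).det := by
  have h : (LinearMap.mulLeft ℂ (toFlagRing r N (vand r))) ∘ₗ (pullback r N).toLinearMap ∘ₗ
      satake r N = exteriorPower.alternatingMapLinearEquiv (detRootEval r N) := by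
    refine (wedgeBasis r N).ext fun s => ?_
    have h1 : wedgeBasis r N s
        = exteriorPower.ιMulti ℂ r fun j => specialClass 1 N 1 ^ wedgeExponents s j := by
      rw [wedgeBasis, exteriorPower.basis_apply]
      simp only [exteriorPower.ιMulti_family]
      congr 1
      ext1 j
      simp [hyperplaneBasis_apply, wedgeExponents]
    have h2 : satake r N (wedgeBasis r N s) = schubertClass N fun j =>
        wedgeExponents s j - (j.rev : ℕ) := Module.Basis.constr_basis _ _ _ _
    rw [LinearMap.comp_apply, LinearMap.comp_apply, h2, h1,
      exteriorPower.alternatingMapLinearEquiv_apply_ιMulti, detRootEval_apply]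
    refine (vand_mul_pullback_schubertClass _).trans ?_
    congr 1
    ext1 i j
    simp only [Matrix.of_apply, map_pow, rootEval_specialClass]
    rw [Nat.sub_add_cancel (rev_le_wedgeExponents s j)]
  have h3 := DFunLike.congr_fun h (exteriorPower.ιMulti ℂ r u)
  rw [exteriorPower.alternatingMapLinearEquiv_apply_ιMulti, detRootEval_apply] at h3
  exact h3

set_option linter.unusedSectionVars false

/-! ### Functions on words -/

section Words

variable {X : Type} [Fintype X] [DecidableEq X] {r : ℕ}

/-- The number of occurrences of the letter `i` in the word `w`. -/
def letterCount (w : X → Fin r) (i : Fin r) : ℕ := (Finset.univ.filter fun a => w a = i).card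

theorem letterCount_eq_sum (w : X → Fin r) (i : Fin r) :
    letterCount w i = ∑ a, if w a = i then 1 else 0 := by
  rw [letterCount, Finset.card_filter]

theorem sum_letterCount (w : X → Fin r) : ∑ i, letterCount w i = Fintype.card X := by
  simp_rw [letterCount, ← Finset.card_univ]
  exact (Finset.card_eq_sum_card_fiberwise fun a _ => Finset.mem_univ (w a)).symm

theorem letterCount_comp_perm (w : X → Fin r) (p : Equiv.Perm X) :
    letterCount (w ∘ p) = letterCount w := by
  funext i
  rw [letterCount_eq_sum, letterCount_eq_sum]
  exact Equiv.sum_comp p (fun a => if w a = i then 1 else 0)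

theorem letterCount_update (w : X → Fin r) (a : X) (j : Fin r) :
    letterCount (Function.update w a j) + Pi.single (w a) 1 = letterCount w + Pi.single j 1 := by
  funext k
  simp only [Pi.add_apply, letterCount_eq_sum]
  rw [← Finset.add_sum_erase _ _ (Finset.mem_univ a),
    ← Finset.add_sum_erase _ (fun b => if w b = k then 1 else 0) (Finset.mem_univ a)]
  have h : ∑ b ∈ Finset.univ.erase a, (if Function.update w a j b = k then 1 else 0)
      = ∑ b ∈ Finset.univ.erase a, if w b = k then 1 else 0 :=
    Finset.sum_congr rfl fun b hb => by rw [Function.update_of_ne (Finset.ne_of_mem_erase hb)]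
  rw [h, Function.update_self]
  simp only [Pi.single_apply, eq_comm (a := k)]
  ring

/-- The action of permutations of positions on functions on words. -/
def permRep : Equiv.Perm X →* Module.End ℂ ((X → Fin r) → ℂ) where
  toFun p := LinearMap.funLeft ℂ ℂ fun w => w ∘ p
  map_one' := rfl
  map_mul' _ _ := rfl

theorem permRep_apply (p : Equiv.Perm X) (f : (X → Fin r) → ℂ) (w : X → Fin r) :
    permRep p f w = f (w ∘ p) := rfl

/-- The action of the elementary matrix with entry `1` in row `i` and column `j` (as an element of
the Lie algebra) on functions on words. -/
def elemAct (i j : Fin r) : Module.End ℂ ((X → Fin r) → ℂ) where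
  toFun f w := ∑ a, if w a = i then f (Function.update w a j) else 0
  map_add' f g := by
    funext w
    simp only [Pi.add_apply, ← Finset.sum_add_distrib]
    exact Finset.sum_congr rfl fun a _ => by split_ifs <;> simp
  map_smul' c f := by
    funext w
    simp only [Pi.smul_apply, smul_eq_mul, Finset.mul_sum, RingHom.id_apply]
    exact Finset.sum_congr rfl fun a _ => by split_ifs <;> simp

theorem elemAct_apply (i j : Fin r) (f : (X → Fin r) → ℂ) (w : X → Fin r) :
    elemAct i j f w = ∑ a, if w a = i then f (Function.update w a j) else 0 := rfl

theorem elemAct_mul_permRep (i j : Fin r) (p : Equiv.Perm X) :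
    elemAct i j * permRep p = permRep p * elemAct i j := by
  refine LinearMap.ext fun f => funext fun w => ?_
  simp only [Module.End.mul_apply, elemAct_apply, permRep_apply]
  refine (Equiv.sum_comp p _).symm.trans (Finset.sum_congr rfl fun a _ => ?_)
  have h : Function.update w (p a) j ∘ p = Function.update (w ∘ p) a j := by
    funext b
    by_cases hb : b = a
    · simp [hb]
    · simp [Function.update_of_ne hb, Function.update_of_ne (p.injective.ne hb)]
  simp [h]

/-- Two letters are replaced in turn. If both replacements occur at the same position the word is
unchanged, once for each letter i; otherwise an i and a j trade places. -/
theorem elemAct_elemAct {i j : Fin r} (hij : i ≠ j) (f : (X → Fin r) → ℂ) (w : X → Fin r) :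
    elemAct i j (elemAct j i f) w = letterCount w i * f w
      + ∑ a, ∑ b, if w a = i ∧ w b = j then f (w ∘ Equiv.swap a b) else 0 := by
  rw [elemAct_apply, letterCount_eq_sum]
  push_cast
  rw [Finset.sum_mul, ← Finset.sum_add_distrib]
  refine Finset.sum_congr rfl fun a _ => ?_
  by_cases ha : w a = i
  · simp only [ha, if_true, true_and, one_mul]
    rw [elemAct_apply, ← Finset.add_sum_erase _ _ (Finset.mem_univ a),
      ← Finset.add_sum_erase _ (fun b => if w b = j then f (w ∘ Equiv.swap a b) else 0)
        (Finset.mem_univ a)]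
    have h1 : ¬ w a = j := by rw [ha]; exact hij
    rw [if_pos (Function.update_self _ _ _), if_neg h1, zero_add, Function.update_idem]
    congr 1
    · rw [← ha, Function.update_eq_self]
    · refine Finset.sum_congr rfl fun b hb => ?_
      have hba := Finset.ne_of_mem_erase hb
      rw [Function.update_of_ne hba]
      split_ifs with hbj
      · congr 1
        funext c
        rcases eq_or_ne c b with rfl | hcb
        · simp [ha]
        · rcases eq_or_ne c a with rfl | hca
          · rw [Function.update_of_ne hcb, Function.update_self]
            simp [hbj]
          · rw [Function.update_of_ne hcb, Function.update_of_ne hca]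
            simp [Equiv.swap_apply_of_ne_of_ne hca hcb]
      · rfl
  · simp [ha]

/-- The relation [E_ij, E_ji] = E_ii - E_jj: the exchange terms are symmetric in i and j and cancel.
-/
theorem elemAct_commutator {i j : Fin r} (hij : i ≠ j) (f : (X → Fin r) → ℂ) (w : X → Fin r) :
    elemAct i j (elemAct j i f) w - elemAct j i (elemAct i j f) w
      = ((letterCount w i : ℂ) - letterCount w j) * f w := by
  rw [elemAct_elemAct hij, elemAct_elemAct hij.symm]
  have h : (∑ a, ∑ b, if w a = j ∧ w b = i then f (w ∘ Equiv.swap a b) else 0)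
      = ∑ a, ∑ b, if w a = i ∧ w b = j then f (w ∘ Equiv.swap a b) else 0 := by
    rw [Finset.sum_comm]
    refine Finset.sum_congr rfl fun a _ => Finset.sum_congr rfl fun b _ => ?_
    rw [Equiv.swap_comm]
    exact if_congr and_comm rfl rfl
  rw [h]
  ring

/-- The sum of the transpositions of all pairs of positions. -/
def swapSum (X : Type) [Fintype X] [DecidableEq X] (r : ℕ) : Module.End ℂ ((X → Fin r) → ℂ) :=
  ∑ a, ∑ b, permRep (Equiv.swap a b)

theorem swapSum_mul_permRep (p : Equiv.Perm X) :
    swapSum X r * permRep p = permRep p * swapSum X r := by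
  simp only [swapSum, Finset.sum_mul, Finset.mul_sum, ← map_mul]
  rw [← Equiv.sum_comp p]
  refine Finset.sum_congr rfl fun a _ => ?_
  rw [← Equiv.sum_comp p]
  refine Finset.sum_congr rfl fun b _ => ?_
  rw [Equiv.mul_swap_eq_swap_mul]

/-- The Casimir identity. -/
theorem sum_elemAct_elemAct (f : (X → Fin r) → ℂ) (w : X → Fin r) :
    (∑ i, ∑ j, if i ≠ j then elemAct i j (elemAct j i f) w else 0)
      = ((r : ℂ) - 1) * Fintype.card X * f w + swapSum X r f w
        - (∑ i, (letterCount w i : ℂ) ^ 2) * f w := by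
  -- The off-diagonal formula is extended to i = j and corrected there: exchanging two equal letters
  -- changes nothing, so the exchange sum is the squared letter count times f w.
  have h1 : ∀ i j, (if i ≠ j then elemAct i j (elemAct j i f) w else 0)
      = ((letterCount w i : ℂ) * f w
        + ∑ a, ∑ b, if w a = i ∧ w b = j then f (w ∘ Equiv.swap a b) else 0)
        - if i = j then (letterCount w i : ℂ) * f w + (letterCount w i : ℂ) ^ 2 * f w
          else 0 := by
    intro i j
    by_cases hij : i = j
    · subst hij
      have h2 : (∑ a, ∑ b, if w a = i ∧ w b = i then f (w ∘ Equiv.swap a b) else 0)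
          = (letterCount w i : ℂ) ^ 2 * f w := by
        rw [letterCount_eq_sum]
        push_cast
        rw [sq, Finset.sum_mul_sum, Finset.sum_mul]
        refine Finset.sum_congr rfl fun a _ => ?_
        rw [Finset.sum_mul]
        refine Finset.sum_congr rfl fun b _ => ?_
        by_cases ha : w a = i
        · by_cases hb : w b = i
          · have : w ∘ Equiv.swap a b = w := by
              funext c
              simp only [Function.comp_apply, Equiv.swap_apply_def]
              split_ifs with h h'
              · rw [h, ha, hb]
              · rw [h', ha, hb]
              · rfl
            simp [ha, hb, this]
          · simp [hb]
        · simp [ha]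
      simp [h2]
    · simp [hij, elemAct_elemAct]
  simp only [h1, Finset.sum_sub_distrib, Finset.sum_add_distrib]
  have h3 : ∑ i : Fin r, ∑ j : Fin r, (letterCount w i : ℂ) * f w
      = r * Fintype.card X * f w := by
    simp only [Finset.sum_const, Finset.card_univ, Fintype.card_fin, nsmul_eq_mul]
    rw [← Finset.mul_sum, ← Finset.sum_mul, ← sum_letterCount w]
    push_cast
    ring
  have h4 : (∑ i : Fin r, ∑ j : Fin r, ∑ a, ∑ b,
      if w a = i ∧ w b = j then f (w ∘ Equiv.swap a b) else 0) = swapSum X r f w := by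
    simp only [swapSum, LinearMap.sum_apply, Finset.sum_apply, permRep_apply]
    simp_rw [Finset.sum_comm (s := (Finset.univ : Finset (Fin r))) (t := (Finset.univ : Finset X))]
    refine Finset.sum_congr rfl fun a _ => Finset.sum_congr rfl fun b _ => ?_
    simp [ite_and]
  have h5 : ∑ i : Fin r, (letterCount w i : ℂ) * f w = Fintype.card X * f w := by
    rw [← Finset.sum_mul, ← sum_letterCount w]
    push_cast
    rfl
  rw [h3, h4]
  simp only [Finset.sum_ite_eq, Finset.mem_univ, if_true, Finset.sum_add_distrib]
  rw [h5, ← Finset.sum_mul]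
  ring

/-- The functions supported on words with content `μ`. -/
def contentSpace (X : Type) [Fintype X] {r : ℕ} (μ : Fin r → ℕ) :
    Submodule ℂ ((X → Fin r) → ℂ) where
  carrier := {f | ∀ w, letterCount w ≠ μ → f w = 0}
  add_mem' hf hg w hw := by simp [hf w hw, hg w hw]
  zero_mem' _ _ := rfl
  smul_mem' c f hf w hw := by simp [hf w hw]

theorem elemAct_mem_contentSpace {i j : Fin r} {κ : Fin r → ℕ} {f : (X → Fin r) → ℂ}
    (hf : f ∈ contentSpace X (κ + Pi.single j 1)) :
    elemAct i j f ∈ contentSpace X (κ + Pi.single i 1) := by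
  intro w hw
  rw [elemAct_apply]
  refine Finset.sum_eq_zero fun a _ => ?_
  split_ifs with ha
  · refine hf _ fun h => hw ?_
    have h1 := letterCount_update w a j
    rw [h, ha] at h1
    have h2 : (κ + Pi.single i 1) + Pi.single j 1 = letterCount w + Pi.single j 1 := by
      rw [← h1]
      abel
    exact (add_right_cancel h2).symm
  · rfl

theorem elemAct_elemAct_mem_contentSpace {i j : Fin r} (hij : i ≠ j) {μ : Fin r → ℕ}
    {f : (X → Fin r) → ℂ} (hf : f ∈ contentSpace X μ) :
    elemAct i j (elemAct j i f) ∈ contentSpace X μ := by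
  intro w hw
  rw [elemAct_elemAct hij, hf w hw, mul_zero, zero_add]
  refine Finset.sum_eq_zero fun a _ => Finset.sum_eq_zero fun b _ => ?_
  split_ifs
  · exact hf _ (by rwa [letterCount_comp_perm])
  · rfl

/-! ### Traces on weight spaces -/

variable (W : Submodule ℂ ((X → Fin r) → ℂ))

/-- The dimension of the space of elements of `W` with content `μ`. -/
def contentDim (μ : Fin r → ℕ) : ℕ :=
  Module.finrank ℂ (W ⊓ contentSpace X μ : Submodule ℂ ((X → Fin r) → ℂ))

theorem elemAct_elemAct_mem (hW : ∀ i j : Fin r, ∀ f ∈ W, elemAct i j f ∈ W)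
    {i j : Fin r} (hij : i ≠ j) (μ : Fin r → ℕ) :
    ∀ f ∈ W ⊓ contentSpace X μ,
      (elemAct i j * elemAct j i : Module.End ℂ ((X → Fin r) → ℂ)) f ∈ W ⊓ contentSpace X μ :=
  fun f hf => ⟨hW i j _ (hW j i f hf.1), elemAct_elemAct_mem_contentSpace hij hf.2⟩

theorem elemAct_mem_inf (hW : ∀ i j : Fin r, ∀ f ∈ W, elemAct i j f ∈ W)
    (i j : Fin r) (κ : Fin r → ℕ) :
    ∀ f ∈ W ⊓ contentSpace X (κ + Pi.single j 1),
      elemAct i j f ∈ W ⊓ contentSpace X (κ + Pi.single i 1) :=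
  fun f hf => ⟨hW i j f hf.1, elemAct_mem_contentSpace hf.2⟩

/-- The trace of `E_{ij} E_{ji}` on the elements of `W` of content `μ`, and `0` if `i = j`. -/
def elemTrace (hW : ∀ i j : Fin r, ∀ f ∈ W, elemAct i j f ∈ W)
    (i j : Fin r) (μ : Fin r → ℕ) : ℂ :=
  if hij : i ≠ j then
    LinearMap.trace ℂ _ ((elemAct i j * elemAct j i).restrict (elemAct_elemAct_mem W hW hij μ))
  else 0

/-- Cyclicity of the trace for E_ij and E_ji viewed as maps between the two adjacent weight spaces κ
+ e_j and κ + e_i. -/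
theorem elemTrace_shift (hW : ∀ i j : Fin r, ∀ f ∈ W, elemAct i j f ∈ W)
    (i j : Fin r) (κ : Fin r → ℕ) :
    elemTrace W hW i j (κ + Pi.single i 1) = elemTrace W hW j i (κ + Pi.single j 1) := by
  by_cases hij : i = j
  · subst hij; rfl
  have hji : j ≠ i := fun h => hij h.symm
  rw [elemTrace, elemTrace, dif_pos hij, dif_pos hji]
  exact LinearMap.trace_comp_comm' ((elemAct j i).restrict (elemAct_mem_inf W hW j i κ))
    ((elemAct i j).restrict (elemAct_mem_inf W hW i j κ))

theorem elemTrace_eq_zero (hW : ∀ i j : Fin r, ∀ f ∈ W, elemAct i j f ∈ W)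
    (i j : Fin r) (μ : Fin r → ℕ) (hμ : μ i = 0) :
    elemTrace W hW i j μ = 0 := by
  by_cases hij : i = j
  · simp [elemTrace, hij]
  rw [elemTrace, dif_pos hij]
  have h : (elemAct i j * elemAct j i).restrict (elemAct_elemAct_mem W hW hij μ) = 0 := by
    refine LinearMap.ext fun ⟨f, hf⟩ => Subtype.ext (funext fun w => ?_)
    change elemAct i j (elemAct j i f) w = 0
    by_cases hw : letterCount w = μ
    · rw [elemAct_apply]
      refine Finset.sum_eq_zero fun a _ => if_neg fun ha => ?_
      rw [← hw, letterCount, Finset.card_eq_zero, Finset.filter_eq_empty_iff] at hμ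
      exact hμ (Finset.mem_univ a) ha
    · exact elemAct_elemAct_mem_contentSpace hij hf.2 w hw
  rw [h, map_zero]

/-- On a single weight space the commutator is the scalar μ_i - μ_j. -/
theorem elemTrace_sub (hW : ∀ i j : Fin r, ∀ f ∈ W, elemAct i j f ∈ W)
    (i j : Fin r) (μ : Fin r → ℕ) :
    elemTrace W hW i j μ - elemTrace W hW j i μ = ((μ i : ℂ) - μ j) * contentDim W μ := by
  by_cases hij : i = j
  · subst hij; simp
  have hji : j ≠ i := fun h => hij h.symm
  rw [elemTrace, elemTrace, dif_pos hij, dif_pos hji, ← map_sub]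
  have h : (elemAct i j * elemAct j i).restrict (elemAct_elemAct_mem W hW hij μ)
      - (elemAct j i * elemAct i j).restrict (elemAct_elemAct_mem W hW hji μ)
      = ((μ i : ℂ) - μ j) • LinearMap.id := by
    refine LinearMap.ext fun ⟨f, hf⟩ => Subtype.ext (funext fun w => ?_)
    change elemAct i j (elemAct j i f) w - elemAct j i (elemAct i j f) w = ((μ i : ℂ) - μ j) * f w
    rw [elemAct_commutator hij]
    by_cases hw : letterCount w = μ
    · rw [hw]
    · rw [hf.2 w hw, mul_zero, mul_zero]
  rw [h, map_smul, LinearMap.trace_id]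
  rfl

/-- The trace of the Casimir identity on one weight space, once the sum of transpositions is known
to be scalar. -/
theorem sum_elemTrace (hW : ∀ i j : Fin r, ∀ f ∈ W, elemAct i j f ∈ W)
    {z : ℂ} (hz : ∀ f ∈ W, swapSum X r f = z • f) (μ : Fin r → ℕ) :
    ∑ i, ∑ j, elemTrace W hW i j μ
      = (((r : ℂ) - 1) * Fintype.card X + z - ∑ i, (μ i : ℂ) ^ 2) * contentDim W μ := by
  let T : Fin r → Fin r → Module.End ℂ (W ⊓ contentSpace X μ : Submodule ℂ _) := fun i j =>
    if hij : i ≠ j then (elemAct i j * elemAct j i).restrict (elemAct_elemAct_mem W hW hij μ)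
    else 0
  have h1 : ∀ i j, elemTrace W hW i j μ = LinearMap.trace ℂ _ (T i j) := fun i j => by
    by_cases hij : i = j
    · simp [elemTrace, T, hij]
    · simp [elemTrace, T, hij]
  have h2 : ∑ i, ∑ j, T i j
      = (((r : ℂ) - 1) * Fintype.card X + z - ∑ i, (μ i : ℂ) ^ 2) • LinearMap.id := by
    refine LinearMap.ext fun ⟨f, hf⟩ => Subtype.ext (funext fun w => ?_)
    have h3 : ∀ i j, ((T i j ⟨f, hf⟩ : (W ⊓ contentSpace X μ : Submodule ℂ _)) :
        (X → Fin r) → ℂ) w = if i ≠ j then elemAct i j (elemAct j i f) w else 0 := fun i j => by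
      by_cases hij : i = j
      · simp [T, hij]
      · simp [T, hij]
    simp only [LinearMap.sum_apply, AddSubmonoidClass.coe_finsetSum, Finset.sum_apply, h3]
    rw [sum_elemAct_elemAct, hz f hf.1]
    change _ = (((r : ℂ) - 1) * Fintype.card X + z - ∑ i, (μ i : ℂ) ^ 2) * f w
    by_cases hw : letterCount w = μ
    · rw [hw, Pi.smul_apply, smul_eq_mul]
      ring
    · rw [Pi.smul_apply, hf.2 w hw]
      simp
  simp only [h1, ← map_sum]
  rw [h2, map_smul, LinearMap.trace_id]
  rfl

end Words

/-! ### The Young symmetrizer on functions on words -/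

section Young

variable {r : ℕ} (ν : Fin r → ℕ)

/-- The sum of the permutations preserving the rows. -/
def rowSum : Module.End ℂ ((Boxes ν → Fin r) → ℂ) := ∑ p : RowPerm ν, permRep p.1

/-- The signed sum of the permutations preserving the columns. -/
def colSum : Module.End ℂ ((Boxes ν → Fin r) → ℂ) :=
  ∑ q : ColPerm ν, ((Equiv.Perm.sign q.1 : ℤ) : ℂ) • permRep q.1

/-- The Young symmetrizer on functions on words. -/
def youngOp : Module.End ℂ ((Boxes ν → Fin r) → ℂ) := rowSum ν * colSum ν

variable {ν}

theorem rowSum_mul_permRep {s : Equiv.Perm (Boxes ν)} (hs : ∀ c, (s c).1 = c.1) :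
    rowSum ν * permRep s = rowSum ν := by
  rw [rowSum, Finset.sum_mul]
  refine Fintype.sum_equiv ((Equiv.mulRight s).subtypeEquiv fun p => ?_) _ _ fun p => ?_
  · constructor
    · exact fun h c => (h (s c)).trans (hs c)
    · intro h c
      obtain ⟨d, rfl⟩ := s.surjective c
      exact (h d).trans (hs d).symm
  · rw [← map_mul]
    rfl

theorem sign_mul_self {s : Equiv.Perm (Boxes ν)} :
    ((Equiv.Perm.sign s : ℤ) : ℂ) * ((Equiv.Perm.sign s : ℤ) : ℂ) = 1 := by
  rcases Int.units_eq_one_or (Equiv.Perm.sign s) with h | h <;> simp [h]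

theorem permRep_mul_colSum {s : Equiv.Perm (Boxes ν)} (hs : ∀ c, ((s c).2 : ℕ) = (c.2 : ℕ)) :
    permRep s * colSum ν = ((Equiv.Perm.sign s : ℤ) : ℂ) • colSum ν := by
  rw [colSum, Finset.mul_sum, Finset.smul_sum]
  refine Fintype.sum_equiv ((Equiv.mulLeft s).subtypeEquiv fun p => ?_) _ _ fun p => ?_
  · exact forall_congr' fun c => by simp [hs]
  · rw [mul_smul_comm, ← map_mul, smul_smul]
    simp only [Equiv.subtypeEquiv_apply, Equiv.coe_mulLeft, Equiv.Perm.sign_mul, Units.val_mul,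
      Int.cast_mul]
    rw [← mul_assoc, sign_mul_self, one_mul]

theorem colSum_mul_permRep {s : Equiv.Perm (Boxes ν)} (hs : ∀ c, ((s c).2 : ℕ) = (c.2 : ℕ)) :
    colSum ν * permRep s = ((Equiv.Perm.sign s : ℤ) : ℂ) • colSum ν := by
  rw [colSum, Finset.sum_mul, Finset.smul_sum]
  refine Fintype.sum_equiv ((Equiv.mulRight s).subtypeEquiv fun p => ?_) _ _ fun p => ?_
  · constructor
    · exact fun h c => (h (s c)).trans (hs c)
    · intro h c
      obtain ⟨d, rfl⟩ := s.surjective c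
      exact (h d).trans (hs d).symm
  · rw [smul_mul_assoc, ← map_mul, smul_smul]
    simp only [Equiv.subtypeEquiv_apply, Equiv.coe_mulRight, Equiv.Perm.sign_mul, Units.val_mul,
      Int.cast_mul]
    rw [mul_comm (((Equiv.Perm.sign p.1 : ℤ)) : ℂ), ← mul_assoc, sign_mul_self, one_mul]

theorem commute_youngOp {T : Module.End ℂ ((Boxes ν → Fin r) → ℂ)}
    (hT : ∀ p, T * permRep p = permRep p * T) : T * youngOp ν = youngOp ν * T := by
  have h1 : T * rowSum ν = rowSum ν * T := by
    simp only [rowSum, Finset.mul_sum, Finset.sum_mul, hT]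
  have h2 : T * colSum ν = colSum ν * T := by
    simp only [colSum, Finset.mul_sum, Finset.sum_mul, mul_smul_comm, smul_mul_assoc, hT]
  rw [youngOp, ← mul_assoc, h1, mul_assoc, h2, mul_assoc]

theorem elemAct_mem_range_youngOp (i j : Fin r) :
    ∀ f ∈ LinearMap.range (youngOp ν), elemAct i j f ∈ LinearMap.range (youngOp ν) := by
  rintro _ ⟨g, rfl⟩
  exact ⟨elemAct i j g,
    (DFunLike.congr_fun (commute_youngOp (elemAct_mul_permRep i j)) g).symm⟩

/-! ### The sum of transpositions acts by a scalar -/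

theorem swap_fst_eq {a b : Boxes ν} (h : a.1 = b.1) (c : Boxes ν) :
    (Equiv.swap a b c).1 = c.1 := by
  rw [Equiv.swap_apply_def]
  split_ifs with h1 h2
  · rw [h1, h]
  · rw [h2, h]
  · rfl

theorem swap_snd_eq {a b : Boxes ν} (h : (a.2 : ℕ) = b.2) (c : Boxes ν) :
    ((Equiv.swap a b c).2 : ℕ) = c.2 := by
  rcases eq_or_ne c a with rfl | h1
  · rw [Equiv.swap_apply_left, h]
  · rcases eq_or_ne c b with rfl | h2
    · rw [Equiv.swap_apply_right, h]
    · rw [Equiv.swap_apply_of_ne_of_ne h1 h2]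

theorem eq_zero_of_eq_neg {M : Type*} [AddCommGroup M] [Module ℂ M] {x : M} (h : x = -x) :
    x = 0 := by
  have h2 : (2 : ℂ) • x = 0 := by
    rw [two_smul]
    exact eq_neg_iff_add_eq_zero.1 h
  simpa using h2

/-- A Garnir relation. -/
theorem sum_rowSum_swap_colSum (hν : Antitone ν) {i : Fin r} {b : Boxes ν} (hib : i < b.1) :
    ∑ j : Fin (ν i), rowSum ν * permRep (Equiv.swap ⟨i, j⟩ b) * colSum ν = -youngOp ν := by
  -- The box of row i in the column of b; it exists because the higher row is at least as long.
  let d : Fin (ν i) := ⟨b.2, b.2.2.trans_le (hν hib.le)⟩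
  have hne : ∀ j : Fin (ν i), (⟨i, j⟩ : Boxes ν) ≠ b := fun j h => by
    rw [← h] at hib
    exact lt_irrefl _ hib
  let Y := rowSum ν + ∑ j : Fin (ν i), rowSum ν * permRep (Equiv.swap ⟨i, j⟩ b)
  -- Right multiplication by this swap exchanges the identity term with the term of d. It fixes
  -- every other term, since conjugation produces a swap inside row i, which the row sum absorbs.
  -- The column sum changes sign under the same swap, whence Y C = -Y C.
  have hY : Y * permRep (Equiv.swap ⟨i, d⟩ b) = Y := by
    have h1 : ∀ j, j ≠ d → rowSum ν * permRep (Equiv.swap (⟨i, j⟩ : Boxes ν) b)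
        * permRep (Equiv.swap ⟨i, d⟩ b) = rowSum ν * permRep (Equiv.swap (⟨i, j⟩ : Boxes ν) b) := by
      intro j hj
      have hjd : (⟨i, j⟩ : Boxes ν) ≠ ⟨i, d⟩ := fun h => hj (by simpa using h)
      have h2 : Equiv.swap (⟨i, j⟩ : Boxes ν) b * Equiv.swap ⟨i, d⟩ b
          = Equiv.swap ⟨i, j⟩ ⟨i, d⟩ * Equiv.swap ⟨i, j⟩ b := by
        rw [Equiv.mul_swap_eq_swap_mul, Equiv.swap_apply_right,
          Equiv.swap_apply_of_ne_of_ne hjd.symm (hne d), Equiv.swap_comm (⟨i, d⟩ : Boxes ν)]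
      rw [mul_assoc, ← map_mul, h2, map_mul, ← mul_assoc,
        rowSum_mul_permRep (swap_fst_eq (a := ⟨i, j⟩) (b := ⟨i, d⟩) rfl)]
    simp only [Y, add_mul, Finset.sum_mul]
    rw [← Finset.add_sum_erase _ _ (Finset.mem_univ d),
      Finset.sum_congr rfl fun j hj => h1 j (Finset.ne_of_mem_erase hj), mul_assoc, ← map_mul,
      Equiv.swap_mul_self, map_one, mul_one,
      ← Finset.add_sum_erase _ (fun j => rowSum ν * permRep (Equiv.swap ⟨i, j⟩ b))
        (Finset.mem_univ d)]
    abel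
  have h3 : Y * colSum ν = 0 := by
    have h4 : Y * colSum ν = -(Y * colSum ν) := by
      conv_lhs => rw [← hY, mul_assoc, permRep_mul_colSum
        (swap_snd_eq (a := ⟨i, d⟩) (b := b) rfl),
        Equiv.Perm.sign_swap (hne d)]
      simp
    exact eq_zero_of_eq_neg h4
  simp only [Y, add_mul, Finset.sum_mul] at h3
  rw [eq_neg_iff_add_eq_zero, add_comm]
  exact h3

/-- The sum of transpositions is central, so it can be placed between the row sum and the column sum
and split by pairs of rows. A swap within a row is absorbed, and swaps between two rows are summed
by the Garnir relation. Only the existence of the scalar is needed later. -/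
theorem exists_swapSum_mul_youngOp (hν : Antitone ν) :
    ∃ z : ℂ, swapSum (Boxes ν) r * youngOp ν = z • youngOp ν := by
  have h1 : ∀ i i' : Fin r, ∃ z : ℂ, ∑ j : Fin (ν i), ∑ j' : Fin (ν i'),
      rowSum ν * permRep (Equiv.swap ⟨i, j⟩ ⟨i', j'⟩) * colSum ν = z • youngOp ν := by
    intro i i'
    rcases lt_trichotomy i i' with h | h | h
    · refine ⟨-(ν i' : ℂ), ?_⟩
      rw [Finset.sum_comm]
      simp only [sum_rowSum_swap_colSum hν (show i < (⟨i', _⟩ : Boxes ν).1 from h)]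
      simp only [Finset.sum_const, Finset.card_univ, Fintype.card_fin, ← Nat.cast_smul_eq_nsmul ℂ]
      rw [smul_neg]
      refine LinearMap.ext fun f => funext fun w => ?_
      simp only [LinearMap.neg_apply, LinearMap.smul_apply, Pi.neg_apply, Pi.smul_apply, smul_eq_mul,
        neg_mul]
    · subst h
      refine ⟨(ν i : ℂ) * ν i, ?_⟩
      have h2 : ∀ j j' : Fin (ν i), rowSum ν * permRep (Equiv.swap ⟨i, j⟩ ⟨i, j'⟩) = rowSum ν :=
        fun j j' => rowSum_mul_permRep (swap_fst_eq rfl)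
      simp only [h2]
      simp [← Nat.cast_smul_eq_nsmul ℂ, smul_smul, youngOp]
    · refine ⟨-(ν i : ℂ), ?_⟩
      simp only [Equiv.swap_comm (⟨i, _⟩ : Boxes ν) ⟨i', _⟩,
        sum_rowSum_swap_colSum hν (show i' < (⟨i, _⟩ : Boxes ν).1 from h)]
      simp only [Finset.sum_const, Finset.card_univ, Fintype.card_fin, ← Nat.cast_smul_eq_nsmul ℂ]
      rw [smul_neg]
      refine LinearMap.ext fun f => funext fun w => ?_
      simp only [LinearMap.neg_apply, LinearMap.smul_apply, Pi.neg_apply, Pi.smul_apply, smul_eq_mul,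
        neg_mul]
  choose z hz using h1
  refine ⟨∑ i, ∑ i', z i i', ?_⟩
  have h2 : swapSum (Boxes ν) r * rowSum ν = rowSum ν * swapSum (Boxes ν) r := by
    simp only [rowSum, Finset.mul_sum, Finset.sum_mul, swapSum_mul_permRep]
  rw [youngOp, ← mul_assoc, h2, swapSum]
  simp only [Finset.mul_sum, Finset.sum_mul, Finset.sum_smul]
  rw [Fintype.sum_sigma]
  refine Finset.sum_congr rfl fun i _ => ?_
  have h3 : ∀ j : Fin (ν i), (∑ b : Boxes ν, rowSum ν * permRep (Equiv.swap ⟨i, j⟩ b) * colSum ν)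
      = ∑ i', ∑ j' : Fin (ν i'),
        rowSum ν * permRep (Equiv.swap ⟨i, j⟩ ⟨i', j'⟩) * colSum ν := fun j =>
    Fintype.sum_sigma _
  simp only [h3]
  rw [Finset.sum_comm]
  exact Finset.sum_congr rfl fun i' _ => hz i i'

theorem exists_swapSum_eq_smul (hν : Antitone ν) :
    ∃ z : ℂ, ∀ f ∈ LinearMap.range (youngOp ν), swapSum (Boxes ν) r f = z • f := by
  obtain ⟨z, hz⟩ := exists_swapSum_mul_youngOp hν
  refine ⟨z, ?_⟩
  rintro _ ⟨g, rfl⟩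
  exact DFunLike.congr_fun hz g

/-! ### Weights of the image of the Young symmetrizer -/

theorem permRep_single (p : Equiv.Perm (Boxes ν)) (w : Boxes ν → Fin r) (c : ℂ) :
    permRep p (Pi.single w c) = Pi.single (w ∘ p.symm) c := by
  funext v
  rw [permRep_apply, Pi.single_apply, Pi.single_apply]
  congr 1
  rw [eq_iff_iff]
  constructor
  · rintro rfl
    funext a
    simp
  · rintro rfl
    funext a
    simp

/-- Swapping the two equal letters fixes the word but negates the column sum. -/
theorem youngOp_single_eq_zero {w : Boxes ν → Fin r} {a b : Boxes ν} (hab : a ≠ b)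
    (hcol : (a.2 : ℕ) = b.2) (hw : w a = w b) : youngOp ν (Pi.single w 1) = 0 := by
  have h1 : permRep (Equiv.swap a b) (Pi.single w (1 : ℂ)) = Pi.single w 1 := by
    rw [permRep_single]
    congr 1
    funext c
    simp only [Equiv.symm_swap, Function.comp_apply, Equiv.swap_apply_def]
    split_ifs with h h'
    · rw [h, hw]
    · rw [h', hw]
    · rfl
  have h2 := DFunLike.congr_fun (colSum_mul_permRep (swap_snd_eq hcol)) (Pi.single w (1 : ℂ))
  rw [Module.End.mul_apply, h1, Equiv.Perm.sign_swap hab] at h2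
  have h3 : colSum ν (Pi.single w 1) = 0 := eq_zero_of_eq_neg (by simpa using h2)
  rw [youngOp, Module.End.mul_apply, h3, map_zero]

theorem permRep_mem_contentSpace (p : Equiv.Perm (Boxes ν)) {μ : Fin r → ℕ}
    {f : (Boxes ν → Fin r) → ℂ} (hf : f ∈ contentSpace (Boxes ν) μ) :
    permRep p f ∈ contentSpace (Boxes ν) μ := fun w hw =>
  hf _ (by rwa [letterCount_comp_perm])

theorem youngOp_single_mem_contentSpace (w : Boxes ν → Fin r) :
    youngOp ν (Pi.single w 1) ∈ contentSpace (Boxes ν) (letterCount w) := by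
  rw [youngOp, Module.End.mul_apply, rowSum, LinearMap.sum_apply]
  refine Submodule.sum_mem _ fun p _ => permRep_mem_contentSpace _ ?_
  rw [colSum, LinearMap.sum_apply]
  refine Submodule.sum_mem _ fun q _ => Submodule.smul_mem _ _ (permRep_mem_contentSpace _ ?_)
  exact fun v hv => Pi.single_eq_of_ne (fun h => hv (by rw [h])) _

/-- The symmetrizer preserves content, so the terms of any other content contribute nothing to the
values on words of content μ. -/
theorem mem_inf_contentSpace_eq_sum {μ : Fin r → ℕ} {f : (Boxes ν → Fin r) → ℂ}
    (hf : f ∈ LinearMap.range (youngOp ν) ⊓ contentSpace (Boxes ν) μ) :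
    ∃ g : (Boxes ν → Fin r) → ℂ,
      f = ∑ w, if letterCount w = μ then g w • youngOp ν (Pi.single w 1) else 0 := by
  obtain ⟨⟨g, rfl⟩, hμ⟩ := hf
  refine ⟨g, ?_⟩
  have h1 : youngOp ν g = ∑ w, g w • youngOp ν (Pi.single w 1) := by
    conv_lhs => rw [pi_eq_sum_univ' g, map_sum]
    refine Finset.sum_congr rfl fun w _ => ?_
    rw [map_smul]
  funext v
  by_cases hv : letterCount v = μ
  · rw [h1]
    simp only [Finset.sum_apply]
    refine Finset.sum_congr rfl fun w _ => ?_
    split_ifs with hw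
    · rfl
    · rw [Pi.smul_apply, youngOp_single_mem_contentSpace w v (by rw [hv]; exact fun h => hw h.symm)]
      simp
  · rw [hμ v hv]
    simp only [Finset.sum_apply]
    refine (Finset.sum_eq_zero fun w _ => ?_).symm
    split_ifs with hw
    · rw [Pi.smul_apply, youngOp_single_mem_contentSpace w v (by rw [hw]; exact hv)]
      simp
    · rfl

/-- The number of boxes in column `j` whose letter is less than `k`. -/
def columnCount (w : Boxes ν → Fin r) (j k : ℕ) : ℕ :=
  (Finset.univ.filter fun a : Boxes ν => (a.2 : ℕ) = j ∧ (w a : ℕ) < k).card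

/-- The word whose letter in each box is the row of the box. -/
def rowWord (ν : Fin r → ℕ) : Boxes ν → Fin r := fun a => a.1

theorem sum_columnCount (w : Boxes ν → Fin r) (k M : ℕ) (hM : ∀ a : Boxes ν, (a.2 : ℕ) < M) :
    ∑ j ∈ Finset.range M, columnCount w j k
      = ∑ i : Fin r, if (i : ℕ) < k then letterCount w i else 0 := by
  have h1 : ∑ j ∈ Finset.range M, columnCount w j k
      = (Finset.univ.filter fun a : Boxes ν => (w a : ℕ) < k).card := by
    rw [Finset.card_eq_sum_card_fiberwise (f := fun a : Boxes ν => (a.2 : ℕ))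
      (t := Finset.range M) fun a _ => Finset.mem_coe.2 (Finset.mem_range.2 (hM a))]
    refine Finset.sum_congr rfl fun j _ => ?_
    rw [columnCount, Finset.filter_filter]
    congr 1
    ext a
    simp [and_comm]
  have h2 : (Finset.univ.filter fun a : Boxes ν => (w a : ℕ) < k).card
      = ∑ i ∈ Finset.univ.filter (fun i : Fin r => (i : ℕ) < k), letterCount w i := by
    rw [Finset.card_eq_sum_card_fiberwise (f := w)
      (t := Finset.univ.filter (fun i : Fin r => (i : ℕ) < k)) fun a ha => by simpa using ha]
    refine Finset.sum_congr rfl fun i hi => ?_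
    rw [letterCount, Finset.filter_filter]
    congr 1
    ext a
    simp only [Finset.mem_filter, Finset.mem_univ, true_and] at hi ⊢
    exact ⟨fun h => h.2, fun h => ⟨h ▸ hi, h⟩⟩
  rw [h1, h2, Finset.sum_filter]

theorem letterCount_rowWord : letterCount (rowWord ν) = ν := by
  funext i
  rw [letterCount_eq_sum, Fintype.sum_sigma]
  have : ∀ x, (∑ y : Fin (ν x), if rowWord ν ⟨x, y⟩ = i then 1 else 0)
      = if x = i then ν x else 0 := fun x => by
    by_cases h : x = i
    · rw [if_pos h, Finset.sum_congr rfl fun y _ => if_pos (show rowWord ν ⟨x, y⟩ = i from h)]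
      simp
    · rw [if_neg h]
      exact Finset.sum_eq_zero fun y _ => if_neg h
  simp [this]

/-- Distinct letters less than k number at most k, and at most the length of the column. The row
word attains the smaller of the two bounds because columns are filled from the top. -/
theorem columnCount_le (hν : Antitone ν) {w : Boxes ν → Fin r}
    (hw : ∀ a b : Boxes ν, (a.2 : ℕ) = b.2 → w a = w b → a = b) (j k : ℕ) :
    columnCount w j k ≤ columnCount (rowWord ν) j k := by
  by_cases h : ∃ b : Boxes ν, (b.2 : ℕ) = j ∧ k ≤ (b.1 : ℕ)
  · obtain ⟨b, hb, hkb⟩ := h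
    have h1 : columnCount w j k ≤ k := by
      have : columnCount w j k ≤ (Finset.range k).card :=
        Finset.card_le_card_of_injOn (fun a => (w a : ℕ)) (fun a ha => by
          simp only [Finset.coe_filter, Finset.mem_univ, true_and, Set.mem_ofPred_eq] at ha
          simpa using ha.2) (fun a ha a' ha' haa' => by
          simp only [Finset.coe_filter, Finset.mem_univ, true_and, Set.mem_ofPred_eq] at ha ha'
          exact hw a a' (ha.1.trans ha'.1.symm) (Fin.ext haa'))
      simpa using this
    have h2 : k ≤ columnCount (rowWord ν) j k := by
      have : (Finset.univ : Finset (Fin k)).card ≤ columnCount (rowWord ν) j k :=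
        Finset.card_le_card_of_injOn (fun i => ⟨⟨i, i.2.trans_le (hkb.trans b.1.2.le)⟩,
          ⟨j, by
            have h3 : j < ν b.1 := hb ▸ b.2.2
            exact h3.trans_le (hν (Fin.le_def.2 (i.2.le.trans hkb)))⟩⟩)
          (fun i _ => Finset.mem_coe.2 (Finset.mem_filter.2 ⟨Finset.mem_univ _, rfl, i.2⟩)) (fun i _ i' _ hii' => by
            have h4 := congrArg (fun a : Boxes ν => (a.1 : ℕ)) hii'
            exact Fin.ext h4)
      simpa using this
    exact h1.trans h2
  · push Not at h
    refine Finset.card_le_card fun a ha => ?_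
    simp only [Finset.mem_filter, Finset.mem_univ, true_and] at ha ⊢
    exact ⟨ha.1, h a ha.1⟩

theorem exists_column_bound (ν : Fin r → ℕ) : ∃ M : ℕ, ∀ a : Boxes ν, (a.2 : ℕ) < M :=
  ⟨∑ i, ν i, fun a => a.2.2.trans_le
    (Finset.single_le_sum (f := ν) (fun _ _ => Nat.zero_le _) (Finset.mem_univ a.1))⟩

theorem partialSum_content_le (hν : Antitone ν) {w : Boxes ν → Fin r}
    (hw : ∀ a b : Boxes ν, (a.2 : ℕ) = b.2 → w a = w b → a = b) (k : ℕ) :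
    (∑ i : Fin r, if (i : ℕ) < k then letterCount w i else 0)
      ≤ ∑ i : Fin r, if (i : ℕ) < k then ν i else 0 := by
  obtain ⟨M, hM⟩ := exists_column_bound ν
  conv_rhs => rw [← letterCount_rowWord (ν := ν)]
  rw [← sum_columnCount w k M hM, ← sum_columnCount (rowWord ν) k M hM]
  exact Finset.sum_le_sum fun j _ => columnCount_le hν hw j k

theorem injective_columns_of_youngOp_ne_zero {w : Boxes ν → Fin r}
    (h : youngOp ν (Pi.single w 1) ≠ 0) (a b : Boxes ν) (hab : (a.2 : ℕ) = b.2)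
    (hw : w a = w b) : a = b := by
  by_contra hne
  exact h (youngOp_single_eq_zero hne hab hw)

/-- A nonzero weight vector involves a word of content μ with distinct letters in each column; the
column-wise bounds on such a word add up to dominance by ν. -/
theorem dominance_of_contentDim_ne_zero (hν : Antitone ν) {μ : Fin r → ℕ}
    (h : contentDim (LinearMap.range (youngOp ν)) μ ≠ 0) (k : ℕ) :
    (∑ i : Fin r, if (i : ℕ) < k then μ i else 0)
      ≤ ∑ i : Fin r, if (i : ℕ) < k then ν i else 0 := by
  have hne : (LinearMap.range (youngOp ν) ⊓ contentSpace (Boxes ν) μ) ≠ ⊥ := fun h0 =>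
    h (by rw [contentDim, h0, finrank_bot])
  obtain ⟨f, hf, hf0⟩ := Submodule.exists_mem_ne_zero_of_ne_bot hne
  obtain ⟨g, hg⟩ := mem_inf_contentSpace_eq_sum hf
  rw [hg] at hf0
  obtain ⟨w, -, hw⟩ := Finset.exists_ne_zero_of_sum_ne_zero hf0
  split_ifs at hw with hμ
  · rw [← hμ]
    exact partialSum_content_le hν
      (injective_columns_of_youngOp_ne_zero (right_ne_zero_of_smul hw)) k
  · exact absurd rfl hw

theorem sum_eq_of_contentDim_ne_zero {μ : Fin r → ℕ}
    (h : contentDim (LinearMap.range (youngOp ν)) μ ≠ 0) : ∑ i, μ i = ∑ i, ν i := by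
  have hne : (LinearMap.range (youngOp ν) ⊓ contentSpace (Boxes ν) μ) ≠ ⊥ := fun h0 =>
    h (by rw [contentDim, h0, finrank_bot])
  obtain ⟨f, hf, hf0⟩ := Submodule.exists_mem_ne_zero_of_ne_bot hne
  obtain ⟨w, hw⟩ := Function.ne_iff.1 hf0
  have hμ : letterCount w = μ := by
    by_contra hμ
    exact hw (hf.2 w hμ)
  rw [← hμ, sum_letterCount]
  simp

/-- With content ν the column inequalities sum to an equality, so each one is an equality. Then
every letter of a column is the index of a row meeting that column, and sending each box to the row
named by its letter is the required permutation. -/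
theorem exists_colPerm_of_letterCount_eq (hν : Antitone ν) {w : Boxes ν → Fin r}
    (hw : ∀ a b : Boxes ν, (a.2 : ℕ) = b.2 → w a = w b → a = b) (hcount : letterCount w = ν) :
    ∃ q : Equiv.Perm (Boxes ν), (∀ c, ((q c).2 : ℕ) = c.2) ∧ rowWord ν ∘ q = w := by
  obtain ⟨M, hM⟩ := exists_column_bound ν
  have heq : ∀ k, ∀ j, j < M → columnCount w j k = columnCount (rowWord ν) j k := by
    intro k j hj
    have h1 : ∑ j ∈ Finset.range M, columnCount w j k
        = ∑ j ∈ Finset.range M, columnCount (rowWord ν) j k := by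
      rw [sum_columnCount w k M hM, sum_columnCount (rowWord ν) k M hM, hcount,
        letterCount_rowWord]
    exact (Finset.sum_eq_sum_iff_of_le fun j _ => columnCount_le hν hw j k).1 h1 j
      (Finset.mem_range.2 hj)
  have hlt : ∀ a : Boxes ν, (a.2 : ℕ) < ν (w a) := by
    intro a
    by_contra hna
    -- The box a makes the count for w jump at its own letter; if row w a missed this column, the
    -- count for the row word could not jump there.
    have h1 : columnCount w a.2 (w a) < columnCount w a.2 ((w a : ℕ) + 1) := by
      refine Finset.card_lt_card ⟨fun b hb => ?_, fun hsub => ?_⟩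
      · simp only [Finset.mem_filter, Finset.mem_univ, true_and] at hb ⊢
        exact ⟨hb.1, hb.2.trans (Nat.lt_succ_self _)⟩
      · have := hsub (Finset.mem_filter.2 ⟨Finset.mem_univ a, rfl, Nat.lt_succ_self _⟩)
        simp at this
    have h2 : columnCount (rowWord ν) a.2 ((w a : ℕ) + 1) ≤ columnCount (rowWord ν) a.2 (w a) := by
      refine Finset.card_le_card fun b hb => ?_
      obtain ⟨-, hb1, hb2⟩ := Finset.mem_filter.1 hb
      refine Finset.mem_filter.2 ⟨Finset.mem_univ _, hb1,
        lt_of_le_of_ne (Nat.lt_succ_iff.1 hb2) fun h => hna ?_⟩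
      have h3 : b.1 = w a := Fin.ext h
      rw [← hb1, ← h3]
      exact b.2.2
    rw [heq _ _ (hM a), heq _ _ (hM a)] at h1
    omega
  let q : Boxes ν → Boxes ν := fun a => ⟨w a, ⟨a.2, hlt a⟩⟩
  have hq : Function.Injective q := fun a b hab => by
    have h1 : w a = w b := congrArg Sigma.fst hab
    have h2 : ((q a).2 : ℕ) = (q b).2 := by rw [hab]
    exact hw a b h2 h1
  exact ⟨Equiv.ofBijective q (Finite.injective_iff_bijective.1 hq), fun _ => rfl, rfl⟩

/-- At the row word itself only the trivial column permutation contributes, with sign +1, and every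
row permutation contributes 1, so the value is the number of row permutations. -/
theorem youngOp_rowWord_ne_zero : youngOp ν (Pi.single (rowWord ν) 1) ≠ 0 := by
  intro h
  have h1 := congrFun h (rowWord ν)
  simp only [youngOp, rowSum, colSum, Module.End.mul_apply, LinearMap.sum_apply,
    LinearMap.smul_apply, map_sum, map_smul, Finset.sum_apply, Pi.smul_apply,
    permRep_apply, Pi.zero_apply] at h1
  have h2 : ∀ p : RowPerm ν, rowWord ν ∘ p.1 = rowWord ν := fun p => funext fun c => p.2 c
  have h3 : ∀ q : ColPerm ν, rowWord ν ∘ q.1 = rowWord ν → q = ⟨1, fun _ => rfl⟩ := by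
    intro q hq
    apply Subtype.ext
    ext1 c
    have h4 : (q.1 c).1 = c.1 := congrFun hq c
    have h5 := q.2 c
    rcases hc : q.1 c with ⟨i, j⟩
    rcases c with ⟨i', j'⟩
    rw [hc] at h4 h5
    simp only at h4 h5
    subst h4
    simp only [Equiv.Perm.coe_one, id_eq]
    congr 1
    exact Fin.ext h5
  simp only [h2] at h1
  rw [Finset.sum_eq_single (⟨1, fun _ => rfl⟩ : ColPerm ν)] at h1
  · have : Nonempty (RowPerm ν) := ⟨⟨1, fun _ => rfl⟩⟩
    simp at h1
  · intro q _ hq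
    simp [Pi.single_eq_of_ne (fun hq' => hq (h3 q hq') : rowWord ν ∘ q.1 ≠ rowWord ν)]
  · simp

/-- Every word of content ν with nonzero image is a column permutation of the row word, and the
symmetrizer turns that permutation into a sign. -/
theorem contentDim_self (hν : Antitone ν) : contentDim (LinearMap.range (youngOp ν)) ν = 1 := by
  have h : LinearMap.range (youngOp ν) ⊓ contentSpace (Boxes ν) ν
      = Submodule.span ℂ {youngOp ν (Pi.single (rowWord ν) 1)} := by
    apply le_antisymm
    · intro f hf
      obtain ⟨g, rfl⟩ := mem_inf_contentSpace_eq_sum hf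
      refine Submodule.sum_mem _ fun w _ => ?_
      split_ifs with hw
      · refine Submodule.smul_mem _ _ ?_
        by_cases h0 : youngOp ν (Pi.single w 1) = 0
        · rw [h0]
          exact Submodule.zero_mem _
        · obtain ⟨q, hq, rfl⟩ := exists_colPerm_of_letterCount_eq hν
            (injective_columns_of_youngOp_ne_zero h0) hw
          have h1 : Pi.single (rowWord ν ∘ q) (1 : ℂ)
              = permRep q.symm (Pi.single (rowWord ν) 1) := by
            rw [permRep_single, Equiv.symm_symm]
          have h2 : ∀ c, ((q.symm c).2 : ℕ) = c.2 := fun c => by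
            rw [← hq, Equiv.apply_symm_apply]
          rw [h1, youngOp, ← Module.End.mul_apply, mul_assoc, colSum_mul_permRep h2,
            mul_smul_comm, LinearMap.smul_apply]
          exact Submodule.smul_mem _ _ (Submodule.mem_span_singleton_self _)
      · exact Submodule.zero_mem _
    · rw [Submodule.span_singleton_le_iff_mem]
      refine ⟨⟨_, rfl⟩, ?_⟩
      have := youngOp_single_mem_contentSpace (rowWord ν)
      rwa [letterCount_rowWord] at this
  rw [contentDim, h, finrank_span_singleton youngOp_rowWord_ne_zero]

end Young

/-! ### Weight spaces of the Schur functor as functions on words -/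

section Transport

variable {r : ℕ} {ν : Fin r → ℕ}

/-- Coordinates on the tensor power of `ℂ^r`. -/
def wordCoords (ν : Fin r → ℕ) :
    (⨂[ℂ] _ : Boxes ν, (Fin r → ℂ)) ≃ₗ[ℂ] ((Boxes ν → Fin r) → ℂ) :=
  (Basis.piTensorProduct (fun _ : Boxes ν => Pi.basisFun ℂ (Fin r))).equivFun

theorem wordCoords_tprod (v : Boxes ν → Fin r → ℂ) (w : Boxes ν → Fin r) :
    wordCoords ν (PiTensorProduct.tprod ℂ v) w = ∏ a, v a (w a) := by
  rw [wordCoords, Module.Basis.equivFun_apply, Basis.piTensorProduct_repr_tprod_apply]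
  simp

theorem wordCoords_reindex (p : Equiv.Perm (Boxes ν)) (x : ⨂[ℂ] _ : Boxes ν, (Fin r → ℂ)) :
    wordCoords ν (PiTensorProduct.reindex ℂ (fun _ : Boxes ν => (Fin r → ℂ)) p x)
      = permRep p (wordCoords ν x) := by
  induction x using PiTensorProduct.induction_on with
  | smul_tprod a v =>
    rw [map_smul, map_smul, map_smul, map_smul]
    congr 1
    funext w
    rw [PiTensorProduct.reindex_tprod, permRep_apply, wordCoords_tprod, wordCoords_tprod]
    rw [← Equiv.prod_comp p]
    simp
  | add x y hx hy => simp only [map_add, hx, hy]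

theorem wordCoords_youngSymmetrizer (x : ⨂[ℂ] _ : Boxes ν, (Fin r → ℂ)) :
    wordCoords ν (youngSymmetrizer ν (Fin r → ℂ) x) = youngOp ν (wordCoords ν x) := by
  simp only [youngSymmetrizer, youngOp, rowSum, colSum, LinearMap.sum_apply, LinearMap.smul_apply,
    LinearMap.comp_apply, LinearEquiv.coe_coe, map_sum, map_smul, Module.End.mul_apply,
    wordCoords_reindex]
  rw [Finset.sum_comm]
  simp only [Finset.smul_sum]

theorem prod_letters_eq (t : Fin r → ℂ) (w : Boxes ν → Fin r) :
    ∏ a, t (w a) = ∏ i, t i ^ letterCount w i := by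
  rw [← Finset.prod_fiberwise_of_maps_to (s := Finset.univ) (t := Finset.univ) (g := w)
    (fun a _ => Finset.mem_univ (w a))]
  refine Finset.prod_congr rfl fun i _ => ?_
  rw [letterCount, Finset.prod_congr rfl fun a ha => by rw [(Finset.mem_filter.1 ha).2],
    Finset.prod_const]

theorem wordCoords_torusAction (t : Fin r → ℂˣ) (x : ⨂[ℂ] _ : Boxes ν, (Fin r → ℂ))
    (w : Boxes ν → Fin r) : wordCoords ν (torusAction ν t x) w
      = (∏ i, (t i : ℂ) ^ letterCount w i) * wordCoords ν x w := by
  induction x using PiTensorProduct.induction_on with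
  | smul_tprod a v =>
    rw [map_smul, map_smul, map_smul, Pi.smul_apply, Pi.smul_apply, mul_smul_comm]
    congr 1
    rw [torusAction, PiTensorProduct.map_tprod, wordCoords_tprod, wordCoords_tprod,
      ← prod_letters_eq (fun i => (t i : ℂ)), ← Finset.prod_mul_distrib]
    simp [Matrix.mulVec_diagonal]
  | add x y hx hy => simp only [map_add, Pi.add_apply, hx, hy, mul_add]

theorem map_schurWeightSpace (μ : Fin r → ℕ) :
    (schurWeightSpace ν μ).map (wordCoords ν).toLinearMap
      = LinearMap.range (youngOp ν) ⊓ contentSpace (Boxes ν) μ := by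
  have hrange : ∀ x, x ∈ schurFunctor ν (Fin r → ℂ) ↔
      wordCoords ν x ∈ LinearMap.range (youngOp ν) := fun x => by
    constructor
    · rintro ⟨y, rfl⟩
      exact ⟨wordCoords ν y, (wordCoords_youngSymmetrizer y).symm⟩
    · rintro ⟨f, hf⟩
      refine ⟨(wordCoords ν).symm f, (wordCoords ν).injective ?_⟩
      rw [wordCoords_youngSymmetrizer, LinearEquiv.apply_symm_apply, hf]
  have htorus : ∀ x, (∀ t : Fin r → ℂˣ,
      x ∈ Module.End.eigenspace (torusAction ν t) (∏ i, (t i : ℂ) ^ μ i)) ↔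
      wordCoords ν x ∈ contentSpace (Boxes ν) μ := fun x => by
    simp only [Module.End.mem_eigenspace_iff]
    constructor
    · intro h w hw
      obtain ⟨i, hi⟩ := Function.ne_iff.1 hw
      -- The torus element with 2 in position i and 1 elsewhere already separates weights, since n ↦
      -- 2^n is injective.
      have h1 := congrFun (congrArg (wordCoords ν)
        (h (Function.update 1 i (Units.mk0 2 two_ne_zero)))) w
      rw [wordCoords_torusAction, map_smul, Pi.smul_apply, smul_eq_mul] at h1
      have h2 : ∀ κ : Fin r → ℕ, ∏ j, (((Function.update 1 i (Units.mk0 2 two_ne_zero) :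
          Fin r → ℂˣ) j : ℂˣ) : ℂ) ^ κ j = 2 ^ κ i := fun κ => by
        rw [Finset.prod_eq_single i (fun j _ hj => by simp [Function.update_of_ne hj])
          (fun h => absurd (Finset.mem_univ i) h)]
        simp
      rw [h2, h2] at h1
      by_contra h0
      have h3 := mul_right_cancel₀ h0 h1
      have h4 : (2 : ℕ) ^ letterCount w i = 2 ^ μ i := by exact_mod_cast h3
      exact hi (Nat.pow_right_injective le_rfl h4)
    · intro h t
      refine (wordCoords ν).injective (funext fun w => ?_)
      rw [wordCoords_torusAction, map_smul, Pi.smul_apply, smul_eq_mul]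
      by_cases hw : letterCount w = μ
      · rw [hw]
      · rw [h w hw, mul_zero, mul_zero]
  ext f
  rw [Submodule.mem_map]
  constructor
  · rintro ⟨x, hx, rfl⟩
    rw [schurWeightSpace, Submodule.mem_inf, Submodule.mem_iInf] at hx
    exact ⟨(hrange x).1 hx.1, (htorus x).1 hx.2⟩
  · intro hf
    refine ⟨(wordCoords ν).symm f, ?_, (wordCoords ν).apply_symm_apply f⟩
    rw [schurWeightSpace, Submodule.mem_inf, Submodule.mem_iInf, hrange, htorus,
      LinearEquiv.apply_symm_apply]
    exact hf

theorem weightMult_eq_contentDim (μ : Fin r → ℕ) :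
    weightMult ν μ = contentDim (LinearMap.range (youngOp ν)) μ := by
  rw [weightMult, contentDim, ← map_schurWeightSpace]
  exact (LinearEquiv.finrank_map_eq (wordCoords ν) _).symm

end Transport

/-! ### The Vandermonde product and the Euler operators -/

theorem det_rev_pow {R : Type*} [CommRing R] {r : ℕ} (v : Fin r → R) :
    (Matrix.of fun i j : Fin r => v i ^ (j.rev : ℕ)).det
      = ∏ i, ∏ j, if i < j then v i - v j else 1 := by
  have h : (Matrix.of fun i j : Fin r => v i ^ (j.rev : ℕ)) = Matrix.projVandermonde 1 v := by
    ext i j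
    simp [Matrix.projVandermonde_apply]
  rw [h, Matrix.det_projVandermonde]
  refine Finset.prod_congr rfl fun i _ => ?_
  rw [← Finset.prod_filter]
  refine Finset.prod_congr ?_ fun j _ => by simp
  ext j
  simp

/-- The operator `x_k ∂/∂x_k`. -/
def eulerOp {r : ℕ} (k : Fin r) :
    Derivation ℂ (MvPolynomial (Fin r) ℂ) (MvPolynomial (Fin r) ℂ) :=
  (MvPolynomial.X k : MvPolynomial (Fin r) ℂ) • MvPolynomial.pderiv k

theorem eulerOp_X {r : ℕ} (k i : Fin r) :
    eulerOp k (MvPolynomial.X i) = if i = k then MvPolynomial.X k else 0 := by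
  rw [eulerOp, Derivation.smul_apply, MvPolynomial.pderiv_X, smul_eq_mul, Pi.single_apply]
  split_ifs <;> simp_all

theorem coeff_eulerOp {r : ℕ} (k : Fin r) (p : MvPolynomial (Fin r) ℂ) (α : Fin r →₀ ℕ) :
    MvPolynomial.coeff α (eulerOp k p) = (α k : ℂ) * MvPolynomial.coeff α p := by
  induction p using MvPolynomial.induction_on' with
  | monomial β c =>
    have h : eulerOp k (MvPolynomial.monomial β c) = MvPolynomial.monomial β (c * β k) := by
      rw [eulerOp, Derivation.smul_apply, MvPolynomial.pderiv_monomial, smul_eq_mul,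
        MvPolynomial.X, MvPolynomial.monomial_mul, one_mul]
      by_cases hk : β k = 0
      · simp [hk]
      · congr 1
        rw [add_tsub_cancel_of_le]
        rw [Finsupp.single_le_iff]
        omega
    rw [h, MvPolynomial.coeff_monomial, MvPolynomial.coeff_monomial]
    split_ifs with h'
    · rw [h', mul_comm]
    · rw [mul_zero]
  | add p q hp hq => rw [map_add, MvPolynomial.coeff_add, MvPolynomial.coeff_add, hp, hq, mul_add]

theorem derivation_prod {A ι : Type*} [CommRing A] [Algebra ℂ A] [DecidableEq ι]
    (d : Derivation ℂ A A) (s : Finset ι) (f : ι → A) :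
    d (∏ p ∈ s, f p) = ∑ p ∈ s, (∏ q ∈ s.erase p, f q) * d (f p) := by
  induction s using Finset.induction_on with
  | empty => simp
  | insert a s ha ih =>
    rw [Finset.prod_insert ha, Derivation.leibniz, ih, Finset.sum_insert ha,
      Finset.erase_insert ha, smul_eq_mul, smul_eq_mul, add_comm, Finset.mul_sum]
    congr 1
    refine Finset.sum_congr rfl fun p hp => ?_
    have hpa : a ≠ p := fun h => ha (h ▸ hp)
    rw [Finset.erase_insert_of_ne hpa, Finset.prod_insert (fun h => ha (Finset.mem_of_mem_erase h)),
      mul_assoc]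

/-- The quotients `V / (x_i - x_j)` of the Vandermonde product and the logarithmic derivative of
`V`. -/
theorem exists_vand_quotients (r : ℕ) : ∃ W : Fin r → Fin r → MvPolynomial (Fin r) ℂ,
    (∀ i j, W j i = -W i j) ∧
    (∀ i j, i ≠ j → (MvPolynomial.X i - MvPolynomial.X j) * W i j = vand r) ∧
    ∀ k, eulerOp k (vand r) = ∑ j, MvPolynomial.X k * W k j := by
  let f : Fin r × Fin r → MvPolynomial (Fin r) ℂ := fun p =>
    if p.1 < p.2 then MvPolynomial.X p.1 - MvPolynomial.X p.2 else 1
  let G : Fin r → Fin r → MvPolynomial (Fin r) ℂ := fun i j =>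
    if i < j then ∏ q ∈ Finset.univ.erase (i, j), f q else 0
  have hV : vand r = ∏ p, f p := by
    rw [Fintype.prod_prod_type]
    exact det_rev_pow MvPolynomial.X
  have hG : ∀ i j, i < j → (MvPolynomial.X i - MvPolynomial.X j) * G i j = vand r := by
    intro i j hij
    rw [hV, ← Finset.mul_prod_erase _ f (Finset.mem_univ (i, j))]
    simp only [G, f, hij, if_true]
  refine ⟨fun i j => G i j - G j i, fun i j => by ring, fun i j hij => ?_, fun k => ?_⟩
  · rcases lt_or_gt_of_ne hij with h | h
    · have : G j i = 0 := if_neg h.le.not_gt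
      beta_reduce
      rw [this, sub_zero, hG i j h]
    · have : G i j = 0 := if_neg h.le.not_gt
      beta_reduce
      rw [this, ← hG j i h]
      ring
  · rw [hV, derivation_prod, Fintype.sum_prod_type]
    have h1 : ∀ i j : Fin r, (∏ q ∈ Finset.univ.erase (i, j), f q) * eulerOp k (f (i, j))
        = (if i = k then MvPolynomial.X k * G i j else 0)
          - if j = k then MvPolynomial.X k * G i j else 0 := by
      intro i j
      by_cases hij : i < j
      · simp only [G, f, hij, if_true, map_sub, eulerOp_X]
        split_ifs <;> ring
      · simp [G, f, hij]
    simp only [h1, Finset.sum_sub_distrib, mul_sub]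
    congr 1
    · rw [Finset.sum_comm]
      simp
    · simp

/-- The relations on F give (x_i - x_j) F_ij = x_i (d_i - d_j), hence V F_ij = W_ij x_i (d_i - d_j).
In the application V = Δ, d_k = x_k ∂χ/∂x_k and F holds the generating polynomials of traces. The
identity evaluates the cross term of the second-order Euler operator on Δ χ. -/
theorem vand_laplace_identity {A : Type*} [CommRing A] [IsDomain A] [CharZero A] {r : ℕ}
    (x d : Fin r → A) (W F : Fin r → Fin r → A) (V : A)
    (hW : ∀ i j, W j i = -W i j) (hV : ∀ i j, i ≠ j → (x i - x j) * W i j = V)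
    (hF0 : ∀ i, F i i = 0) (hF : ∀ i j, x j * F i j = x i * F j i)
    (hFd : ∀ i j, F i j - F j i = d i - d j) :
    2 * ∑ k, (∑ j, x k * W k j) * d k - V * ∑ i, ∑ j, F i j = ((r : A) - 1) * (V * ∑ k, d k) := by
  have hVF : ∀ i j, V * F i j = W i j * (x i * (d i - d j)) := fun i j => by
    by_cases hij : i = j
    · subst hij
      simp [hF0]
    · rw [← hV i j hij]
      linear_combination (-W i j) * hF i j + (W i j * x i) * hFd i j
  have h1 : 2 * ∑ k, (∑ j, x k * W k j) * d k - V * ∑ i, ∑ j, F i j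
      = ∑ i, ∑ j, W i j * x i * (d i + d j) := by
    simp only [Finset.mul_sum, Finset.sum_mul, hVF, ← Finset.sum_sub_distrib]
    refine Finset.sum_congr rfl fun i _ => Finset.sum_congr rfl fun j _ => ?_
    ring
  have h2 : ∑ i, ∑ j, W i j * x i * (d i + d j) = ∑ i, ∑ j, -(W i j * x j * (d i + d j)) := by
    rw [Finset.sum_comm]
    refine Finset.sum_congr rfl fun i _ => Finset.sum_congr rfl fun j _ => ?_
    rw [hW i j]
    ring
  -- Averaging with the sum in which i and j are exchanged turns W_ij x_i into W_ij (x_i - x_j) = V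
  -- off the diagonal; each d_k then occurs 2(r-1) times.
  have h3 : 2 * ∑ i, ∑ j, W i j * x i * (d i + d j) = 2 * (((r : A) - 1) * (V * ∑ k, d k)) := by
    rw [two_mul]
    conv_lhs =>
      lhs
      rw [h2]
    simp only [← Finset.sum_add_distrib]
    have h4 : ∀ i j, -(W i j * x j * (d i + d j)) + W i j * x i * (d i + d j)
        = V * (d i + d j) - if i = j then V * (d i + d j) else 0 := fun i j => by
      by_cases hij : i = j
      · subst hij; simp
      · rw [if_neg hij, ← hV i j hij]
        ring
    simp only [h4]
    simp only [Finset.sum_sub_distrib, mul_add, Finset.sum_add_distrib, Finset.sum_ite_eq,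
      Finset.mem_univ, if_true, Finset.sum_const, Finset.card_univ, Fintype.card_fin,
      nsmul_eq_mul, ← Finset.mul_sum]
    ring
  rw [h1]
  exact mul_left_cancel₀ two_ne_zero h3

/-! ### Coefficients of antisymmetric polynomials -/

theorem coeff_det_alternant {r : ℕ} (a : Fin r → ℕ) (α : Fin r →₀ ℕ) :
    MvPolynomial.coeff α (alternant r a).det
      = ∑ σ : Equiv.Perm (Fin r),
        if (∀ i, α (σ i) = a i) then ((Equiv.Perm.sign σ : ℤ) : ℂ) else 0 := by
  rw [Matrix.det_apply', MvPolynomial.coeff_sum]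
  refine Finset.sum_congr rfl fun σ _ => ?_
  have h1 : (((Equiv.Perm.sign σ : ℤ) : MvPolynomial (Fin r) ℂ))
      = MvPolynomial.C ((Equiv.Perm.sign σ : ℤ) : ℂ) := 
    (map_intCast (MvPolynomial.C : ℂ →+* MvPolynomial (Fin r) ℂ) _).symm
  have h2 : ∏ i, alternant r a (σ i) i
      = MvPolynomial.monomial (Finsupp.equivFunOnFinite.symm (a ∘ σ.symm)) (1 : ℂ) := by
    rw [MvPolynomial.monomial_eq, Finsupp.prod_fintype _ _ fun i => pow_zero _,
      ← Equiv.prod_comp σ fun i => (MvPolynomial.X i : MvPolynomial (Fin r) ℂ)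
        ^ (Finsupp.equivFunOnFinite.symm (a ∘ σ.symm)) i, map_one, one_mul]
    simp [alternant]
  rw [h1, MvPolynomial.coeff_C_mul, h2, MvPolynomial.coeff_monomial]
  have h3 : Finsupp.equivFunOnFinite.symm (a ∘ σ.symm) = α ↔ ∀ i, α (σ i) = a i := by
    constructor
    · rintro rfl i
      simp
    · intro h
      ext i
      have := h (σ.symm i)
      rw [Equiv.apply_symm_apply] at this
      simp [this]
  simp [h3]

theorem exists_perm_of_coeff_det_alternant_ne_zero {r : ℕ} {a : Fin r → ℕ} {α : Fin r →₀ ℕ}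
    (h : MvPolynomial.coeff α (alternant r a).det ≠ 0) :
    ∃ σ : Equiv.Perm (Fin r), ∀ i, α (σ i) = a i := by
  rw [coeff_det_alternant] at h
  obtain ⟨σ, _, hσ⟩ := Finset.exists_ne_zero_of_sum_ne_zero h
  exact ⟨σ, by_contra fun h0 => hσ (if_neg h0)⟩

/-- A permutation matching two strictly decreasing sequences is increasing, hence the identity. -/
theorem coeff_det_alternant_of_strictAnti {r : ℕ} {a : Fin r → ℕ} (ha : StrictAnti a)
    {α : Fin r →₀ ℕ} (hα : StrictAnti α) :
    MvPolynomial.coeff α (alternant r a).det = if ∀ i, α i = a i then 1 else 0 := by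
  have h1 : ∀ σ : Equiv.Perm (Fin r), (∀ i, α (σ i) = a i) → σ = 1 := fun σ hσ => by
    have hmono : StrictMono σ := fun i j hij => by
      have := ha hij
      rw [← hσ i, ← hσ j] at this
      exact hα.lt_iff_gt.1 this
    have := (StrictMono.range_inj hmono strictMono_id).1
      (by rw [σ.surjective.range_eq, Set.range_id])
    exact Equiv.ext fun i => congrFun this i
  rw [coeff_det_alternant, Finset.sum_eq_single 1]
  · simp
  · intro σ _ hσ
    exact if_neg fun h => hσ (h1 σ h)
  · simp

theorem IsAntisymmetric.coeff_comp {r : ℕ} {p : MvPolynomial (Fin r) ℂ} (hp : IsAntisymmetric p)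
    (α : Fin r → ℕ) (σ : Equiv.Perm (Fin r)) :
    MvPolynomial.coeff (Finsupp.equivFunOnFinite.symm (α ∘ σ)) p
      = ((Equiv.Perm.sign σ : ℤ) : ℂ)
        * MvPolynomial.coeff (Finsupp.equivFunOnFinite.symm α) p := by
  have h1 := MvPolynomial.coeff_rename_mapDomain (R := ℂ) σ σ.injective p
    (Finsupp.equivFunOnFinite.symm (α ∘ σ))
  have h2 : Finsupp.mapDomain σ (Finsupp.equivFunOnFinite.symm (α ∘ σ))
      = Finsupp.equivFunOnFinite.symm α := by
    ext i
    obtain ⟨j, rfl⟩ := σ.surjective i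
    rw [Finsupp.mapDomain_apply σ.injective]
    simp
  rw [h2, hp σ] at h1
  rw [← h1, show (((Equiv.Perm.sign σ : ℤ) : MvPolynomial (Fin r) ℂ))
      = MvPolynomial.C ((Equiv.Perm.sign σ : ℤ) : ℂ) from 
    (map_intCast (MvPolynomial.C : ℂ →+* MvPolynomial (Fin r) ℂ) _).symm,
    MvPolynomial.coeff_C_mul]

/-- Distinct exponents can be sorted into decreasing order at the cost of a sign; with a repeated
exponent, the transposition of the two positions shows that the coefficient is its own negative. -/
theorem IsAntisymmetric.eq_zero {r : ℕ} {p : MvPolynomial (Fin r) ℂ} (hp : IsAntisymmetric p)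
    (h : ∀ α : Fin r →₀ ℕ, StrictAnti α → MvPolynomial.coeff α p = 0) : p = 0 := by
  refine MvPolynomial.ext _ _ fun α => ?_
  rw [MvPolynomial.coeff_zero]
  have hα : Finsupp.equivFunOnFinite.symm (α : Fin r → ℕ) = α :=
    Finsupp.equivFunOnFinite.symm_apply_apply α
  by_cases hinj : Function.Injective α
  · let τ : Equiv.Perm (Fin r) := Fin.revPerm.trans (Tuple.sort α)
    have hmono : Monotone (α ∘ Tuple.sort α) := Tuple.monotone_sort α
    have hanti : StrictAnti (α ∘ τ) := by
      have h1 : Antitone (α ∘ τ) := fun i j hij => hmono (Fin.rev_le_rev.2 hij)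
      exact h1.strictAnti_of_injective (hinj.comp τ.injective)
    have h2 := hp.coeff_comp α τ
    rw [h _ (by simpa using hanti), hα] at h2
    have h3 : ((Equiv.Perm.sign τ : ℤ) : ℂ) ≠ 0 := by
      rcases Int.units_eq_one_or (Equiv.Perm.sign τ) with h | h <;> simp [h]
    exact (mul_eq_zero.1 h2.symm).resolve_left h3
  · rw [Function.Injective] at hinj
    push Not at hinj
    obtain ⟨i, j, hij, hne⟩ := hinj
    have h2 := hp.coeff_comp α (Equiv.swap i j)
    have h3 : (α : Fin r → ℕ) ∘ Equiv.swap i j = α := by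
      funext k
      simp only [Function.comp_apply, Equiv.swap_apply_def]
      split_ifs with h h'
      · rw [h, hij]
      · rw [h', hij]
      · rfl
    rw [h3, hα, Equiv.Perm.sign_swap hne] at h2
    exact eq_zero_of_eq_neg (by simpa using h2)

/-! ### Dominance -/

theorem exists_lt_iff_of_antitone {r : ℕ} {a : Fin r → ℕ} (ha : Antitone a) (m : ℕ) :
    ∃ k : ℕ, ∀ i, m < a i ↔ (i : ℕ) < k := by
  refine ⟨(Finset.univ.filter fun i => m < a i).sup fun i => (i : ℕ) + 1, fun i => ?_⟩
  rw [Finset.lt_sup_iff]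
  constructor
  · exact fun h => ⟨i, by simpa using h, by omega⟩
  · rintro ⟨j, hj, hij⟩
    have h1 : m < a j := by simpa using hj
    exact h1.trans_le (ha (Fin.le_def.2 (by omega)))

/-- Summation by layers: ∑ a_i c_i is the sum over m of the c_i with a_i > m, and for decreasing a
each layer is an initial segment, where the hypothesis compares a with b. -/
theorem sum_mul_le_of_dominance {r : ℕ} {a b : Fin r → ℕ} (ha : Antitone a)
    (h : ∀ k : ℕ, (∑ i : Fin r, if (i : ℕ) < k then a i else 0)
      ≤ ∑ i : Fin r, if (i : ℕ) < k then b i else 0) :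
    ∑ i, a i * a i ≤ ∑ i, a i * b i := by
  have key : ∀ c : Fin r → ℕ, ∑ i, a i * c i
      = ∑ m ∈ Finset.range (∑ i, a i), ∑ i, if m < a i then c i else 0 := fun c => by
    rw [Finset.sum_comm]
    refine Finset.sum_congr rfl fun i _ => ?_
    rw [← Finset.sum_filter, Finset.sum_const, smul_eq_mul]
    congr 1
    have : (Finset.range (∑ i, a i)).filter (fun m => m < a i) = Finset.range (a i) := by
      ext m
      simp only [Finset.mem_filter, Finset.mem_range, and_iff_right_iff_imp]
      exact fun hm => hm.trans_le
        (Finset.single_le_sum (f := a) (fun _ _ => Nat.zero_le _) (Finset.mem_univ i))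
    rw [this, Finset.card_range]
  rw [key, key]
  refine Finset.sum_le_sum fun m _ => ?_
  obtain ⟨k, hk⟩ := exists_lt_iff_of_antitone ha m
  simp only [hk]
  exact h k

/-- Dominance gives |a|² ≤ ⟨a, b⟩, so |b - a|² = |a|² + |b|² - 2⟨a, b⟩ ≤ 0 when the norms agree. -/
theorem eq_of_dominance_of_sum_sq {r : ℕ} {a b : Fin r → ℕ} (ha : Antitone a)
    (h : ∀ k : ℕ, (∑ i : Fin r, if (i : ℕ) < k then a i else 0)
      ≤ ∑ i : Fin r, if (i : ℕ) < k then b i else 0)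
    (hsq : ∑ i, a i * a i = ∑ i, b i * b i) : a = b := by
  have h1 := sum_mul_le_of_dominance ha h
  have h2 : ∑ i, ((b i : ℤ) - a i) ^ 2 ≤ 0 := by
    have h3 : ∑ i, ((b i : ℤ) - a i) ^ 2
        = ((∑ i, b i * b i : ℕ) : ℤ) + ((∑ i, a i * a i : ℕ) : ℤ)
          - 2 * ((∑ i, a i * b i : ℕ) : ℤ) := by
      push_cast
      rw [Finset.mul_sum, ← Finset.sum_add_distrib, ← Finset.sum_sub_distrib]
      exact Finset.sum_congr rfl fun i _ => by ring
    rw [h3, ← hsq]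
    omega
  have h4 := (Finset.sum_eq_zero_iff_of_nonneg fun i _ => sq_nonneg ((b i : ℤ) - a i)).1
    (le_antisymm h2 (Finset.sum_nonneg fun i _ => sq_nonneg _))
  funext i
  have := h4 i (Finset.mem_univ i)
  have h5 : (b i : ℤ) - a i = 0 := by simpa using this
  omega

theorem eq_of_partialSums_eq {r : ℕ} {a b : Fin r → ℕ}
    (h : ∀ k : ℕ, (∑ i : Fin r, if (i : ℕ) < k then a i else 0)
      = ∑ i : Fin r, if (i : ℕ) < k then b i else 0) : a = b := by
  have key : ∀ (c : Fin r → ℕ) (j : Fin r), (∑ i : Fin r, if (i : ℕ) < (j : ℕ) + 1 then c i else 0)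
      = (∑ i : Fin r, if (i : ℕ) < (j : ℕ) then c i else 0) + c j := fun c j => by
    have h1 : ∀ i : Fin r, (if (i : ℕ) < (j : ℕ) + 1 then c i else 0)
        = (if (i : ℕ) < (j : ℕ) then c i else 0) + if i = j then c i else 0 := fun i => by
      rcases lt_trichotomy (i : ℕ) j with h | h | h
      · simp [h, h.trans (Nat.lt_succ_self _), Fin.ne_of_lt (Fin.lt_def.2 h)]
      · simp [Fin.ext h]
      · simp [h.not_gt, show ¬ (i : ℕ) < (j : ℕ) + 1 by omega, Fin.ne_of_gt (Fin.lt_def.2 h)]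
    rw [Finset.sum_congr rfl fun i _ => h1 i, Finset.sum_add_distrib, Finset.sum_ite_eq',
      if_pos (Finset.mem_univ j)]
  funext j
  have h1 := h (j + 1)
  rw [key, key, h j] at h1
  exact add_left_cancel h1

/-- The rearrangement inequality against the indicator of the first k positions. -/
theorem partialSum_perm_rev_le {r : ℕ} {β : Fin r → ℕ} {σ : Equiv.Perm (Fin r)}
    (hσ : ∀ i, β (σ i) = (i.rev : ℕ)) (k : ℕ) :
    (∑ i : Fin r, if (i : ℕ) < k then β i else 0)
      ≤ ∑ i : Fin r, if (i : ℕ) < k then (i.rev : ℕ) else 0 := by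
  have h1 : Antitone fun i : Fin r => (i.rev : ℕ) := fun i j hij =>
    Fin.le_def.1 (Fin.rev_le_rev.2 hij)
  have h2 : Antitone fun i : Fin r => if (i : ℕ) < k then 1 else 0 := fun i j hij => by
    have : (i : ℕ) ≤ j := hij
    dsimp only
    split_ifs <;> omega
  have h3 := (h1.monovary h2).sum_comp_perm_mul_le_sum_mul (σ := σ.symm)
  have h4 : ∀ i, ((σ.symm i).rev : ℕ) = β i := fun i => by
    rw [← hσ, Equiv.apply_symm_apply]
  simp only [h4, mul_ite, mul_one, mul_zero] at h3
  exact h3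

/-! ### The Weyl character formula -/

section Weyl

variable {r : ℕ}

/-- The polynomial of degree `n` with coefficients given by `c`. -/
def genPoly (n : ℕ) (c : (Fin r → ℕ) → ℂ) : MvPolynomial (Fin r) ℂ :=
  ∑ μ ∈ Finset.piAntidiag (Finset.univ : Finset (Fin r)) n, c μ • ∏ i, MvPolynomial.X i ^ μ i

theorem coeff_genPoly (n : ℕ) (c : (Fin r → ℕ) → ℂ) (α : Fin r →₀ ℕ) :
    MvPolynomial.coeff α (genPoly n c) = if ∑ i, α i = n then c α else 0 := by
  have h1 : ∀ μ : Fin r → ℕ, MvPolynomial.coeff α (c μ • ∏ i, MvPolynomial.X i ^ μ i)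
      = if (α : Fin r → ℕ) = μ then c μ else 0 := fun μ => by
    have h2 : ∏ i, (MvPolynomial.X i : MvPolynomial (Fin r) ℂ) ^ μ i
        = MvPolynomial.monomial (Finsupp.equivFunOnFinite.symm μ) (1 : ℂ) := by
      rw [MvPolynomial.monomial_eq, Finsupp.prod_fintype _ _ fun i => pow_zero _, map_one, one_mul]
      rfl
    rw [h2, MvPolynomial.coeff_smul, MvPolynomial.coeff_monomial]
    have h3 : Finsupp.equivFunOnFinite.symm μ = α ↔ (α : Fin r → ℕ) = μ := by
      rw [Equiv.symm_apply_eq, eq_comm]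
      rfl
    simp [h3]
  rw [genPoly, MvPolynomial.coeff_sum, Finset.sum_congr rfl fun μ _ => h1 μ, Finset.sum_ite_eq]
  simp [Finset.mem_piAntidiag]

/-- The character of `S^ν(ℂ^r)`. -/
def schurCharacter (ν : Fin r → ℕ) : MvPolynomial (Fin r) ℂ :=
  genPoly (∑ i, ν i) fun μ => (weightMult ν μ : ℂ)

variable {ν : Fin r → ℕ}

/-- No degree condition is needed, since every weight of S^ν has total |ν|. -/
theorem coeff_schurCharacter (α : Fin r →₀ ℕ) :
    MvPolynomial.coeff α (schurCharacter ν) = (weightMult ν α : ℂ) := by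
  rw [schurCharacter, coeff_genPoly]
  split_ifs with h
  · rfl
  · by_contra h0
    refine h (sum_eq_of_contentDim_ne_zero (ν := ν) fun h1 => h0 ?_)
    rw [weightMult_eq_contentDim, h1, Nat.cast_zero]

theorem isSymmetric_schurCharacter (ν : Fin r → ℕ) : (schurCharacter ν).IsSymmetric := by
  intro e
  refine MvPolynomial.ext _ _ fun α => ?_
  have h2 : Finsupp.mapDomain e (Finsupp.equivFunOnFinite.symm (α ∘ e)) = α := by
    ext i
    obtain ⟨j, rfl⟩ := e.surjective i
    rw [Finsupp.mapDomain_apply e.injective]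
    simp
  have h1 := MvPolynomial.coeff_rename_mapDomain (R := ℂ) e e.injective (schurCharacter ν)
    (Finsupp.equivFunOnFinite.symm (α ∘ e))
  rw [h2] at h1
  rw [h1, coeff_schurCharacter, coeff_schurCharacter]
  exact congrArg Nat.cast (weightMult_comp ν α e)

/-- The generating polynomial of the traces of `E_{ij} E_{ji}`. -/
def tracePoly (ν : Fin r → ℕ) (i j : Fin r) : MvPolynomial (Fin r) ℂ :=
  genPoly (∑ i, ν i) fun μ =>
    elemTrace (LinearMap.range (youngOp ν)) elemAct_mem_range_youngOp i j μ

theorem coeff_X_mul_tracePoly (i j : Fin r) (α : Fin r →₀ ℕ) :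
    MvPolynomial.coeff α (MvPolynomial.X j * tracePoly ν i j)
      = if α i ≠ 0 ∧ α j ≠ 0 ∧ ∑ k, α k = ∑ k, ν k + 1 then
          elemTrace (LinearMap.range (youngOp ν)) elemAct_mem_range_youngOp i j
            (α - Finsupp.single j 1 : Fin r →₀ ℕ) else 0 := by
  rw [MvPolynomial.coeff_X_mul', tracePoly, coeff_genPoly]
  by_cases hj : α j = 0
  · simp [hj]
  rw [if_pos (Finsupp.mem_support_iff.2 hj)]
  by_cases hi : α i = 0
  · rw [elemTrace_eq_zero _ _ _ _ _ (by simp [hi]), ite_self,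
      if_neg fun h => h.1 hi]
  have hsum : ∑ k, α k = ∑ k, (α - Finsupp.single j 1 : Fin r →₀ ℕ) k + 1 := by
    have h1 : α = (α - Finsupp.single j 1) + Finsupp.single j 1 := by
      rw [tsub_add_cancel_of_le]
      rw [Finsupp.single_le_iff]
      omega
    conv_lhs => rw [h1]
    simp only [Finsupp.add_apply, Finset.sum_add_distrib]
    congr 1
    simp [Finsupp.single_apply]
  have hiff : (∑ k, (α - Finsupp.single j 1 : Fin r →₀ ℕ) k = ∑ k, ν k) ↔
      (α i ≠ 0 ∧ α j ≠ 0 ∧ ∑ k, α k = ∑ k, ν k + 1) := by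
    rw [hsum]
    simp [hi, hj]
  simp only [hiff]

/-- The generating-function form of `elemTrace_shift`. The boundary exponents, with α_i = 0 or α_j =
0, are covered by `elemTrace_eq_zero`. -/
theorem X_mul_tracePoly (i j : Fin r) :
    MvPolynomial.X j * tracePoly ν i j = MvPolynomial.X i * tracePoly ν j i := by
  by_cases hij : i = j
  · subst hij; rfl
  refine MvPolynomial.ext _ _ fun α => ?_
  rw [coeff_X_mul_tracePoly, coeff_X_mul_tracePoly]
  by_cases h : α i ≠ 0 ∧ α j ≠ 0 ∧ ∑ k, α k = ∑ k, ν k + 1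
  · rw [if_pos h, if_pos ⟨h.2.1, h.1, h.2.2⟩]
    have h1 := elemTrace_shift (LinearMap.range (youngOp ν)) elemAct_mem_range_youngOp i j
      (α - Finsupp.single j 1 - Finsupp.single i 1 : Fin r →₀ ℕ)
    have h2 : ((α - Finsupp.single j 1 - Finsupp.single i 1 : Fin r →₀ ℕ) : Fin r → ℕ)
        + (Pi.single i 1 : Fin r → ℕ) = (α - Finsupp.single j 1 : Fin r →₀ ℕ) := by
      funext k
      have := h.1
      simp only [Finsupp.coe_tsub, Pi.add_apply, Pi.sub_apply, Finsupp.single_apply,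
        Pi.single_apply, eq_comm (a := k)]
      rcases eq_or_ne i k with rfl | hi
      · simp only [if_true, if_neg (Ne.symm hij)]
        omega
      · simp [hi]
    have h3 : ((α - Finsupp.single j 1 - Finsupp.single i 1 : Fin r →₀ ℕ) : Fin r → ℕ)
        + (Pi.single j 1 : Fin r → ℕ) = (α - Finsupp.single i 1 : Fin r →₀ ℕ) := by
      funext k
      have := h.2.1
      simp only [Finsupp.coe_tsub, Pi.add_apply, Pi.sub_apply, Finsupp.single_apply,
        Pi.single_apply, eq_comm (a := k)]
      rcases eq_or_ne j k with rfl | hj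
      · simp only [if_true, if_neg hij]
        omega
      · simp [hj]
    rw [h2, h3] at h1
    exact h1
  · rw [if_neg h, if_neg fun h' => h ⟨h'.2.1, h'.1, h'.2.2⟩]

theorem tracePoly_self (i : Fin r) : tracePoly ν i i = 0 := by
  refine MvPolynomial.ext _ _ fun α => ?_
  rw [tracePoly, coeff_genPoly, MvPolynomial.coeff_zero]
  simp [elemTrace]

theorem tracePoly_sub (i j : Fin r) : tracePoly ν i j - tracePoly ν j i
    = eulerOp i (schurCharacter ν) - eulerOp j (schurCharacter ν) := by
  refine MvPolynomial.ext _ _ fun α => ?_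
  rw [MvPolynomial.coeff_sub, MvPolynomial.coeff_sub, coeff_eulerOp, coeff_eulerOp, ← sub_mul,
    tracePoly, tracePoly, schurCharacter, coeff_genPoly, coeff_genPoly, coeff_genPoly]
  split_ifs
  · rw [elemTrace_sub, weightMult_eq_contentDim]
  · simp

/-- The operator `∑_k (x_k ∂/∂x_k)^2`. -/
def eulerSq (p : MvPolynomial (Fin r) ℂ) : MvPolynomial (Fin r) ℂ :=
  ∑ k, eulerOp k (eulerOp k p)

theorem coeff_eulerSq (p : MvPolynomial (Fin r) ℂ) (α : Fin r →₀ ℕ) :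
    MvPolynomial.coeff α (eulerSq p) = (∑ k, (α k : ℂ) ^ 2) * MvPolynomial.coeff α p := by
  rw [eulerSq, MvPolynomial.coeff_sum, Finset.sum_mul]
  exact Finset.sum_congr rfl fun k _ => by rw [coeff_eulerOp, coeff_eulerOp]; ring

/-- Every exponent occurring in Δ is a permutation of ρ = (r-1, …, 0), so all have the same sum of
squares. -/
theorem eulerSq_vand (r : ℕ) :
    eulerSq (vand r) = MvPolynomial.C (∑ i : Fin r, ((i.rev : ℕ) : ℂ) ^ 2) * vand r := by
  refine MvPolynomial.ext _ _ fun α => ?_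
  rw [coeff_eulerSq, MvPolynomial.coeff_C_mul]
  by_cases h : MvPolynomial.coeff α (vand r) = 0
  · rw [h, mul_zero, mul_zero]
  · obtain ⟨σ, hσ⟩ := exists_perm_of_coeff_det_alternant_ne_zero h
    congr 1
    rw [← Equiv.sum_comp σ]
    simp only [hσ]

theorem sum_tracePoly (hν : Antitone ν) : ∃ z : ℂ, ∑ i, ∑ j, tracePoly ν i j
    = MvPolynomial.C z * schurCharacter ν - eulerSq (schurCharacter ν) := by
  obtain ⟨z, hz⟩ := exists_swapSum_eq_smul hν
  refine ⟨((r : ℂ) - 1) * Fintype.card (Boxes ν) + z, MvPolynomial.ext _ _ fun α => ?_⟩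
  have h := sum_elemTrace (LinearMap.range (youngOp ν)) elemAct_mem_range_youngOp hz α
  rw [MvPolynomial.coeff_sub, MvPolynomial.coeff_C_mul, coeff_eulerSq, ← sub_mul]
  simp only [MvPolynomial.coeff_sum, tracePoly, schurCharacter, coeff_genPoly]
  split_ifs
  · rw [h, weightMult_eq_contentDim]
  · simp

theorem sum_eulerOp_schurCharacter : ∑ k, eulerOp k (schurCharacter ν)
    = MvPolynomial.C (∑ i, (ν i : ℂ)) * schurCharacter ν := by
  refine MvPolynomial.ext _ _ fun α => ?_
  rw [MvPolynomial.coeff_C_mul, MvPolynomial.coeff_sum,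
    Finset.sum_congr rfl fun k _ => coeff_eulerOp k _ α, ← Finset.sum_mul,
    schurCharacter, coeff_genPoly]
  split_ifs with h
  · congr 1
    exact_mod_cast h
  · rw [mul_zero, mul_zero]

theorem eulerSq_mul (p q : MvPolynomial (Fin r) ℂ) :
    eulerSq (p * q) = eulerSq p * q + 2 * ∑ k, eulerOp k p * eulerOp k q + p * eulerSq q := by
  simp only [eulerSq, Finset.mul_sum, Finset.sum_mul, ← Finset.sum_add_distrib]
  refine Finset.sum_congr rfl fun k _ => ?_
  simp only [Derivation.leibniz, map_add, smul_eq_mul]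
  ring

/-- In the Leibniz expansion on Δ χ, the Casimir trace identity replaces Δ times the second-order
term of χ, and `vand_laplace_identity` disposes of the cross term. What remains is scalar by the
eigenvalue of Δ and the homogeneity of χ. -/
theorem eulerSq_vand_mul_schurCharacter (hν : Antitone ν) :
    ∃ κ : ℂ, eulerSq (vand r * schurCharacter ν)
      = MvPolynomial.C κ * (vand r * schurCharacter ν) := by
  obtain ⟨W, hW, hV, hk⟩ := exists_vand_quotients r
  obtain ⟨z, hz⟩ := sum_tracePoly hν
  have h := vand_laplace_identity MvPolynomial.X (fun k => eulerOp k (schurCharacter ν)) W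
    (tracePoly ν) (vand r) hW hV tracePoly_self X_mul_tracePoly tracePoly_sub
  simp only [← hk] at h
  rw [hz, sum_eulerOp_schurCharacter] at h
  refine ⟨(∑ i : Fin r, ((i.rev : ℕ) : ℂ) ^ 2) + z + ((r : ℂ) - 1) * ∑ i, (ν i : ℂ), ?_⟩
  rw [eulerSq_mul, eulerSq_vand]
  simp only [MvPolynomial.C_add, MvPolynomial.C_mul, MvPolynomial.C_sub, MvPolynomial.C_1]
  have hr : (MvPolynomial.C (r : ℂ) : MvPolynomial (Fin r) ℂ) = r :=
    map_natCast (MvPolynomial.C : ℂ →+* MvPolynomial (Fin r) ℂ) r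
  rw [hr]
  linear_combination h

theorem sum_sq_eq_of_coeff_ne_zero {κ : ℂ} {p : MvPolynomial (Fin r) ℂ}
    (hp : eulerSq p = MvPolynomial.C κ * p) {α : Fin r →₀ ℕ} (h : MvPolynomial.coeff α p ≠ 0) :
    ∑ k, (α k : ℂ) ^ 2 = κ := by
  have h1 := congrArg (MvPolynomial.coeff α) hp
  rw [coeff_eulerSq, MvPolynomial.coeff_C_mul] at h1
  exact mul_right_cancel₀ h h1

theorem dominance_of_coeff_ne_zero (hν : Antitone ν) {β γ : Fin r →₀ ℕ}
    (h : MvPolynomial.coeff β (vand r) * MvPolynomial.coeff γ (schurCharacter ν) ≠ 0) (k : ℕ) :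
    ((∑ i : Fin r, if (i : ℕ) < k then β i else 0)
      ≤ ∑ i : Fin r, if (i : ℕ) < k then (i.rev : ℕ) else 0) ∧
    ((∑ i : Fin r, if (i : ℕ) < k then γ i else 0)
      ≤ ∑ i : Fin r, if (i : ℕ) < k then ν i else 0) := by
  obtain ⟨h1, h2⟩ := mul_ne_zero_iff.1 h
  obtain ⟨σ, hσ⟩ := exists_perm_of_coeff_det_alternant_ne_zero h1
  refine ⟨partialSum_perm_rev_le hσ k, dominance_of_contentDim_ne_zero hν ?_ k⟩
  rw [coeff_schurCharacter, weightMult_eq_contentDim] at h2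
  exact_mod_cast h2

theorem strictAnti_rev (r : ℕ) : StrictAnti fun i : Fin r => (i.rev : ℕ) := fun _ _ hij =>
  Fin.lt_def.1 (Fin.rev_lt_rev.2 hij)

theorem sum_ite_add (k : ℕ) (a b : Fin r → ℕ) :
    (∑ i : Fin r, if (i : ℕ) < k then a i + b i else 0)
      = (∑ i : Fin r, if (i : ℕ) < k then a i else 0)
        + ∑ i : Fin r, if (i : ℕ) < k then b i else 0 := by
  rw [← Finset.sum_add_distrib]
  exact Finset.sum_congr rfl fun i _ => by split_ifs <;> simp

/-- Exponents of Δ are dominated by ρ and those of χ by ν, so a pair adding up to ν + ρ must be (ρ,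
ν); both of these coefficients are 1. -/
theorem coeff_vand_mul_schurCharacter_top (hν : Antitone ν) :
    MvPolynomial.coeff (Finsupp.equivFunOnFinite.symm fun i => ν i + (i.rev : ℕ))
      (vand r * schurCharacter ν) = 1 := by
  let ρ : Fin r →₀ ℕ := Finsupp.equivFunOnFinite.symm fun i => (i.rev : ℕ)
  let ν' : Fin r →₀ ℕ := Finsupp.equivFunOnFinite.symm ν
  rw [MvPolynomial.coeff_mul, Finset.sum_eq_single (ρ, ν')]
  · have h1 : MvPolynomial.coeff ρ (vand r) = 1 := by
      have hρ : StrictAnti ρ := strictAnti_rev r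
      rw [vand, coeff_det_alternant_of_strictAnti (strictAnti_rev r) hρ]
      exact if_pos fun i => rfl
    have h2 : MvPolynomial.coeff ν' (schurCharacter ν) = 1 := by
      rw [coeff_schurCharacter, weightMult_eq_contentDim]
      have : (ν' : Fin r → ℕ) = ν := rfl
      rw [this, contentDim_self hν, Nat.cast_one]
    rw [h1, h2, mul_one]
  · rintro ⟨β, γ⟩ hβγ hne
    rw [Finset.HasAntidiagonal.mem_antidiagonal] at hβγ
    by_contra h0
    have hd := dominance_of_coeff_ne_zero (β := β) (γ := γ) hν h0
    have hs : ∀ i, β i + γ i = (i.rev : ℕ) + ν i := fun i => by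
      have := DFunLike.congr_fun hβγ i
      rw [Finsupp.add_apply] at this
      rw [this, add_comm]
      rfl
    have hsum : ∀ k : ℕ, (∑ i : Fin r, if (i : ℕ) < k then β i else 0)
        + (∑ i : Fin r, if (i : ℕ) < k then γ i else 0)
        = (∑ i : Fin r, if (i : ℕ) < k then (i.rev : ℕ) else 0)
        + ∑ i : Fin r, if (i : ℕ) < k then ν i else 0 := fun k => by
      rw [← sum_ite_add, ← sum_ite_add]
      simp only [hs]
    have hβ : (β : Fin r → ℕ) = fun i => (i.rev : ℕ) := eq_of_partialSums_eq fun k => by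
      have := hd k
      have := hsum k
      omega
    have hγ : (γ : Fin r → ℕ) = ν := eq_of_partialSums_eq fun k => by
      have := hd k
      have := hsum k
      omega
    refine hne (Prod.ext ?_ ?_)
    · exact DFunLike.coe_injective hβ
    · exact DFunLike.coe_injective hγ
  · intro h
    refine absurd ?_ h
    rw [Finset.HasAntidiagonal.mem_antidiagonal]
    ext i
    exact add_comm _ _

theorem strictAnti_add_rev (hν : Antitone ν) : StrictAnti fun i => ν i + (i.rev : ℕ) :=
  fun _ _ hij => add_lt_add_of_le_of_lt (hν hij.le) (strictAnti_rev r hij)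

/-- Antisymmetry reduces the claim to strictly decreasing exponents α. A nonzero coefficient of Δ χ
at α forces |α|² = |ν + ρ|² by the eigenvalue equation and dominance of α by ν + ρ by multiplication
of monomials; together these give α = ν + ρ. -/
theorem vand_mul_schurCharacter (hν : Antitone ν) :
    vand r * schurCharacter ν = (alternant r fun j => ν j + (j.rev : ℕ)).det := by
  obtain ⟨κ, hκ⟩ := eulerSq_vand_mul_schurCharacter hν
  have htop := coeff_vand_mul_schurCharacter_top hν
  have hκ' := sum_sq_eq_of_coeff_ne_zero hκ (htop.trans_ne one_ne_zero)
  rw [← sub_eq_zero]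
  refine IsAntisymmetric.eq_zero (fun e => ?_) fun α hα => ?_
  · rw [map_sub, (isAntisymmetric_vand r).mul (isSymmetric_schurCharacter ν) e,
      rename_det_alternant, mul_sub]
  rw [MvPolynomial.coeff_sub, coeff_det_alternant_of_strictAnti (strictAnti_add_rev hν) hα]
  split_ifs with h
  · have : α = Finsupp.equivFunOnFinite.symm fun i => ν i + (i.rev : ℕ) := Finsupp.ext h
    rw [this, htop, sub_self]
  · rw [sub_zero]
    by_contra h0
    have hsq := (sum_sq_eq_of_coeff_ne_zero hκ h0).trans hκ'.symm
    rw [MvPolynomial.coeff_mul] at h0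
    obtain ⟨⟨β, γ⟩, hβγ, hne⟩ := Finset.exists_ne_zero_of_sum_ne_zero h0
    rw [Finset.HasAntidiagonal.mem_antidiagonal] at hβγ
    have hd := dominance_of_coeff_ne_zero hν hne
    refine h fun i => congrFun (eq_of_dominance_of_sum_sq (a := α)
      (b := fun i => ν i + (i.rev : ℕ)) hα.antitone (fun k => ?_) ?_) i
    · have hα' : ∀ i, α i = γ i + β i := fun i => by
        rw [← hβγ, Finsupp.add_apply, add_comm]
      simp only [hα']
      rw [sum_ite_add, sum_ite_add]
      exact add_le_add (hd k).2 (hd k).1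
    · have : ((∑ i, α i * α i : ℕ) : ℂ)
          = ((∑ i : Fin r, (ν i + (i.rev : ℕ)) * (ν i + (i.rev : ℕ)) : ℕ) : ℂ) := by
        push_cast
        simp only [← sq]
        refine hsq.trans (Finset.sum_congr rfl fun i _ => ?_)
        rw [← Nat.cast_add]
        rfl
      exact_mod_cast this

theorem schurPoly_eq_schurCharacter (hν : Antitone ν) : schurPoly ν = schurCharacter ν :=
  mul_left_cancel₀ (vand_ne_zero r)
    ((schurPoly_spec ν).symm.trans (vand_mul_schurCharacter hν).symm)

end Weyl

/-! ### Determinants of exponential series -/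

theorem prod_prod_lt {M : Type*} [CommMonoid M] {r : ℕ} (f : Fin r → Fin r → M) :
    (∏ i, ∏ j, if i < j then f i j else 1) = ∏ i, ∏ j ∈ Finset.Ioi i, f i j := by
  refine Finset.prod_congr rfl fun i _ => ?_
  rw [← Finset.prod_filter]
  refine Finset.prod_congr ?_ fun j _ => rfl
  ext j
  simp

theorem sum_card_Ioi (r : ℕ) : ∑ i : Fin r, (Finset.Ioi i).card = r.choose 2 := by
  have h : ∀ i : Fin r, (Finset.Ioi i).card = (i.rev : ℕ) := fun i => by
    rw [Fin.card_Ioi, Fin.val_rev]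
    omega
  simp only [h]
  rw [sum_rev, Finset.sum_range_id, Nat.choose_two_right]

/-- The reflection formula is applied to each factor of the Vandermonde product in e^{2πi x_i t}.
The power of t comes from the linear factor (x_i - x_j) t of each pair. -/
theorem det_expSeries {A : Type*} [CommRing A] [Algebra ℂ A] {r : ℕ} (x : Fin r → A) :
    (Matrix.of fun i j : Fin r =>
        expSeries ((2 * Real.pi * Complex.I : ℂ) • x i) ^ (j.rev : ℕ)).det
      = PowerSeries.C (algebraMap ℂ A (2 * Real.pi * Complex.I)) ^ r.choose 2 *
        PowerSeries.X ^ r.choose 2 *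
        PowerSeries.C (Matrix.of fun i j : Fin r => x i ^ (j.rev : ℕ)).det *
        (∏ p : Fin r × Fin r, scaledSeries (x p.1 - x p.2) gammaSeries⁻¹) *
        ∏ i, expSeries ((Real.pi * Complex.I : ℂ) • x i) ^ (r - 1) := by
  have hγ : (∏ i, ∏ j ∈ Finset.Ioi i, scaledSeries (x i - x j) gammaSeries⁻¹ *
      scaledSeries (x j - x i) gammaSeries⁻¹)
      = ∏ p : Fin r × Fin r, scaledSeries (x p.1 - x p.2) gammaSeries⁻¹ := by
    rw [Finset.prod_prod_Ioi_mul_eq_prod_prod_off_diag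
      (fun a b => scaledSeries (x b - x a) gammaSeries⁻¹), Fintype.prod_prod_type]
    refine Finset.prod_congr rfl fun i _ => ?_
    refine Finset.prod_subset (Finset.subset_univ _) fun j _ hj => ?_
    have : j = i := by simpa using hj
    -- The diagonal factors are 1/Γ(1) = 1, so the product over i ≠ k extends to all pairs.
    rw [this, sub_self, scaledSeries_zero _ constantCoeff_gammaSeries_inv]
  have hE : (∏ i, ∏ j ∈ Finset.Ioi i, expSeries ((Real.pi * Complex.I : ℂ) • (x i + x j)))
      = ∏ i, expSeries ((Real.pi * Complex.I : ℂ) • x i) ^ (r - 1) := by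
    simp only [smul_add, expSeries_add]
    rw [Finset.prod_prod_Ioi_mul_eq_prod_prod_off_diag
      (fun _ b => expSeries ((Real.pi * Complex.I : ℂ) • x b))]
    refine Finset.prod_congr rfl fun i _ => ?_
    rw [Finset.prod_const, Finset.card_compl, Finset.card_singleton, Fintype.card_fin]
  have hc : ∀ c : PowerSeries A, (∏ i : Fin r, ∏ _j ∈ Finset.Ioi i, c) = c ^ r.choose 2 :=
    fun c => by
      simp only [Finset.prod_const]
      rw [Finset.prod_pow_eq_pow_sum, sum_card_Ioi]
  rw [det_rev_pow, det_rev_pow, prod_prod_lt, prod_prod_lt]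
  simp only [← scaledSeries_gamma_reflection, Finset.prod_mul_distrib, map_prod]
  simp only [Finset.prod_mul_distrib] at hγ
  rw [hγ, hE, hc, hc]
  ring

/-! ### Graded symmetric series -/

section Graded

variable {r : ℕ}

/-- The series whose coefficient of degree `d` is homogeneous of degree `d`. -/
def gradedSeries (r : ℕ) : Subalgebra ℂ (PowerSeries (MvPolynomial (Fin r) ℂ)) where
  carrier := {u | ∀ d, (PowerSeries.coeff d u).IsHomogeneous d}
  add_mem' hu hv d := by
    rw [map_add]
    exact (hu d).add (hv d)
  mul_mem' hu hv d := by
    rw [PowerSeries.coeff_mul]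
    refine MvPolynomial.IsHomogeneous.sum _ _ _ fun p hp => ?_
    rw [← Finset.HasAntidiagonal.mem_antidiagonal.1 hp]
    exact (hu p.1).mul (hv p.2)
  algebraMap_mem' c d := by
    rw [IsScalarTower.algebraMap_apply ℂ (MvPolynomial (Fin r) ℂ)
      (PowerSeries (MvPolynomial (Fin r) ℂ)), PowerSeries.algebraMap_eq, PowerSeries.coeff_C]
    split_ifs with h
    · rw [h]
      exact MvPolynomial.isHomogeneous_C _ _
    · exact MvPolynomial.isHomogeneous_zero _ _ _

theorem scaledSeries_mem_gradedSeries {a : MvPolynomial (Fin r) ℂ} (ha : a.IsHomogeneous 1)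
    (φ : PowerSeries ℂ) : scaledSeries a φ ∈ gradedSeries r := fun d => by
  rw [coeff_scaledSeries, MvPolynomial.smul_eq_C_mul]
  simpa using (MvPolynomial.isHomogeneous_C (Fin r) (PowerSeries.coeff d φ)).mul (ha.pow d)

theorem expSeries_mem_gradedSeries {a : MvPolynomial (Fin r) ℂ} (ha : a.IsHomogeneous 1) :
    expSeries a ∈ gradedSeries r := scaledSeries_mem_gradedSeries ha _

/-- Invariance of the coefficients of a series under permutations of the variables. -/
def IsSymmetricSeries (u : PowerSeries (MvPolynomial (Fin r) ℂ)) : Prop :=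
  ∀ e : Equiv.Perm (Fin r), PowerSeries.map
    ((MvPolynomial.rename e : MvPolynomial (Fin r) ℂ →ₐ[ℂ] _) : _ →+* MvPolynomial (Fin r) ℂ) u = u

theorem IsSymmetricSeries.mul {u v : PowerSeries (MvPolynomial (Fin r) ℂ)}
    (hu : IsSymmetricSeries u) (hv : IsSymmetricSeries v) : IsSymmetricSeries (u * v) := fun e => by
  rw [map_mul, hu e, hv e]

theorem coeff_map_toFlagRing_eq_zero {N : ℕ} (hrN : r ≤ N)
    {u : PowerSeries (MvPolynomial (Fin r) ℂ)} (hu : u ∈ gradedSeries r)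
    (hs : IsSymmetricSeries u) {d : ℕ} (hd : r * (N - r) < d) :
    toFlagRing r N (PowerSeries.coeff d u) = 0 :=
  Ideal.Quotient.eq_zero_iff_mem.2
    (mem_flagIdeal_of_isHomogeneous hrN (isSymmetric_coeff_of_map hs d) (hu d) hd)

/-- The discarded products are symmetric and homogeneous of degree above the dimension, so truncated
classes multiply like the full series. -/
theorem toFlagRing_partialSum_mul {N : ℕ} (hrN : r ≤ N)
    {u v : PowerSeries (MvPolynomial (Fin r) ℂ)} (hu : u ∈ gradedSeries r)
    (hsu : IsSymmetricSeries u) (hv : v ∈ gradedSeries r) (hsv : IsSymmetricSeries v) :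
    toFlagRing r N (partialSum (r * (N - r)) (u * v))
      = toFlagRing r N (partialSum (r * (N - r)) u)
        * toFlagRing r N (partialSum (r * (N - r)) v) := by
  have key : ∀ w, toFlagRing r N (partialSum (r * (N - r)) w)
      = partialSum (r * (N - r)) (PowerSeries.map (toFlagRing r N : _ →+* FlagRing r N) w) :=
    fun w => (partialSum_map (toFlagRing r N : _ →+* FlagRing r N) _ w).symm
  rw [key, key, key, map_mul]
  have := partialSum_mul (r * (N - r)) (1 : FlagRing r N)
    (PowerSeries.map (toFlagRing r N : _ →+* FlagRing r N) u)
    (PowerSeries.map (toFlagRing r N : _ →+* FlagRing r N) v) fun i j hij => by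
      rw [one_mul, PowerSeries.coeff_map, PowerSeries.coeff_map, ← map_mul]
      refine Ideal.Quotient.eq_zero_iff_mem.2 (mem_flagIdeal_of_isHomogeneous hrN ?_
        ((hu i).mul (hv j)) hij)
      exact MvPolynomial.IsSymmetric.mul (isSymmetric_coeff_of_map hsu i)
        (isSymmetric_coeff_of_map hsv j)
  simpa only [one_mul] using this

theorem gammaRatio_mem_gradedSeries (r N : ℕ) : gammaRatio r N ∈ gradedSeries r :=
  mul_mem
    (prod_mem fun i _ => pow_mem (scaledSeries_mem_gradedSeries (MvPolynomial.isHomogeneous_X ℂ i) _) _)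
    (prod_mem fun p _ => scaledSeries_mem_gradedSeries
      ((MvPolynomial.isHomogeneous_X ℂ p.1).sub (MvPolynomial.isHomogeneous_X ℂ p.2)) _)

theorem isSymmetricSeries_gammaRatio (r N : ℕ) : IsSymmetricSeries (gammaRatio r N) := fun e => by
  rw [gammaRatio, map_mul, map_prod, map_prod]
  simp only [map_pow, map_scaledSeries, map_sub, MvPolynomial.rename_X]
  congr 1
  · exact Equiv.prod_comp e fun i =>
      scaledSeries (MvPolynomial.X i : MvPolynomial (Fin r) ℂ) gammaSeries ^ N
  · exact Equiv.prod_comp (Equiv.prodCongr e e) fun p : Fin r × Fin r => scaledSeries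
      (MvPolynomial.X p.1 - MvPolynomial.X p.2 : MvPolynomial (Fin r) ℂ) gammaSeries⁻¹

/-- The series `e^{2πi x_i t}`. -/
def rootExp (i : Fin r) : PowerSeries (MvPolynomial (Fin r) ℂ) :=
  expSeries ((2 * Real.pi * Complex.I : ℂ) • MvPolynomial.X i)

/-- The Chern character series of `S^ν V^*`. -/
def chSeries (ν : Fin r → ℕ) : PowerSeries (MvPolynomial (Fin r) ℂ) :=
  MvPolynomial.aeval rootExp (schurCharacter ν)

theorem isHomogeneous_smul_X (c : ℂ) (i : Fin r) :
    (c • MvPolynomial.X i : MvPolynomial (Fin r) ℂ).IsHomogeneous 1 := by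
  rw [MvPolynomial.smul_eq_C_mul]
  simpa using (MvPolynomial.isHomogeneous_C (Fin r) c).mul (MvPolynomial.isHomogeneous_X ℂ i)

theorem chSeries_eq_sum (ν : Fin r → ℕ) : chSeries ν
    = ∑ μ ∈ Finset.piAntidiag (Finset.univ : Finset (Fin r)) (∑ i, ν i),
      (weightMult ν μ : ℂ) • ∏ i, rootExp i ^ μ i := by
  simp [chSeries, schurCharacter, genPoly, map_sum, map_prod]

theorem chSeries_mem_gradedSeries (ν : Fin r → ℕ) : chSeries ν ∈ gradedSeries r := by
  rw [chSeries_eq_sum]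
  exact sum_mem fun μ _ => Subalgebra.smul_mem _ (prod_mem fun i _ => pow_mem
    (expSeries_mem_gradedSeries (isHomogeneous_smul_X _ i)) _) _

theorem isSymmetricSeries_chSeries (ν : Fin r → ℕ) : IsSymmetricSeries (chSeries ν) := fun e => by
  have h1 : ∀ i, PowerSeries.map ((MvPolynomial.rename e : MvPolynomial (Fin r) ℂ →ₐ[ℂ] _) :
      _ →+* MvPolynomial (Fin r) ℂ) (rootExp i) = rootExp (e i) := fun i => by
    rw [rootExp, map_expSeries, map_smul, MvPolynomial.rename_X]
    rfl
  have h2 : chSeries ν = MvPolynomial.aeval (fun i => rootExp (e i)) (schurCharacter ν) := by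
    conv_lhs => rw [chSeries, ← isSymmetric_schurCharacter ν e, MvPolynomial.aeval_rename]
    rfl
  conv_rhs => rw [h2]
  rw [chSeries]
  have h3 : ∀ p : MvPolynomial (Fin r) ℂ, PowerSeries.map
      ((MvPolynomial.rename e : MvPolynomial (Fin r) ℂ →ₐ[ℂ] _) : _ →+* MvPolynomial (Fin r) ℂ)
      (MvPolynomial.aeval rootExp p) = MvPolynomial.aeval (fun i => rootExp (e i)) p := fun p => by
    induction p using MvPolynomial.induction_on with
    | C c =>
      rw [MvPolynomial.aeval_C, MvPolynomial.aeval_C]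
      rw [IsScalarTower.algebraMap_apply ℂ (MvPolynomial (Fin r) ℂ)
        (PowerSeries (MvPolynomial (Fin r) ℂ)), PowerSeries.algebraMap_eq, PowerSeries.map_C]
      simp
    | add p q hp hq => rw [map_add, map_add, map_add, hp, hq]
    | mul_X p i hp =>
      rw [map_mul, map_mul, map_mul, hp, MvPolynomial.aeval_X, MvPolynomial.aeval_X, h1]
  exact h3 _

theorem chSchurPoly_eq_partialSum (ν : Fin r → ℕ) (D : ℕ) :
    chSchurPoly ν D = partialSum D (chSeries ν) := by
  rw [chSchurPoly, chSeries_eq_sum, map_sum]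
  refine Finset.sum_congr rfl fun μ _ => ?_
  have h1 : (2 * Real.pi * Complex.I : ℂ) • ∑ i, (μ i : ℂ) • (MvPolynomial.X i :
      MvPolynomial (Fin r) ℂ) = ∑ i, μ i • ((2 * Real.pi * Complex.I : ℂ) • MvPolynomial.X i) := by
    rw [Finset.smul_sum]
    exact Finset.sum_congr rfl fun i _ => by rw [smul_comm, Nat.cast_smul_eq_nsmul]
  rw [LinearMap.map_smul_of_tower, truncExp_eq_partialSum, h1, expSeries_sum]
  simp only [expSeries_nsmul]
  rfl

theorem expSeries_smul_sum_X_mem (c : ℂ) :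
    expSeries (c • ∑ i : Fin r, (MvPolynomial.X i : MvPolynomial (Fin r) ℂ)) ∈ gradedSeries r :=
  expSeries_mem_gradedSeries (by
    rw [Finset.smul_sum]
    exact MvPolynomial.IsHomogeneous.sum _ _ _ fun i _ => isHomogeneous_smul_X c i)

theorem isSymmetricSeries_expSeries_smul_sum_X (c : ℂ) :
    IsSymmetricSeries (expSeries (c • ∑ i : Fin r, (MvPolynomial.X i : MvPolynomial (Fin r) ℂ))) :=
  fun e => by
    rw [map_expSeries, map_smul, map_sum]
    simp only [MvPolynomial.rename_X]
    rw [Equiv.sum_comp e fun i => (MvPolynomial.X i : MvPolynomial (Fin r) ℂ)]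

end Graded

/-! ### Sums of the coefficients of a determinant -/

section TotalSum

variable {B : Type*} [CommRing B]

theorem partialSum_coe_eq_eval (q : Polynomial B) {E : ℕ} (hE : q.natDegree ≤ E) :
    partialSum E (q : PowerSeries B) = q.eval 1 := by
  rw [partialSum_apply, Polynomial.eval_eq_sum_range' (Nat.lt_succ_of_le hE)]
  simp

theorem exists_coe_eq {u : PowerSeries B} {D : ℕ}
    (hu : ∀ d, D < d → PowerSeries.coeff d u = 0) :
    ∃ q : Polynomial B, (q : PowerSeries B) = u ∧ q.eval 1 = partialSum D u := by
  have hq : ((PowerSeries.trunc (D + 1) u : Polynomial B) : PowerSeries B) = u := by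
    ext d
    rw [Polynomial.coeff_coe, PowerSeries.coeff_trunc]
    split_ifs with h
    · rfl
    · exact (hu d (by omega)).symm
  refine ⟨_, hq, ?_⟩
  rw [← partialSum_coe_eq_eval _
    (Nat.lt_succ_iff.1 (PowerSeries.natDegree_trunc_lt u D)), hq]

/-- The entries are polynomials in t, on which a long enough partial sum is evaluation at t = 1, a
ring homomorphism commuting with determinants. The determinant may have degree above D, hence the
separate threshold. -/
theorem exists_partialSum_det {n : Type*} [Fintype n] [DecidableEq n]
    (M : Matrix n n (PowerSeries B)) {D : ℕ}
    (hM : ∀ i j d, D < d → PowerSeries.coeff d (M i j) = 0) :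
    ∃ E₀, ∀ E, E₀ ≤ E →
      partialSum E M.det = (Matrix.of fun i j => partialSum D (M i j)).det := by
  choose P hP using fun i j => exists_coe_eq (hM i j)
  refine ⟨(Matrix.of P).det.natDegree, fun E hE => ?_⟩
  have h1 : M.det = ((Matrix.of P).det : Polynomial B) := by
    have h2 : M = (Polynomial.coeToPowerSeries.ringHom (R := B)).mapMatrix (Matrix.of P) := by
      ext1 i j
      exact (hP i j).1.symm
    rw [h2, ← RingHom.map_det]
    rfl
  rw [h1, partialSum_coe_eq_eval _ hE, ← Polynomial.coe_evalRingHom, RingHom.map_det]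
  congr 1
  ext1 i j
  exact (hP i j).2

theorem partialSum_X_pow_mul {u : PowerSeries B} {D : ℕ}
    (hu : ∀ d, D < d → PowerSeries.coeff d u = 0) (b E : ℕ) (hE : D + b ≤ E) :
    partialSum E (PowerSeries.X ^ b * u) = partialSum D u := by
  obtain ⟨k, rfl⟩ := Nat.exists_eq_add_of_le hE
  rw [partialSum_apply, partialSum_apply, show D + b + k + 1 = b + ((D + 1) + k) by ring,
    Finset.sum_range_add, Finset.sum_eq_zero, zero_add, Finset.sum_range_add]
  · have h1 : ∀ x, PowerSeries.coeff (b + x) (PowerSeries.X ^ b * u) = PowerSeries.coeff x u :=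
      fun x => by rw [add_comm, PowerSeries.coeff_X_pow_mul]
    simp only [h1]
    rw [add_eq_left]
    exact Finset.sum_eq_zero fun x _ => hu _ (by omega)
  · intro d hd
    rw [PowerSeries.coeff_X_pow_mul', if_neg (not_le.2 (Finset.mem_range.1 hd))]

end TotalSum

/-! ### Classes on projective space -/

theorem map_partialSum_scaledSeries {A B : Type*} [CommRing A] [Algebra ℂ A] [CommRing B]
    [Algebra ℂ B] (F : A →ₐ[ℂ] B) (D : ℕ) (a : A) (φ : PowerSeries ℂ) :
    F (partialSum D (scaledSeries a φ)) = partialSum D (scaledSeries (F a) φ) := by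
  rw [← map_scaledSeries F, partialSum_map]
  rfl

theorem pullback_specialClass_one (r N : ℕ) : pullback r N (specialClass r N 1)
    = toFlagRing r N (∑ i, MvPolynomial.X i) := by
  rw [specialClass, pullback_toHG]
  simp [hSym, MvPolynomial.hsymm_one]

theorem pullback_specialClass_one_one (N : ℕ) :
    pullback 1 N (specialClass 1 N 1) = toFlagRing 1 N (MvPolynomial.X 0) := by
  rw [pullback_specialClass_one, Fin.sum_univ_one]

theorem specialClass_pow_eq_zero {N k : ℕ} (hk : N ≤ k) : specialClass 1 N 1 ^ k = 0 := by
  apply pullback_injective 1 N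
  rw [map_pow, pullback_specialClass_one_one, ← map_pow, map_zero]
  exact Ideal.Quotient.eq_zero_iff_mem.2
    (Ideal.mem_of_dvd _ (pow_dvd_pow _ hk) (X_pow_mem_flagIdeal 0))

theorem pullback_gammaClass {r N : ℕ} (hrN : r ≤ N) : pullback r N (gammaClass r N)
    = toFlagRing r N (partialSum (r * (N - r)) (gammaRatio r N)) := by
  have h := toFlagRing_gammaPoly r (N - r)
  rw [Nat.sub_add_cancel hrN] at h
  exact h

theorem gammaRatio_one (N : ℕ) :
    gammaRatio 1 N = scaledSeries (MvPolynomial.X 0) (gammaSeries ^ N) := by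
  rw [gammaRatio, Fintype.prod_prod_type]
  simp [scaledSeries_zero _ constantCoeff_gammaSeries_inv]

theorem gammaClass_one {N : ℕ} (hN : 1 ≤ N) : gammaClass 1 N
    = partialSum (N - 1) (scaledSeries (specialClass 1 N 1) (gammaSeries ^ N)) := by
  apply pullback_injective 1 N
  rw [pullback_gammaClass hN, gammaRatio_one, one_mul]
  have h1 := map_partialSum_scaledSeries (B := FlagRing 1 N) (toFlagRing 1 N) (N - 1)
    (MvPolynomial.X 0) (gammaSeries ^ N)
  have h2 := map_partialSum_scaledSeries (A := HG 1 N) (B := FlagRing 1 N) (pullback 1 N) (N - 1)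
    (specialClass 1 N 1) (gammaSeries ^ N)
  have h3 : (pullback 1 N) (specialClass 1 N 1) = toFlagRing 1 N (MvPolynomial.X 0) :=
    pullback_specialClass_one_one N
  rw [h3] at h2
  exact h1.trans h2.symm

theorem gammaClass_mul_chO {N : ℕ} (hN : 1 ≤ N) (k : ℕ) : gammaClass 1 N * chO N (k : ℤ)
    = partialSum (N - 1) (scaledSeries (specialClass 1 N 1) (gammaSeries ^ N *
      PowerSeries.rescale (2 * Real.pi * Complex.I * k : ℂ) (PowerSeries.exp ℂ))) := by
  have h1 : chO N (k : ℤ) = partialSum (N - 1) (scaledSeries (specialClass 1 N 1)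
      (PowerSeries.rescale (2 * Real.pi * Complex.I * k : ℂ) (PowerSeries.exp ℂ))) := by
    rw [chO, truncExp_eq_partialSum, scaledSeries_rescale_exp]
    norm_num
  have h2 := partialSum_mul (N - 1) (1 : HG 1 N)
    (scaledSeries (specialClass 1 N 1) (gammaSeries ^ N)) (scaledSeries (specialClass 1 N 1)
      (PowerSeries.rescale (2 * Real.pi * Complex.I * k : ℂ) (PowerSeries.exp ℂ)))
    -- Since N ≥ 1, a total degree above N - 1 is at least N, and there the power of h vanishes.
    fun i j hij => by
      rw [coeff_scaledSeries, coeff_scaledSeries, smul_mul_smul_comm, ← pow_add,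
        specialClass_pow_eq_zero (by omega), smul_zero, mul_zero]
  rw [one_mul, one_mul] at h2
  rw [gammaClass_one hN, h1, ← h2, (scaledSeries (specialClass 1 N 1)).map_mul]

theorem rootEval_gammaClass_mul_chO {r N : ℕ} (hN : 1 ≤ N) (i : Fin r) (k : ℕ) :
    rootEval N i (gammaClass 1 N * chO N (k : ℤ))
      = partialSum (N - 1) (scaledSeries (toFlagRing r N (MvPolynomial.X i)) (gammaSeries ^ N *
        PowerSeries.rescale (2 * Real.pi * Complex.I * k : ℂ) (PowerSeries.exp ℂ))) := by
  rw [gammaClass_mul_chO hN, ← rootEval_specialClass]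
  exact map_partialSum_scaledSeries (A := HG 1 N) (B := FlagRing r N) (rootEval N i) (N - 1) _ _

/-! ### The determinant of Gamma classes -/

/-- The series `(2πi)^{r(r-1)/2} Γ(TG) Ch(S^ν V^*) e^{(r-1)πi σ_1}`. -/
def wedgeSeries {r : ℕ} (N : ℕ) (ν : Fin r → ℕ) : PowerSeries (MvPolynomial (Fin r) ℂ) :=
  (2 * Real.pi * Complex.I : ℂ) ^ r.choose 2 • (gammaRatio r N * chSeries ν *
    expSeries ((((r : ℂ) - 1) * Real.pi * Complex.I) • ∑ i, MvPolynomial.X i))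

theorem prod_expSeries_pow {r : ℕ} {A : Type*} [CommRing A] [Algebra ℂ A] (x : Fin r → A) :
    ∏ i, expSeries ((Real.pi * Complex.I : ℂ) • x i) ^ (r - 1)
      = expSeries ((((r : ℂ) - 1) * Real.pi * Complex.I) • ∑ i, x i) := by
  rcases Nat.eq_zero_or_pos r with rfl | hr
  · simp [expSeries_zero]
  simp only [← expSeries_nsmul]
  rw [← expSeries_sum, Finset.smul_sum]
  congr 1
  refine Finset.sum_congr rfl fun i _ => ?_
  rw [← Nat.cast_smul_eq_nsmul ℂ, smul_smul, Nat.cast_sub hr, Nat.cast_one, mul_assoc]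

/-- After the row factors Γ(1 + x_i t)^N are extracted, the alternant in e^{2πi x_i t} is its
Vandermonde determinant times a Schur polynomial. The first is given by `det_expSeries`; the second
is the Chern character series by the Weyl character formula. -/
theorem det_scaledSeries {r : ℕ} (N : ℕ) {ν : Fin r → ℕ} (hν : Antitone ν) :
    (Matrix.of fun i j : Fin r => scaledSeries (MvPolynomial.X i : MvPolynomial (Fin r) ℂ)
      (gammaSeries ^ N * PowerSeries.rescale
        (2 * Real.pi * Complex.I * (ν j + (j.rev : ℕ) : ℕ) : ℂ) (PowerSeries.exp ℂ))).det
      = PowerSeries.X ^ r.choose 2 * (PowerSeries.C (vand r) * wedgeSeries N ν) := by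
  have h1 : ∀ i j : Fin r, scaledSeries (MvPolynomial.X i : MvPolynomial (Fin r) ℂ)
      (gammaSeries ^ N * PowerSeries.rescale
        (2 * Real.pi * Complex.I * (ν j + (j.rev : ℕ) : ℕ) : ℂ) (PowerSeries.exp ℂ))
      = scaledSeries (MvPolynomial.X i) gammaSeries ^ N
        * rootExp i ^ (ν j + (j.rev : ℕ)) := fun i j => by
    rw [map_mul, map_pow, scaledSeries_rescale_exp, rootExp, ← expSeries_nsmul,
      ← Nat.cast_smul_eq_nsmul ℂ, smul_smul, mul_comm (2 * Real.pi * Complex.I : ℂ)]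
  have h2 : ∀ a : Fin r → ℕ, (Matrix.of fun i j : Fin r => (rootExp i : PowerSeries
      (MvPolynomial (Fin r) ℂ)) ^ a j).det
      = MvPolynomial.aeval rootExp (alternant r a).det := fun a => by
    rw [AlgHom.map_det]
    congr 1
    ext1 i j
    simp [alternant]
  have h3 : MvPolynomial.aeval rootExp (alternant r fun j => (j.rev : ℕ)).det
      = PowerSeries.C (algebraMap ℂ (MvPolynomial (Fin r) ℂ) (2 * Real.pi * Complex.I))
          ^ r.choose 2 *
        PowerSeries.X ^ r.choose 2 * PowerSeries.C (vand r) *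
        (∏ p : Fin r × Fin r, scaledSeries (MvPolynomial.X p.1 - MvPolynomial.X p.2 :
          MvPolynomial (Fin r) ℂ) gammaSeries⁻¹) *
        expSeries ((((r : ℂ) - 1) * Real.pi * Complex.I) • ∑ i, MvPolynomial.X i) := by
    rw [← h2, ← prod_expSeries_pow]
    exact det_expSeries MvPolynomial.X
  simp only [h1]
  have h4 := Matrix.det_mul_column (fun i : Fin r =>
    scaledSeries (MvPolynomial.X i : MvPolynomial (Fin r) ℂ) gammaSeries ^ N)
    (Matrix.of fun i j : Fin r => (rootExp i : PowerSeries
      (MvPolynomial (Fin r) ℂ)) ^ (ν j + (j.rev : ℕ)))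
  refine h4.trans ?_
  have h5 : ∀ u : PowerSeries (MvPolynomial (Fin r) ℂ),
      (2 * Real.pi * Complex.I : ℂ) ^ r.choose 2 • u
        = PowerSeries.C (algebraMap ℂ (MvPolynomial (Fin r) ℂ) (2 * Real.pi * Complex.I))
          ^ r.choose 2 * u := fun u => by
    rw [Algebra.smul_def, map_pow, IsScalarTower.algebraMap_apply ℂ (MvPolynomial (Fin r) ℂ)
      (PowerSeries (MvPolynomial (Fin r) ℂ)), PowerSeries.algebraMap_eq]
  rw [h2 fun j => ν j + (j.rev : ℕ), schurPoly_spec, map_mul, h3, schurPoly_eq_schurCharacter hν,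
    wedgeSeries, gammaRatio, chSeries, h5]
  ring

theorem wedgeSeries_mem_gradedSeries {r : ℕ} (N : ℕ) (ν : Fin r → ℕ) :
    wedgeSeries N ν ∈ gradedSeries r :=
  Subalgebra.smul_mem _ (mul_mem (mul_mem (gammaRatio_mem_gradedSeries r N)
    (chSeries_mem_gradedSeries ν)) (expSeries_smul_sum_X_mem _)) _

theorem IsSymmetricSeries.smul {r : ℕ} {u : PowerSeries (MvPolynomial (Fin r) ℂ)}
    (hu : IsSymmetricSeries u) (c : ℂ) : IsSymmetricSeries (c • u) := fun e => by
  ext1 d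
  have := congrArg (PowerSeries.coeff d) (hu e)
  rw [PowerSeries.coeff_map] at this ⊢
  rw [PowerSeries.coeff_smul]
  exact (map_smul (MvPolynomial.rename e) c _).trans (congrArg (c • ·) this)

theorem isSymmetricSeries_wedgeSeries {r : ℕ} (N : ℕ) (ν : Fin r → ℕ) :
    IsSymmetricSeries (wedgeSeries N ν) :=
  (((isSymmetricSeries_gammaRatio r N).mul (isSymmetricSeries_chSeries ν)).mul
    (isSymmetricSeries_expSeries_smul_sum_X _)).smul _

/-- Setting t = 1 in `det_scaledSeries` inside the flag ring: x_i^N = 0 makes the entries polynomial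
in t, and above the dimension the wedge series vanishes, so the factor t^{r(r-1)/2} only shifts
degrees. -/
theorem vand_mul_pullback_satake_gamma {r N : ℕ} (hrN : r ≤ N) {ν : Fin r → ℕ}
    (hν : Antitone ν) :
    toFlagRing r N (vand r) * pullback r N (satake r N (exteriorPower.ιMulti ℂ r fun j : Fin r =>
        gammaClass 1 N * chO N ((ν j + (j.rev : ℕ) : ℕ) : ℤ)))
      = toFlagRing r N (vand r)
        * toFlagRing r N (partialSum (r * (N - r)) (wedgeSeries N ν)) := by
  let F : Fin r → PowerSeries ℂ := fun j => gammaSeries ^ N * PowerSeries.rescale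
    (2 * Real.pi * Complex.I * (ν j + (j.rev : ℕ) : ℕ) : ℂ) (PowerSeries.exp ℂ)
  let π : MvPolynomial (Fin r) ℂ →+* FlagRing r N := (toFlagRing r N : _ →+* FlagRing r N)
  let M : Matrix (Fin r) (Fin r) (PowerSeries (FlagRing r N)) :=
    Matrix.of fun i j => scaledSeries (toFlagRing r N (MvPolynomial.X i)) (F j)
  have hM : ∀ i j d, N - 1 < d → PowerSeries.coeff d (M i j) = 0 := fun i j d hd => by
    have h0 : toFlagRing r N (MvPolynomial.X i) ^ d = 0 := by
      rw [← map_pow]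
      exact Ideal.Quotient.eq_zero_iff_mem.2
        (Ideal.mem_of_dvd _ (pow_dvd_pow _ (by omega)) (X_pow_mem_flagIdeal i))
    change PowerSeries.coeff d (scaledSeries (toFlagRing r N (MvPolynomial.X i)) (F j)) = 0
    rw [coeff_scaledSeries, h0, smul_zero]
  obtain ⟨E₀, hE₀⟩ := exists_partialSum_det M hM
  have hdet : M.det = PowerSeries.X ^ r.choose 2 *
      (PowerSeries.C (toFlagRing r N (vand r)) * PowerSeries.map π (wedgeSeries N ν)) := by
    have h1 := congrArg (PowerSeries.map π) (det_scaledSeries N hν)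
    rw [RingHom.map_det] at h1
    rw [map_mul, map_mul, map_pow, PowerSeries.map_X, PowerSeries.map_C] at h1
    rw [show (toFlagRing r N (vand r)) = π (vand r) from rfl, ← h1]
    exact congrArg Matrix.det (Matrix.ext fun i j =>
      (map_scaledSeries (toFlagRing r N) _ _).symm)
  have hs : ∀ d, r * (N - r) < d →
      PowerSeries.coeff d (PowerSeries.C (toFlagRing r N (vand r)) *
        PowerSeries.map π (wedgeSeries N ν)) = 0 := fun d hd => by
    rw [PowerSeries.coeff_C_mul, PowerSeries.coeff_map]
    have := coeff_map_toFlagRing_eq_zero hrN (wedgeSeries_mem_gradedSeries N ν)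
      (isSymmetricSeries_wedgeSeries N ν) hd
    rw [show π (PowerSeries.coeff d (wedgeSeries N ν)) = 0 from this, mul_zero]
  rw [vand_mul_pullback_satake]
  have h2 : (Matrix.of fun i j : Fin r => rootEval N i
      (gammaClass 1 N * chO N ((ν j + (j.rev : ℕ) : ℕ) : ℤ)))
      = Matrix.of fun i j => partialSum (N - 1) (M i j) := by
    ext1 i j
    -- Positivity of N comes from the existence of the index i; for r = 0 the matrices are empty.
    have hN : 1 ≤ N := (Nat.succ_le_of_lt (Nat.zero_lt_of_lt i.isLt)).trans hrN
    exact rootEval_gammaClass_mul_chO hN i _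
  -- The cutoff is large enough both for the determinant and for the series of degree at most r(N-r)
  -- shifted by r(r-1)/2.
  rw [h2, ← hE₀ (E₀ + (r * (N - r) + r.choose 2)) (by omega), hdet,
    partialSum_X_pow_mul hs _ _ (by omega)]
  have h3 : PowerSeries.C (toFlagRing r N (vand r)) * PowerSeries.map π (wedgeSeries N ν)
      = toFlagRing r N (vand r) • PowerSeries.map π (wedgeSeries N ν) :=
    (PowerSeries.smul_eq_C_mul _ _).symm
  rw [h3, map_smul, smul_eq_mul, partialSum_map]
  rfl

theorem expSeries_neg_mul_wedgeSeries {r : ℕ} (N : ℕ) (ν : Fin r → ℕ) :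
    expSeries ((-(((r : ℂ) - 1) * Real.pi * Complex.I)) • ∑ i, MvPolynomial.X i)
      * wedgeSeries N ν
      = (2 * Real.pi * Complex.I : ℂ) ^ r.choose 2 • (gammaRatio r N * chSeries ν) := by
  have h : expSeries ((-(((r : ℂ) - 1) * Real.pi * Complex.I)) • ∑ i : Fin r,
      (MvPolynomial.X i : MvPolynomial (Fin r) ℂ))
      * expSeries ((((r : ℂ) - 1) * Real.pi * Complex.I) • ∑ i, MvPolynomial.X i) = 1 := by
    rw [← expSeries_add, ← add_smul, neg_add_cancel, zero_smul, expSeries_zero]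
  rw [wedgeSeries, mul_smul_comm, mul_left_comm, h, mul_one]

end GammaGrassmannian

end

/-! ### The Gamma class identity on the Grassmannian -/

open GammaGrassmannian in
theorem proposition6p15 (r N : ℕ) (hrN : r ≤ N) (ν : Fin r → ℕ) (hν : Antitone ν)
    (hbox : ∀ j, ν j ≤ N - r) :
    gammaClass r N * chSchurBundle N ν =
      ((2 * Real.pi * Complex.I : ℂ) ^ r.choose 2)⁻¹ •
        (truncExp (r * (N - r))
            ((-(((r : ℂ) - 1) * Real.pi * Complex.I)) • specialClass r N 1) *
          satake r N (exteriorPower.ιMulti ℂ r fun j : Fin r =>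
            gammaClass 1 N * chO N ((ν j + (j.rev : ℕ) : ℕ) : ℤ))) := by
  apply eq_of_vand_mul_pullback_eq
  have hpi : (2 * Real.pi * Complex.I : ℂ) ^ r.choose 2 ≠ 0 :=
    pow_ne_zero _ Complex.two_pi_I_ne_zero
  have hch : pullback r N (chSchurBundle N ν)
      = toFlagRing r N (partialSum (r * (N - r)) (chSeries ν)) := by
    rw [← chSchurPoly_eq_partialSum]
    rfl
  have hexp : pullback r N (truncExp (r * (N - r))
      ((-(((r : ℂ) - 1) * Real.pi * Complex.I)) • specialClass r N 1))
      = toFlagRing r N (partialSum (r * (N - r))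
        (expSeries ((-(((r : ℂ) - 1) * Real.pi * Complex.I)) • ∑ i, MvPolynomial.X i))) := by
    rw [← truncExp_eq_partialSum]
    refine (map_truncExp (A := HG r N) (B := FlagRing r N) (pullback r N) _ _).trans ?_
    rw [map_smul, pullback_specialClass_one, ← map_smul]
    exact (map_truncExp (B := FlagRing r N) (toFlagRing r N) _ _).symm
  have hsat := vand_mul_pullback_satake_gamma hrN hν
  -- Every class is now a truncated symmetric graded series, so the products can be formed before
  -- truncating; the two exponentials in σ_1 cancel as series and leave only the power of 2πi.
  rw [map_mul, map_smul, map_mul, pullback_gammaClass hrN, hch, hexp, mul_smul_comm,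
    mul_left_comm _ _ (pullback r N (satake r N _)), hsat,
    ← toFlagRing_partialSum_mul hrN (gammaRatio_mem_gradedSeries r N)
      (isSymmetricSeries_gammaRatio r N) (chSeries_mem_gradedSeries ν)
      (isSymmetricSeries_chSeries ν),
    mul_left_comm, ← toFlagRing_partialSum_mul hrN (expSeries_smul_sum_X_mem _)
      (isSymmetricSeries_expSeries_smul_sum_X _) (wedgeSeries_mem_gradedSeries N ν)
      (isSymmetricSeries_wedgeSeries N ν), expSeries_neg_mul_wedgeSeries,
    LinearMap.map_smul_of_tower, map_smul, mul_smul_comm, smul_smul, inv_mul_cancel₀ hpi, one_smul]
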